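/- Let $L>0$, $a=c>0$, $a_1=c_1>0$, and let $M,d$ be real constants with $0\le d<1$. Let $\tau:[0,\infty)\to\mathbb R$ satisfy $\tau\in W^{2,\infty}(0,T)$ for every $T>0$ (identified with its $C^1$ representative) and, for all $t\ge 0$, $$0<\tau(0)\le\tau(t)\le M,\qquad \dot\tau(t)\le d .$$ Let $\alpha,\beta\in\mathbb R$ satisfy $$\alpha>\frac{|\beta|}{2a_1}\left(\frac{a_1^2+1-d}{1-d}\right).$$ Let $H=L^2(0,L)\times L^2(0,L)\times L^2(0,1)$ (real-valued functions), and for $t\ge 0$ let $A(t):D(A(t))\subset H\to H$ be the unbounded operator $$A(t)(\eta,\omega,z)=\Big(-\omega_x-a\,\omega_{xxx}-a_1\omega_{xxxxx},\ -\eta_x-a\,\eta_{xxx}-a_1\eta_{xxxxx},\ \tfrac{\dot\tau(t)\rho-1}{\tau(t)}\,z_\rho\Big)$$ whose domain $D(A(t))=D(A(0))$ consists of all $(\eta,\omega,z)\in H$ with $\eta,\omega\in H^5(0,L)\cap H^2_0(0,L)$, $z\in H^1(0,1)$, and $$\eta_{xx}(0)=0,\qquad z(0)=\eta_{xx}(L),\qquad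 \omega_{xx}(L)=\alpha\,\eta_{xx}(L)+\beta\,z(1).$$ Consider the Cauchy problem $$U'(t)=A(t)U(t)\quad (t>0),\qquad U(0)=U_0. \tag{CP}$$ A classical solution of the equation is a function $U\in C([0,\infty),H)$ such that, for every $t>0$, $U(t)\in D(A(t))$ and $U$ is differentiable at $t$ with $U'(t)=A(t)U(t)$. A (mild) solution of (CP) is a function $U\in C([0,\infty),H)$ with $U(0)=U_0$ that is the limit in $H$, uniformly on every bounded interval $[0,T]$, of classical solutions of the equation. Then for every $U_0\in H$ there exists a unique solution $U\in C([0,\infty),H)$ of (CP). Moreover, if $U_0\in D(A(0))$, then this $U$ is a classical solution and $$U\in C([0,\infty),D(A(0)))\cap C^1([0,\infty),H),$$ where $D(A(0))$ carries the graph norm of $A(0)$. -/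

import Mathlib

open MeasureTheory Set Filter Topology
open scoped ENNReal NNReal

namespace DelayedBoussinesq

noncomputable section

/-! ### Weak derivatives, Sobolev spaces and traces on a bounded open interval `(a, b)` -/

open scoped ContDiff in
/-- `g` is the weak derivative of `f` on the open interval `(a, b)`. -/
structure HasWeakDeriv (a b : ℝ) (f g : ℝ → ℝ) : Prop where
  left : LocallyIntegrableOn f (Ioo a b)
  right : LocallyIntegrableOn g (Ioo a b)
  eq : ∀ φ : ℝ → ℝ, ContDiff ℝ ∞ φ → HasCompactSupport φ → tsupport φ ⊆ Ioo a b →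
    ∫ x in Ioo a b, f x * deriv φ x = - ∫ x in Ioo a b, g x * φ x

/-- `f ∈ W^{k,p}(a, b)`: `f ∈ L^p(a, b)`, and, if `k > 0`, `f` has a weak derivative that belongs
to `W^{k-1,p}(a, b)`. -/
def MemSobolev (a b : ℝ) (p : ℝ≥0∞) : ℕ → (ℝ → ℝ) → Prop
  | 0, f => MemLp f p (volume.restrict (Ioo a b))
  | k + 1, f => MemLp f p (volume.restrict (Ioo a b)) ∧
      ∃ g, HasWeakDeriv a b f g ∧ MemSobolev a b p k g

open Classical in
/-- The weak derivative of `f` on `(a, b)`, unique up to a null set when it exists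
(and `0` if there is none). -/
def weakDeriv (a b : ℝ) (f : ℝ → ℝ) : ℝ → ℝ :=
  if h : ∃ g, HasWeakDeriv a b f g then h.choose else 0

/-- The weak derivative of order `k` of `f` on `(a, b)`. -/
def iterWeakDeriv (a b : ℝ) (k : ℕ) (f : ℝ → ℝ) : ℝ → ℝ := (weakDeriv a b)^[k] f

/-- `f`, given up to null sets on `(a, b)`, has a continuous representative on `[a, b]`, and that
representative takes the value `v` at the point `x ∈ [a, b]`. -/
def HasTrace (a b : ℝ) (f : ℝ → ℝ) (x v : ℝ) : Prop :=
  x ∈ Icc a b ∧ ∃ u : ℝ → ℝ, ContinuousOn u (Icc a b) ∧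
    f =ᵐ[volume.restrict (Ioo a b)] u ∧ u x = v

section Lemmas

variable {a b : ℝ} {p : ℝ≥0∞} {f g f' g' : ℝ → ℝ}

theorem locallyIntegrableOn_congr (h : f =ᵐ[volume.restrict (Ioo a b)] f')
    (hf : LocallyIntegrableOn f (Ioo a b)) : LocallyIntegrableOn f' (Ioo a b) := by
  intro x hx
  obtain ⟨t, ht, hi⟩ := hf x hx
  refine ⟨t ∩ Ioo a b, inter_mem ht self_mem_nhdsWithin, ?_⟩
  exact (hi.mono_set inter_subset_left).congr_fun_ae (ae_restrict_of_ae_restrict_of_subset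
    inter_subset_right h)

theorem HasWeakDeriv.congr (h : f =ᵐ[volume.restrict (Ioo a b)] f')
    (hf : HasWeakDeriv a b f g) : HasWeakDeriv a b f' g := by
  refine ⟨locallyIntegrableOn_congr h hf.left, hf.right, fun φ h1 h2 h3 => ?_⟩
  rw [← hf.eq φ h1 h2 h3]
  refine integral_congr_ae ?_
  filter_upwards [h] with x hx
  rw [hx]

theorem weakDeriv_congr (h : f =ᵐ[volume.restrict (Ioo a b)] f') :
    weakDeriv a b f = weakDeriv a b f' := by
  have : (fun g => HasWeakDeriv a b f g) = fun g => HasWeakDeriv a b f' g := by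
    funext g
    exact propext ⟨fun k => k.congr h, fun k => k.congr h.symm⟩
  have h2 : HasWeakDeriv a b f = HasWeakDeriv a b f' := this
  unfold weakDeriv
  rw [h2]

theorem integrable_mul_test (hf : LocallyIntegrableOn f (Ioo a b)) {φ : ℝ → ℝ}
    (h1 : Continuous φ) (h2 : HasCompactSupport φ) (h3 : tsupport φ ⊆ Ioo a b) :
    Integrable (fun x => f x * φ x) (volume.restrict (Ioo a b)) := by
  have hK : IntegrableOn f (tsupport φ) :=
    hf.integrableOn_compact_subset h3 h2
  have h4 : IntegrableOn (fun x => f x * φ x) (tsupport φ) :=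
    hK.mul_continuousOn h1.continuousOn h2
  have h5 : Integrable (fun x => f x * φ x) :=
    (integrableOn_iff_integrable_of_support_subset (fun x hx => by
      have : φ x ≠ 0 := fun h0 => hx (by simp [h0])
      exact subset_tsupport _ this)).1 h4
  exact h5.integrableOn

theorem tsupport_deriv_subset' {φ : ℝ → ℝ} : tsupport (deriv φ) ⊆ tsupport φ :=
  closure_minimal (support_deriv_subset) (isClosed_tsupport φ)

theorem HasWeakDeriv.add (hf : HasWeakDeriv a b f f') (hg : HasWeakDeriv a b g g') :
    HasWeakDeriv a b (f + g) (f' + g') := by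
  refine ⟨hf.left.add hg.left, hf.right.add hg.right, fun φ h1 h2 h3 => ?_⟩
  have hd : Continuous (deriv φ) := h1.continuous_deriv (by simp)
  have h3' := (tsupport_deriv_subset' (φ := φ)).trans h3
  simp only [Pi.add_apply, add_mul]
  rw [integral_add (integrable_mul_test hf.left hd h2.deriv h3')
      (integrable_mul_test hg.left hd h2.deriv h3'),
    integral_add (integrable_mul_test hf.right h1.continuous h2 h3)
      (integrable_mul_test hg.right h1.continuous h2 h3),
    hf.eq φ h1 h2 h3, hg.eq φ h1 h2 h3]
  ring

theorem HasWeakDeriv.smul (c : ℝ) (hf : HasWeakDeriv a b f f') :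
    HasWeakDeriv a b (c • f) (c • f') := by
  refine ⟨hf.left.smul c, hf.right.smul c, fun φ h1 h2 h3 => ?_⟩
  simp only [Pi.smul_apply, smul_eq_mul, mul_assoc]
  rw [integral_const_mul, integral_const_mul, hf.eq φ h1 h2 h3]
  ring

theorem hasWeakDeriv_zero : HasWeakDeriv a b 0 0 := by
  refine ⟨locallyIntegrableOn_zero, locallyIntegrableOn_zero, fun φ _ _ _ => ?_⟩
  simp

theorem HasWeakDeriv.unique (h : HasWeakDeriv a b f g) (h' : HasWeakDeriv a b f g') :
    g =ᵐ[volume.restrict (Ioo a b)] g' := by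
  have key := isOpen_Ioo.ae_eq_zero_of_integral_contDiff_smul_eq_zero
    (μ := volume.restrict (Ioo a b)) (U := Ioo a b) (f := g - g') ?_ ?_
  · filter_upwards [key, ae_restrict_mem measurableSet_Ioo] with x hx hm
    exact sub_eq_zero.1 (hx hm)
  · intro x hx
    obtain ⟨t, ht, hi⟩ := (h.right.sub h'.right) x hx
    exact ⟨t, ht, hi.mono_measure Measure.restrict_le_self⟩
  · intro φ h1 h2 h3
    have e1 := h.eq φ h1 h2 h3
    have e2 := h'.eq φ h1 h2 h3
    have i1 := integrable_mul_test h.right h1.continuous h2 h3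
    have i2 := integrable_mul_test h'.right h1.continuous h2 h3
    have : ∀ x, φ x • (g - g') x = g x * φ x - g' x * φ x := fun x => by
      simp only [Pi.sub_apply, smul_eq_mul]; ring
    simp only [this]
    rw [integral_sub i1 i2]
    linarith

theorem hasWeakDeriv_weakDeriv (h : ∃ g, HasWeakDeriv a b f g) :
    HasWeakDeriv a b f (weakDeriv a b f) := by
  unfold weakDeriv
  rw [dif_pos h]
  exact h.choose_spec

theorem weakDeriv_ae_eq (h : HasWeakDeriv a b f g) :
    weakDeriv a b f =ᵐ[volume.restrict (Ioo a b)] g :=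
  (hasWeakDeriv_weakDeriv ⟨g, h⟩).unique h

theorem MemSobolev.memLp {k : ℕ} (h : MemSobolev a b p k f) :
    MemLp f p (volume.restrict (Ioo a b)) := by
  cases k with
  | zero => exact h
  | succ k => exact h.1

theorem MemSobolev.congr {k : ℕ} (hff' : f =ᵐ[volume.restrict (Ioo a b)] f')
    (h : MemSobolev a b p k f) : MemSobolev a b p k f' := by
  cases k with
  | zero => exact MemLp.ae_eq hff' h
  | succ k =>
    obtain ⟨h1, g, hg, hk⟩ := h
    exact ⟨MemLp.ae_eq hff' h1, g, hg.congr hff', hk⟩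

theorem MemSobolev.hasWeakDeriv {k : ℕ} (h : MemSobolev a b p (k + 1) f) :
    HasWeakDeriv a b f (weakDeriv a b f) := by
  obtain ⟨_, g, hg, _⟩ := h
  exact hasWeakDeriv_weakDeriv ⟨g, hg⟩

theorem MemSobolev.weakDeriv {k : ℕ} (h : MemSobolev a b p (k + 1) f) :
    MemSobolev a b p k (weakDeriv a b f) := by
  obtain ⟨_, g, hg, hk⟩ := h
  exact hk.congr (weakDeriv_ae_eq hg).symm

theorem MemSobolev.add {k : ℕ} (hf : MemSobolev a b p k f) (hg : MemSobolev a b p k g) :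
    MemSobolev a b p k (f + g) := by
  induction k generalizing f g with
  | zero => exact MemLp.add hf hg
  | succ k ih =>
    obtain ⟨h1, f', hf', hk⟩ := hf
    obtain ⟨h1', g', hg', hk'⟩ := hg
    exact ⟨h1.add h1', f' + g', hf'.add hg', ih hk hk'⟩

theorem MemSobolev.smul {k : ℕ} (c : ℝ) (hf : MemSobolev a b p k f) :
    MemSobolev a b p k (c • f) := by
  induction k generalizing f with
  | zero => exact MemLp.const_smul hf c
  | succ k ih =>
    obtain ⟨h1, f', hf', hk⟩ := hf
    exact ⟨h1.const_smul c, c • f', hf'.smul c, ih hk⟩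

theorem memSobolev_zero {k : ℕ} : MemSobolev a b p k 0 := by
  induction k with
  | zero => exact MemLp.zero
  | succ k ih => exact ⟨MemLp.zero, 0, hasWeakDeriv_zero, ih⟩

theorem iterWeakDeriv_congr {k : ℕ} (h : f =ᵐ[volume.restrict (Ioo a b)] f') :
    iterWeakDeriv a b k f =ᵐ[volume.restrict (Ioo a b)] iterWeakDeriv a b k f' := by
  cases k with
  | zero => exact h
  | succ k =>
    simp only [iterWeakDeriv, Function.iterate_succ, Function.comp_apply]
    rw [weakDeriv_congr h]

theorem MemSobolev.iterWeakDeriv {k j : ℕ} (hf : MemSobolev a b p (k + j) f) :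
    MemSobolev a b p k (iterWeakDeriv a b j f) := by
  induction j generalizing f with
  | zero => exact hf
  | succ j ih =>
    have h1 : MemSobolev a b p (k + j) (DelayedBoussinesq.weakDeriv a b f) :=
      MemSobolev.weakDeriv hf
    exact ih h1

theorem iterWeakDeriv_add {k : ℕ} (hf : MemSobolev a b p k f) (hg : MemSobolev a b p k g) :
    iterWeakDeriv a b k (f + g) =ᵐ[volume.restrict (Ioo a b)]
      iterWeakDeriv a b k f + iterWeakDeriv a b k g := by
  induction k generalizing f g with
  | zero => exact EventuallyEq.rfl
  | succ k ih =>
    have h1 := weakDeriv_ae_eq (hf.hasWeakDeriv.add hg.hasWeakDeriv)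
    exact (iterWeakDeriv_congr (k := k) h1).trans (ih hf.weakDeriv hg.weakDeriv)

theorem iterWeakDeriv_smul {k : ℕ} (c : ℝ) (hf : MemSobolev a b p k f) :
    iterWeakDeriv a b k (c • f) =ᵐ[volume.restrict (Ioo a b)]
      c • iterWeakDeriv a b k f := by
  induction k generalizing f with
  | zero => exact EventuallyEq.rfl
  | succ k ih =>
    have h1 := weakDeriv_ae_eq (hf.hasWeakDeriv.smul c)
    exact (iterWeakDeriv_congr (k := k) h1).trans (ih hf.weakDeriv)

theorem MemSobolev.of_le {k j : ℕ} (hjk : j ≤ k) (hf : MemSobolev a b p k f) :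
    MemSobolev a b p j f := by
  induction k generalizing f j with
  | zero =>
    obtain rfl : j = 0 := by omega
    exact hf
  | succ k ih =>
    cases j with
    | zero => exact hf.1
    | succ j =>
      obtain ⟨h1, g, hg, hk⟩ := hf
      exact ⟨h1, g, hg, ih (by omega) hk⟩

theorem HasTrace.add {x v w : ℝ} (hf : HasTrace a b f x v) (hg : HasTrace a b g x w) :
    HasTrace a b (f + g) x (v + w) := by
  obtain ⟨hx, u, hu, hfu, rfl⟩ := hf
  obtain ⟨_, u', hu', hgu, rfl⟩ := hg
  exact ⟨hx, u + u', hu.add hu', hfu.add hgu, rfl⟩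

theorem HasTrace.smul {x v : ℝ} (c : ℝ) (hf : HasTrace a b f x v) :
    HasTrace a b (c • f) x (c * v) := by
  obtain ⟨hx, u, hu, hfu, rfl⟩ := hf
  exact ⟨hx, c • u, hu.const_smul c, hfu.const_smul c, rfl⟩

theorem HasTrace.congr {x v : ℝ} (h : f =ᵐ[volume.restrict (Ioo a b)] f')
    (hf : HasTrace a b f x v) : HasTrace a b f' x v := by
  obtain ⟨hx, u, hu, hfu, hv⟩ := hf
  exact ⟨hx, u, hu, h.symm.trans hfu, hv⟩

theorem hasTrace_zero {x : ℝ} (hx : x ∈ Icc a b) : HasTrace a b 0 x 0 :=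
  ⟨hx, 0, continuousOn_const, EventuallyEq.rfl, rfl⟩

end Lemmas

/-! ### The state space and the time-dependent operator -/

/-- The real Lebesgue space `L²(a, b)`. -/
abbrev L2 (a b : ℝ) := Lp ℝ 2 (volume.restrict (Ioo a b))

/-- The Hilbert space `H = L²(0,L) × L²(0,L) × L²(0,1)` of states `(η, ω, z)`. -/
abbrev State (L : ℝ) := WithLp 2 (L2 0 L × WithLp 2 (L2 0 L × L2 0 1))

/-- First component `η` of a state. -/
abbrev State.eta {L : ℝ} (U : State L) : L2 0 L := U.fst

/-- Second component `ω` of a state. -/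
abbrev State.omega {L : ℝ} (U : State L) : L2 0 L := U.snd.fst

/-- Third component `z` of a state. -/
abbrev State.zed {L : ℝ} (U : State L) : L2 0 1 := U.snd.snd

/-- The conditions that define the domain: `η, ω ∈ H⁵(0,L) ∩ H²₀(0,L)`, `z ∈ H¹(0,1)`,
`η_xx(0) = 0`, `z(0) = η_xx(L)` and `ω_xx(L) = α η_xx(L) + β z(1)`.  For functions in `H⁵(0,L)`,
membership in `H²₀(0,L)` means that the function and its first derivative vanish at `0` and `L`. -/
structure InDomain (L α β : ℝ) (η ω z : ℝ → ℝ) : Prop where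
  eta_sobolev : MemSobolev 0 L 2 5 η
  omega_sobolev : MemSobolev 0 L 2 5 ω
  z_sobolev : MemSobolev 0 1 2 1 z
  eta_zero : HasTrace 0 L η 0 0
  eta_L : HasTrace 0 L η L 0
  eta_x_zero : HasTrace 0 L (iterWeakDeriv 0 L 1 η) 0 0
  eta_x_L : HasTrace 0 L (iterWeakDeriv 0 L 1 η) L 0
  omega_zero : HasTrace 0 L ω 0 0
  omega_L : HasTrace 0 L ω L 0
  omega_x_zero : HasTrace 0 L (iterWeakDeriv 0 L 1 ω) 0 0
  omega_x_L : HasTrace 0 L (iterWeakDeriv 0 L 1 ω) L 0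
  eta_xx_zero : HasTrace 0 L (iterWeakDeriv 0 L 2 η) 0 0
  feedback : ∃ r s : ℝ, HasTrace 0 L (iterWeakDeriv 0 L 2 η) L r ∧ HasTrace 0 1 z 0 r ∧
    HasTrace 0 1 z 1 s ∧ HasTrace 0 L (iterWeakDeriv 0 L 2 ω) L (α * r + β * s)

section DomainLemmas

variable {L α β : ℝ} {η ω z η' ω' z' : ℝ → ℝ}

theorem InDomain.congr (h : InDomain L α β η ω z)
    (h1 : η =ᵐ[volume.restrict (Ioo 0 L)] η') (h2 : ω =ᵐ[volume.restrict (Ioo 0 L)] ω')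
    (h3 : z =ᵐ[volume.restrict (Ioo 0 1)] z') : InDomain L α β η' ω' z' := by
  obtain ⟨r, s, k1, k2, k3, k4⟩ := h.feedback
  exact ⟨h.eta_sobolev.congr h1, h.omega_sobolev.congr h2, h.z_sobolev.congr h3,
    h.eta_zero.congr h1, h.eta_L.congr h1, h.eta_x_zero.congr (iterWeakDeriv_congr h1),
    h.eta_x_L.congr (iterWeakDeriv_congr h1), h.omega_zero.congr h2, h.omega_L.congr h2,
    h.omega_x_zero.congr (iterWeakDeriv_congr h2), h.omega_x_L.congr (iterWeakDeriv_congr h2),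
    h.eta_xx_zero.congr (iterWeakDeriv_congr h1),
    r, s, k1.congr (iterWeakDeriv_congr h1), k2.congr h3, k3.congr h3,
    k4.congr (iterWeakDeriv_congr h2)⟩

theorem InDomain.add (h : InDomain L α β η ω z) (h' : InDomain L α β η' ω' z') :
    InDomain L α β (η + η') (ω + ω') (z + z') := by
  obtain ⟨r, s, k1, k2, k3, k4⟩ := h.feedback
  obtain ⟨r', s', k1', k2', k3', k4'⟩ := h'.feedback
  have e : ∀ j ≤ 5, iterWeakDeriv 0 L j η + iterWeakDeriv 0 L j η'
      =ᵐ[volume.restrict (Ioo 0 L)] iterWeakDeriv 0 L j (η + η') := fun j hj =>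
    (iterWeakDeriv_add (h.eta_sobolev.of_le hj) (h'.eta_sobolev.of_le hj)).symm
  have o : ∀ j ≤ 5, iterWeakDeriv 0 L j ω + iterWeakDeriv 0 L j ω'
      =ᵐ[volume.restrict (Ioo 0 L)] iterWeakDeriv 0 L j (ω + ω') := fun j hj =>
    (iterWeakDeriv_add (h.omega_sobolev.of_le hj) (h'.omega_sobolev.of_le hj)).symm
  refine ⟨h.eta_sobolev.add h'.eta_sobolev, h.omega_sobolev.add h'.omega_sobolev,
    h.z_sobolev.add h'.z_sobolev, ?_, ?_, ?_, ?_, ?_, ?_, ?_, ?_, ?_, r + r', s + s', ?_, ?_, ?_, ?_⟩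
  · simpa using h.eta_zero.add h'.eta_zero
  · simpa using h.eta_L.add h'.eta_L
  · simpa using (h.eta_x_zero.add h'.eta_x_zero).congr (e 1 (by norm_num))
  · simpa using (h.eta_x_L.add h'.eta_x_L).congr (e 1 (by norm_num))
  · simpa using h.omega_zero.add h'.omega_zero
  · simpa using h.omega_L.add h'.omega_L
  · simpa using (h.omega_x_zero.add h'.omega_x_zero).congr (o 1 (by norm_num))
  · simpa using (h.omega_x_L.add h'.omega_x_L).congr (o 1 (by norm_num))
  · simpa using (h.eta_xx_zero.add h'.eta_xx_zero).congr (e 2 (by norm_num))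
  · exact (k1.add k1').congr (e 2 (by norm_num))
  · exact k2.add k2'
  · exact k3.add k3'
  · have := (k4.add k4').congr (o 2 (by norm_num))
    rwa [show α * r + β * s + (α * r' + β * s') = α * (r + r') + β * (s + s') by ring] at this

theorem InDomain.smul (c : ℝ) (h : InDomain L α β η ω z) :
    InDomain L α β (c • η) (c • ω) (c • z) := by
  obtain ⟨r, s, k1, k2, k3, k4⟩ := h.feedback
  have e : ∀ j ≤ 5, c • iterWeakDeriv 0 L j η
      =ᵐ[volume.restrict (Ioo 0 L)] iterWeakDeriv 0 L j (c • η) := fun j hj =>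
    (iterWeakDeriv_smul c (h.eta_sobolev.of_le hj)).symm
  have o : ∀ j ≤ 5, c • iterWeakDeriv 0 L j ω
      =ᵐ[volume.restrict (Ioo 0 L)] iterWeakDeriv 0 L j (c • ω) := fun j hj =>
    (iterWeakDeriv_smul c (h.omega_sobolev.of_le hj)).symm
  refine ⟨h.eta_sobolev.smul c, h.omega_sobolev.smul c,
    h.z_sobolev.smul c, ?_, ?_, ?_, ?_, ?_, ?_, ?_, ?_, ?_, c * r, c * s, ?_, ?_, ?_, ?_⟩
  · simpa using h.eta_zero.smul c
  · simpa using h.eta_L.smul c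
  · simpa using (h.eta_x_zero.smul c).congr (e 1 (by norm_num))
  · simpa using (h.eta_x_L.smul c).congr (e 1 (by norm_num))
  · simpa using h.omega_zero.smul c
  · simpa using h.omega_L.smul c
  · simpa using (h.omega_x_zero.smul c).congr (o 1 (by norm_num))
  · simpa using (h.omega_x_L.smul c).congr (o 1 (by norm_num))
  · simpa using (h.eta_xx_zero.smul c).congr (e 2 (by norm_num))
  · exact (k1.smul c).congr (e 2 (by norm_num))
  · exact k2.smul c
  · exact k3.smul c
  · have := (k4.smul c).congr (o 2 (by norm_num))
    rwa [show c * (α * r + β * s) = α * (c * r) + β * (c * s) by ring] at this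

theorem inDomain_zero (hL : 0 ≤ L) : InDomain L α β 0 0 0 := by
  have w : ∀ j, (0 : ℝ → ℝ) =ᵐ[volume.restrict (Ioo 0 L)] iterWeakDeriv 0 L j 0 := fun j => by
    have := iterWeakDeriv_smul (p := 2) (k := j) (a := 0) (b := L) (f := 0) 0 memSobolev_zero
    simpa using this.symm
  have t0 : ∀ j, HasTrace 0 L (iterWeakDeriv 0 L j 0) 0 0 := fun j =>
    (hasTrace_zero (left_mem_Icc.2 hL)).congr (w j)
  have tL : ∀ j, HasTrace 0 L (iterWeakDeriv 0 L j 0) L 0 := fun j =>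
    (hasTrace_zero (right_mem_Icc.2 hL)).congr (w j)
  exact ⟨memSobolev_zero, memSobolev_zero, memSobolev_zero, t0 0, tL 0, t0 1, tL 1, t0 0, tL 0,
    t0 1, tL 1, t0 2, 0, 0, tL 2, hasTrace_zero (by simp), hasTrace_zero (by simp),
    by simpa using tL 2⟩

end DomainLemmas

/-- The spatial part `-(f_x + a f_xxx + a₁ f_xxxxx)` on `(0, L)`. -/
def dispersion (L a a₁ : ℝ) (f : ℝ → ℝ) : ℝ → ℝ := fun x =>
  -iterWeakDeriv 0 L 1 f x - a * iterWeakDeriv 0 L 3 f x - a₁ * iterWeakDeriv 0 L 5 f x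

/-- The transport part `((τ'(t) ρ - 1) / τ(t)) z_ρ` on `(0, 1)`.
The derivative of `τ`, a function on `[0, ∞)`, is one-sided at `t = 0`. -/
def transport (τ : ℝ → ℝ) (t : ℝ) (z : ℝ → ℝ) : ℝ → ℝ := fun ρ =>
  (derivWithin τ (Ici 0) t * ρ - 1) / τ t * iterWeakDeriv 0 1 1 z ρ

section OperatorLemmas

variable {L a a₁ : ℝ} {f g z y : ℝ → ℝ} {τ : ℝ → ℝ} {t : ℝ}

theorem memLp_dispersion (hf : MemSobolev 0 L 2 5 f) :
    MemLp (dispersion L a a₁ f) 2 (volume.restrict (Ioo 0 L)) := by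
  have h : ∀ j ≤ 5, MemLp (iterWeakDeriv 0 L j f) 2 (volume.restrict (Ioo 0 L)) := fun j hj =>
    (MemSobolev.iterWeakDeriv (k := 0) (j := j) (hf.of_le (by omega))).memLp
  exact ((h 1 (by norm_num)).neg.sub ((h 3 (by norm_num)).const_mul a)).sub
    ((h 5 le_rfl).const_mul a₁)

theorem memLp_transport (hz : MemSobolev 0 1 2 1 z) :
    MemLp (transport τ t z) 2 (volume.restrict (Ioo 0 1)) := by
  have h : MemLp (iterWeakDeriv 0 1 1 z) 2 (volume.restrict (Ioo 0 1)) :=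
    (MemSobolev.iterWeakDeriv (k := 0) (j := 1) hz).memLp
  refine MemLp.mul (p := ∞) (q := 2) h ?_
  refine memLp_top_of_bound (Measurable.aestronglyMeasurable (by fun_prop))
    ((|derivWithin τ (Ici 0) t| + 1) / |τ t|) ?_
  filter_upwards [ae_restrict_mem measurableSet_Ioo] with ρ hρ
  rw [Real.norm_eq_abs, abs_div]
  gcongr
  refine (abs_sub _ _).trans ?_
  rw [abs_mul, abs_one, abs_of_pos hρ.1]
  nlinarith [hρ.2, abs_nonneg (derivWithin τ (Ici 0) t)]

theorem dispersion_congr (h : f =ᵐ[volume.restrict (Ioo 0 L)] g) :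
    dispersion L a a₁ f =ᵐ[volume.restrict (Ioo 0 L)] dispersion L a a₁ g := by
  filter_upwards [iterWeakDeriv_congr (k := 1) h, iterWeakDeriv_congr (k := 3) h,
    iterWeakDeriv_congr (k := 5) h] with x h1 h3 h5
  simp only [dispersion, h1, h3, h5]

theorem dispersion_add (hf : MemSobolev 0 L 2 5 f) (hg : MemSobolev 0 L 2 5 g) :
    dispersion L a a₁ (f + g) =ᵐ[volume.restrict (Ioo 0 L)]
      dispersion L a a₁ f + dispersion L a a₁ g := by
  filter_upwards [iterWeakDeriv_add (k := 1) (hf.of_le (by norm_num)) (hg.of_le (by norm_num)),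
    iterWeakDeriv_add (k := 3) (hf.of_le (by norm_num)) (hg.of_le (by norm_num)),
    iterWeakDeriv_add (k := 5) hf hg] with x h1 h3 h5
  simp only [dispersion, h1, h3, h5, Pi.add_apply]
  ring

theorem dispersion_smul (c : ℝ) (hf : MemSobolev 0 L 2 5 f) :
    dispersion L a a₁ (c • f) =ᵐ[volume.restrict (Ioo 0 L)] c • dispersion L a a₁ f := by
  filter_upwards [iterWeakDeriv_smul (k := 1) c (hf.of_le (by norm_num)),
    iterWeakDeriv_smul (k := 3) c (hf.of_le (by norm_num)),
    iterWeakDeriv_smul (k := 5) c hf] with x h1 h3 h5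
  simp only [dispersion, h1, h3, h5, Pi.smul_apply, smul_eq_mul]
  ring

theorem transport_congr (h : z =ᵐ[volume.restrict (Ioo 0 1)] y) :
    transport τ t z =ᵐ[volume.restrict (Ioo 0 1)] transport τ t y := by
  filter_upwards [iterWeakDeriv_congr (k := 1) h] with x h1
  simp only [transport, h1]

theorem transport_add (hz : MemSobolev 0 1 2 1 z) (hy : MemSobolev 0 1 2 1 y) :
    transport τ t (z + y) =ᵐ[volume.restrict (Ioo 0 1)] transport τ t z + transport τ t y := by
  filter_upwards [iterWeakDeriv_add (k := 1) hz hy] with x h1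
  simp only [transport, h1, Pi.add_apply]
  ring

theorem transport_smul (c : ℝ) (hz : MemSobolev 0 1 2 1 z) :
    transport τ t (c • z) =ᵐ[volume.restrict (Ioo 0 1)] c • transport τ t z := by
  filter_upwards [iterWeakDeriv_smul (k := 1) c hz] with x h1
  simp only [transport, h1, Pi.smul_apply, smul_eq_mul]
  ring

theorem dispersion_toLp_add {F G : L2 0 L} (hF : MemSobolev 0 L 2 5 F)
    (hG : MemSobolev 0 L 2 5 G) (hFG : MemSobolev 0 L 2 5 (F + G : L2 0 L)) :
    (memLp_dispersion (a := a) (a₁ := a₁) hFG).toLp =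
      (memLp_dispersion (a := a) (a₁ := a₁) hF).toLp +
        (memLp_dispersion (a := a) (a₁ := a₁) hG).toLp := by
  rw [← MemLp.toLp_add]
  exact MemLp.toLp_congr _ _ ((dispersion_congr (Lp.coeFn_add _ _)).trans (dispersion_add hF hG))

theorem dispersion_toLp_smul (c : ℝ) {F : L2 0 L} (hF : MemSobolev 0 L 2 5 F)
    (hcF : MemSobolev 0 L 2 5 (c • F : L2 0 L)) :
    (memLp_dispersion (a := a) (a₁ := a₁) hcF).toLp =
      c • (memLp_dispersion (a := a) (a₁ := a₁) hF).toLp := by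
  rw [← MemLp.toLp_const_smul]
  exact MemLp.toLp_congr _ _ ((dispersion_congr (Lp.coeFn_smul _ _)).trans (dispersion_smul c hF))

theorem transport_toLp_add {F G : L2 0 1} (hF : MemSobolev 0 1 2 1 F)
    (hG : MemSobolev 0 1 2 1 G) (hFG : MemSobolev 0 1 2 1 (F + G : L2 0 1)) :
    (memLp_transport (τ := τ) (t := t) hFG).toLp =
      (memLp_transport (τ := τ) (t := t) hF).toLp +
        (memLp_transport (τ := τ) (t := t) hG).toLp := by
  rw [← MemLp.toLp_add]
  exact MemLp.toLp_congr _ _ ((transport_congr (Lp.coeFn_add _ _)).trans (transport_add hF hG))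

theorem transport_toLp_smul (c : ℝ) {F : L2 0 1} (hF : MemSobolev 0 1 2 1 F)
    (hcF : MemSobolev 0 1 2 1 (c • F : L2 0 1)) :
    (memLp_transport (τ := τ) (t := t) hcF).toLp =
      c • (memLp_transport (τ := τ) (t := t) hF).toLp := by
  rw [← MemLp.toLp_const_smul]
  exact MemLp.toLp_congr _ _ ((transport_congr (Lp.coeFn_smul _ _)).trans (transport_smul c hF))

end OperatorLemmas

/-- The domain of the operators `A(t)`, the same for all `t`. -/
def domainA {L : ℝ} (hL : 0 < L) (α β : ℝ) : Submodule ℝ (State L) where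
  carrier := {U | InDomain L α β U.eta U.omega U.zed}
  zero_mem' := (inDomain_zero hL.le).congr (Lp.coeFn_zero _ _ _).symm (Lp.coeFn_zero _ _ _).symm
    (Lp.coeFn_zero _ _ _).symm
  add_mem' := fun hU hV => (InDomain.add hU hV).congr (Lp.coeFn_add _ _).symm
    (Lp.coeFn_add _ _).symm (Lp.coeFn_add _ _).symm
  smul_mem' := fun c _ hU => (InDomain.smul c hU).congr (Lp.coeFn_smul _ _).symm
    (Lp.coeFn_smul _ _).symm (Lp.coeFn_smul _ _).symm

/-- The unbounded operator `A(t)` on `H`,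
`A(t)(η, ω, z) = (-ω_x - a ω_xxx - a₁ ω_xxxxx, -η_x - a η_xxx - a₁ η_xxxxx,
((τ'(t) ρ - 1) / τ(t)) z_ρ)`. -/
def opA {L : ℝ} (hL : 0 < L) (a a₁ α β : ℝ) (τ : ℝ → ℝ) (t : ℝ) : State L →ₗ.[ℝ] State L where
  domain := domainA hL α β
  toFun :=
    { toFun := fun U => WithLp.toLp 2
        ((memLp_dispersion (a := a) (a₁ := a₁) U.2.omega_sobolev).toLp,
          WithLp.toLp 2 ((memLp_dispersion (a := a) (a₁ := a₁) U.2.eta_sobolev).toLp,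
            (memLp_transport (τ := τ) (t := t) U.2.z_sobolev).toLp))
      map_add' := fun U V => WithLp.ofLp_injective 2 (Prod.ext
        (dispersion_toLp_add U.2.omega_sobolev V.2.omega_sobolev (U + V).2.omega_sobolev)
        (WithLp.ofLp_injective 2 (Prod.ext
          (dispersion_toLp_add U.2.eta_sobolev V.2.eta_sobolev (U + V).2.eta_sobolev)
          (transport_toLp_add U.2.z_sobolev V.2.z_sobolev (U + V).2.z_sobolev))))
      map_smul' := fun c U => WithLp.ofLp_injective 2 (Prod.ext
        (dispersion_toLp_smul c U.2.omega_sobolev (c • U).2.omega_sobolev)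
        (WithLp.ofLp_injective 2 (Prod.ext
          (dispersion_toLp_smul c U.2.eta_sobolev (c • U).2.eta_sobolev)
          (transport_toLp_smul c U.2.z_sobolev (c • U).2.z_sobolev)))) }

/-- The standing conditions on the delay `τ : [0, ∞) → ℝ`:
`τ ∈ W^{2,∞}(0,T)` for all `T > 0` (as a function, `τ` is the continuous representative),
`0 < τ(0) ≤ τ(t) ≤ M` and `τ'(t) ≤ d < 1` for all `t ≥ 0`. -/
structure IsDelay (M d : ℝ) (τ : ℝ → ℝ) : Prop where
  continuousOn : ContinuousOn τ (Ici 0)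
  sobolev : ∀ T > 0, MemSobolev 0 T ∞ 2 τ
  pos : 0 < τ 0
  lower : ∀ t ≥ 0, τ 0 ≤ τ t
  upper : ∀ t ≥ 0, τ t ≤ M
  deriv_le : ∀ t ≥ 0, derivWithin τ (Ici 0) t ≤ d
  nonneg : 0 ≤ d
  lt_one : d < 1

/-! ### Solutions of non-autonomous abstract Cauchy problems -/

section Cauchy

variable {X : Type*} [NormedAddCommGroup X] [NormedSpace ℝ X]

/-- A classical solution of `U'(t) = A(t) U(t)`, `t > 0`: `U` is continuous on `[0, ∞)`, and for
every `t > 0`, `U(t) ∈ D(A(t))` and `U` is differentiable at `t` with derivative `A(t) U(t)`. -/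
structure IsClassicalSolution (A : ℝ → X →ₗ.[ℝ] X) (U : ℝ → X) : Prop where
  continuousOn : ContinuousOn U (Ici 0)
  equation : ∀ t > 0, ∃ h : U t ∈ (A t).domain, HasDerivAt U (A t ⟨U t, h⟩) t

/-- A (mild) solution in `C([0, ∞), X)` of `U'(t) = A(t) U(t)`: a continuous function on `[0, ∞)`
that is the limit, uniformly on bounded time intervals, of classical solutions. -/
def IsMildSolution (A : ℝ → X →ₗ.[ℝ] X) (U : ℝ → X) : Prop :=
  ContinuousOn U (Ici 0) ∧ ∃ V : ℕ → ℝ → X, (∀ n, IsClassicalSolution A (V n)) ∧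
    ∀ T > 0, TendstoUniformlyOn V U atTop (Icc 0 T)

/-- `U ∈ C([0, ∞), D(A))`, where `D(A)` carries the graph norm: `t ↦ (U(t), A U(t))` is a
continuous map from `[0, ∞)` into the graph of `A`. -/
def ContinuousIntoDomain (A : X →ₗ.[ℝ] X) (U : ℝ → X) : Prop :=
  ∃ G : Ici (0 : ℝ) → A.graph, Continuous G ∧ ∀ t, (G t : X × X).1 = U t

end Cauchy

end

end DelayedBoussinesq

/-! ### Linear differential equations in a Banach space -/

namespace DelayedBoussinesq

/-! The time dependence of `A(t)` can be factored out. Put ξ = a₁α and let A be the same operator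
with the constant delay 1/ξ, whose third component is -ξ z_ρ. Then A(t) = N(t)A, where N(t)
multiplies z by (1 - τ'(t)ρ)/(ξτ(t)) and leaves η and ω alone. On each [0,T] this multiplier is
symmetric, bounded and Lipschitz in t, and it is coercive because τ ≤ M and τ' ≤ d < 1
(`IsDelay.isFactored_opA`).

The operator A is maximal dissipative for the standard inner product (`maxDissipative_opA`).
Integration by parts gives ⟨AU, U⟩ = -(a₁/2)(αr² + 2βrs + αs²) with r = η_xx(L) and s = z(1), and
this is nonpositive because the hypothesis on α implies |β| ≤ α. The range condition is a boundary
value problem for a system of ten first-order equations. Dissipativity makes its homogeneous version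
uniquely solvable, and in finite dimension uniqueness gives existence.

It remains to solve u' = N(t)Au on a Hilbert space. Let P = N⁻¹. Formally p = u' satisfies (Pp)' =
Ap, that is Pp' = Ap - P'p, with p(0) = N(0)Au₀. Here P' is only bounded and measurable, so it is
replaced by smooth B, and A by its Yosida approximations Y; the resulting equation is a linear
differential equation with bounded operators. The energies ⟨Px, x⟩ and ⟨Nx, x⟩ give bounds for p and
for Yp, the latter using that B is C¹. Monotonicity then makes the solutions Cauchy as the Yosida
parameter tends to 0, and a stability estimate in the L² norm of B allows B → P'. The limit
satisfies Pp - P(0)p(0) = A∫p, an identity free of P', so u = u₀ + ∫p is a C¹ solution with Au = Pp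
continuous (`IsCoeff.exists_classical`).

Almost everywhere differentiability of P is a separate requirement, since a Lipschitz map into the
bounded operators need not be differentiable; here it holds because N is affine in two scalar
Lipschitz functions. The energy estimate bounds classical solutions by their initial values, which
gives uniqueness and, as D(A) is dense, mild solutions for all initial values
(`IsFactored.wellPosed`). -/

theorem integral_exp_mul_le {c t : ℝ} (hc : 0 < c) :
    ∫ s in (0 : ℝ)..t, Real.exp (c * s) ≤ Real.exp (c * t) / c := by
  have h : ∀ s ∈ uIcc 0 t, HasDerivAt (fun s => Real.exp (c * s) / c) (Real.exp (c * s)) s := by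
    intro s _
    have := (((hasDerivAt_id s).const_mul c).exp).div_const c
    simpa [hc.ne'] using this
  rw [intervalIntegral.integral_eq_sub_of_hasDerivAt h
    (Continuous.intervalIntegrable (by fun_prop) _ _)]
  have : 0 < Real.exp (c * 0) / c := by positivity
  linarith

/-- Picard iteration for r(t) = e^{-ct} y(t) instead of y. With c = 2K + 1, where K bounds F on
[0,T], the weight makes the integral operator a contraction with constant 1/2 on the whole interval,
so no subdivision is needed. -/
theorem exists_hasDerivAt_linear {E : Type*} [NormedAddCommGroup E] [NormedSpace ℝ E]
    [CompleteSpace E] {T : ℝ} (hT : 0 ≤ T) {F : ℝ → E →L[ℝ] E} (hF : Continuous F)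
    {g : ℝ → E} (hg : Continuous g) (y₀ : E) :
    ∃ y : ℝ → E, Continuous y ∧ y 0 = y₀ ∧ ∀ t ∈ Icc 0 T, HasDerivAt y (F t (y t) + g t) t := by
  obtain ⟨K, hK⟩ := isCompact_Icc.exists_bound_of_continuousOn (s := Icc 0 T) hF.continuousOn
  have hK0 : 0 ≤ K := (norm_nonneg _).trans (hK 0 ⟨le_rfl, hT⟩)
  set c : ℝ := 2 * K + 1 with hc
  have hc0 : 0 < c := by positivity
  -- Extending r by its end values makes the integrand continuous on all of ℝ, so the primitive has
  -- two-sided derivatives also at 0 and T.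
  let pr : ℝ → Icc 0 T := projIcc 0 T hT
  have hpr : Continuous pr := continuous_projIcc
  let I : C(Icc 0 T, E) → ℝ → E := fun r s => F s (Real.exp (c * s) • (r (pr s) : E)) + g s
  have hI : ∀ r, Continuous (I r) := fun r =>
    (hF.clm_apply ((by fun_prop : Continuous fun s : ℝ => Real.exp (c * s)).smul
      (r.continuous.comp hpr))).add hg
  have hJ : ∀ r, Continuous fun t => ∫ s in (0 : ℝ)..t, I r s := fun r =>
    intervalIntegral.continuous_primitive (fun a b => (hI r).intervalIntegrable a b) 0
  let Φ : C(Icc 0 T, E) → C(Icc 0 T, E) := fun r =>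
    ⟨fun t => Real.exp (-(c * t)) • (y₀ + ∫ s in (0 : ℝ)..t, I r s),
      ((by fun_prop : Continuous fun s : ℝ => Real.exp (-(c * s))).smul
        (continuous_const.add (hJ r))).comp continuous_subtype_val⟩
  have hΦ : ContractingWith (1 / 2) Φ := by
    refine ⟨by norm_num, LipschitzWith.of_dist_le_mul fun r r' => ?_⟩
    rw [ContinuousMap.dist_le (by positivity)]
    intro t
    have ht := t.2
    rw [dist_eq_norm]
    have e1 : Φ r t - Φ r' t = Real.exp (-(c * t)) • ∫ s in (0 : ℝ)..t, (I r s - I r' s) := by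
      rw [intervalIntegral.integral_sub ((hI r).intervalIntegrable _ _)
        ((hI r').intervalIntegrable _ _)]
      change Real.exp (-(c * t)) • (y₀ + ∫ s in (0 : ℝ)..t, I r s) -
        Real.exp (-(c * t)) • (y₀ + ∫ s in (0 : ℝ)..t, I r' s) = _
      rw [← smul_sub]
      congr 1
      abel
    rw [e1, norm_smul, Real.norm_eq_abs, abs_of_pos (Real.exp_pos _)]
    have e2 : ‖∫ s in (0 : ℝ)..t, (I r s - I r' s)‖ ≤
        ∫ s in (0 : ℝ)..t, K * dist r r' * Real.exp (c * s) := by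
      refine intervalIntegral.norm_integral_le_of_norm_le ht.1 (ae_of_all _ fun s hs => ?_)
        (Continuous.intervalIntegrable (by fun_prop) _ _)
      have hs' : s ∈ Icc 0 T := ⟨hs.1.le, hs.2.trans ht.2⟩
      have : I r s - I r' s = F s (Real.exp (c * s) • (r (pr s) - r' (pr s))) := by
        simp only [I, smul_sub, map_sub]; abel
      rw [this]
      refine ((F s).le_opNorm _).trans ?_
      rw [norm_smul, Real.norm_eq_abs, abs_of_pos (Real.exp_pos _)]
      have h1 : ‖r (pr s) - r' (pr s)‖ ≤ dist r r' := by
        rw [← dist_eq_norm]; exact ContinuousMap.dist_apply_le_dist _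
      calc ‖F s‖ * (Real.exp (c * s) * ‖r (pr s) - r' (pr s)‖)
          ≤ K * (Real.exp (c * s) * dist r r') := by gcongr; exact hK s hs'
        _ = _ := by ring
    have e3 : ∫ s in (0 : ℝ)..t, K * dist r r' * Real.exp (c * s) ≤
        K * dist r r' * (Real.exp (c * t) / c) := by
      rw [intervalIntegral.integral_const_mul]
      gcongr
      exact integral_exp_mul_le hc0
    calc _ ≤ Real.exp (-(c * t)) * (K * dist r r' * (Real.exp (c * t) / c)) := by
          gcongr; exact e2.trans e3
      _ = (Real.exp (-(c * t)) * Real.exp (c * t)) * (K / c) * dist r r' := by ring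
      _ = K / c * dist r r' := by rw [← Real.exp_add]; simp
      _ ≤ 1 / 2 * dist r r' := by
          refine mul_le_mul_of_nonneg_right ?_ dist_nonneg
          rw [div_le_iff₀ hc0, hc]; linarith
      _ = _ := by simp
  obtain ⟨r, hr⟩ : ∃ r, Φ r = r := ⟨_, hΦ.fixedPoint_isFixedPt⟩
  refine ⟨fun t => y₀ + ∫ s in (0 : ℝ)..t, I r s, continuous_const.add (hJ r), by simp, ?_⟩
  intro t ht
  have h1 : HasDerivAt (fun t => y₀ + ∫ s in (0 : ℝ)..t, I r s) (I r t) t :=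
    (intervalIntegral.integral_hasDerivAt_right ((hI r).intervalIntegrable _ _)
      ((hI r).stronglyMeasurableAtFilter _ _) (hI r).continuousAt).const_add _
  have h2 : pr t = ⟨t, ht⟩ := projIcc_of_mem hT ht
  have h3 : r (pr t) = Real.exp (-(c * t)) • (y₀ + ∫ s in (0 : ℝ)..t, I r s) := by
    conv_lhs => rw [← hr]
    rw [h2]; rfl
  have h4 : I r t = F t (y₀ + ∫ s in (0 : ℝ)..t, I r s) + g t := by
    change F t (Real.exp (c * t) • (r (pr t) : E)) + g t = _
    rw [h3, smul_smul, ← Real.exp_add, add_neg_cancel, Real.exp_zero, one_smul]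
  rw [h4] at h1
  exact h1

/-! ### The weighted energy inequality -/

section Energy

open scoped RealInnerProductSpace

variable {X : Type*} [NormedAddCommGroup X] [InnerProductSpace ℝ X]

/-- Gronwall's inequality for y = ⟨Px, x⟩. Symmetry gives y' ≤ K‖x‖² + 2⟨Px', x⟩, and coercivity
converts ‖x‖² back into y/c. As P is merely Lipschitz, y need not be differentiable, so the argument
uses upper right difference quotients. -/
theorem energy_bound {P : ℝ → X →L[ℝ] X} {x x' : ℝ → X} {φ : ℝ → ℝ} {a b K c C₀ : ℝ}
    (hc : 0 < c) (hK : 0 ≤ K) (hC₀ : 0 ≤ C₀) (hP : ∀ s t, ‖P s - P t‖ ≤ K * |s - t|)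
    (hsymm : ∀ t u v, ⟪P t u, v⟫ = ⟪u, P t v⟫) (hco : ∀ t u, c * ‖u‖ ^ 2 ≤ ⟪P t u, u⟫)
    (hx : ContinuousOn x (Icc a b)) (hx' : ∀ t ∈ Ico a b, HasDerivWithinAt x (x' t) (Ici t) t)
    (hφ : Continuous φ) (hφ0 : ∀ t, 0 ≤ φ t)
    (h : ∀ t ∈ Ico a b, ⟪P t (x' t), x t⟫ ≤ C₀ * ‖x t‖ ^ 2 + φ t) :
    ∀ t ∈ Icc a b, c * ‖x t‖ ^ 2 ≤
      Real.exp ((K + 2 * C₀) / c * (t - a)) * (⟪P a (x a), x a⟫ + 2 * ∫ s in a..t, φ s) := by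
  set Γ := (K + 2 * C₀) / c with hΓ
  have hPc : Continuous P := by
    have : LipschitzWith K.toNNReal P := LipschitzWith.of_dist_le_mul fun s t => by
      rw [dist_eq_norm, Real.dist_eq, Real.coe_toNNReal _ hK]; exact hP s t
    exact this.continuous
  let y : ℝ → ℝ := fun t => ⟪P t (x t), x t⟫
  have hy : ContinuousOn y (Icc a b) := (hPc.continuousOn.clm_apply hx).inner hx
  -- The comparison principle requires a strict inequality where y meets its majorant; the extra ε
  -- supplies it and tends to 0 at the end.
  have key : ∀ ε > 0, ∀ t ∈ Icc a b,
      y t ≤ Real.exp (Γ * (t - a)) * (y a + ∫ s in a..t, (2 * φ s + ε)) := by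
    intro ε hε
    refine image_le_of_liminf_slope_right_lt_deriv_boundary' (f' := fun t => Γ * y t + 2 * φ t)
      (B' := fun t => Γ * (Real.exp (Γ * (t - a)) * (y a + ∫ s in a..t, (2 * φ s + ε))) +
        Real.exp (Γ * (t - a)) * (2 * φ t + ε)) hy ?_ (by simp) ?_ ?_ ?_
    · intro t ht r hr
      refine Eventually.frequently ?_
      have hw : HasDerivWithinAt (fun z => ⟪P t (x z), x z⟫)
          (⟪P t (x t), x' t⟫ + ⟪P t (x' t), x t⟫) (Ici t) t :=
        HasDerivWithinAt.inner ℝ ((P t).hasFDerivAt.comp_hasDerivWithinAt t (hx' t ht)) (hx' t ht)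
      -- With P frozen at t the energy is differentiable from the right; letting P vary changes the
      -- difference quotient by at most K‖x z‖².
      have hlim : Tendsto (fun z => slope (fun z => ⟪P t (x z), x z⟫) t z + K * ‖x z‖ ^ 2)
          (𝓝[>] t) (𝓝 (⟪P t (x t), x' t⟫ + ⟪P t (x' t), x t⟫ + K * ‖x t‖ ^ 2)) := by
        have hw' := hw.Ioi_of_Ici
        rw [hasDerivWithinAt_iff_tendsto_slope' self_notMem_Ioi] at hw'
        have hxt : Tendsto x (𝓝[>] t) (𝓝 (x t)) :=
          (hx' t ht).continuousWithinAt.mono Ioi_subset_Ici_self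
        exact hw'.add ((hxt.norm.pow 2).const_mul K)
      have hle : ⟪P t (x t), x' t⟫ + ⟪P t (x' t), x t⟫ + K * ‖x t‖ ^ 2 ≤ Γ * y t + 2 * φ t := by
        have e1 : ⟪P t (x t), x' t⟫ = ⟪P t (x' t), x t⟫ := by
          rw [hsymm, real_inner_comm]
        have e2 := h t ht
        have e3 : (K + 2 * C₀) * ‖x t‖ ^ 2 ≤ Γ * y t := by
          rw [hΓ, div_mul_eq_mul_div, le_div_iff₀ hc]
          have := mul_le_mul_of_nonneg_left (hco t (x t)) (by positivity : 0 ≤ K + 2 * C₀)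
          simp only [y]; linarith
        rw [e1]; linarith
      filter_upwards [hlim.eventually_lt_const (hle.trans_lt hr), self_mem_nhdsWithin] with z hz hzt
      refine lt_of_le_of_lt ?_ hz
      have hzt' : 0 < z - t := sub_pos.2 hzt
      rw [slope_def_field, slope_def_field, div_add' _ _ _ hzt'.ne']
      refine div_le_div_of_nonneg_right ?_ hzt'.le
      have : ⟪P z (x z), x z⟫ - ⟪P t (x z), x z⟫ ≤ K * ‖x z‖ ^ 2 * (z - t) := by
        rw [← inner_sub_left, ← sub_apply]
        calc _ ≤ ‖(P z - P t) (x z)‖ * ‖x z‖ := real_inner_le_norm _ _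
          _ ≤ (K * |z - t| * ‖x z‖) * ‖x z‖ := by
            gcongr
            exact ((P z - P t).le_opNorm _).trans (by gcongr; exact hP z t)
          _ = _ := by rw [abs_of_pos hzt']; ring
      simp only [y]; linarith
    · refine Continuous.continuousOn ?_
      refine (by fun_prop : Continuous fun t => Real.exp (Γ * (t - a))).mul
        (continuous_const.add (intervalIntegral.continuous_primitive
          (fun a b => Continuous.intervalIntegrable (by fun_prop) a b) a))
    · intro t _
      have h1 : HasDerivAt (fun t => Real.exp (Γ * (t - a))) (Real.exp (Γ * (t - a)) * Γ) t := by
        have := (((hasDerivAt_id t).sub_const a).const_mul Γ).exp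
        simpa using this
      have h2 : HasDerivAt (fun t => y a + ∫ s in a..t, (2 * φ s + ε)) (2 * φ t + ε) t := by
        have hcont : Continuous fun s => 2 * φ s + ε := by fun_prop
        exact (intervalIntegral.integral_hasDerivAt_right (hcont.intervalIntegrable _ _)
          (hcont.stronglyMeasurableAtFilter _ _) hcont.continuousAt).const_add _
      refine ((h1.mul h2).hasDerivWithinAt).congr_deriv ?_
      ring
    · intro t ht hyt
      rw [← hyt]
      have h1 : 1 ≤ Real.exp (Γ * (t - a)) := by
        refine Real.one_le_exp ?_
        have := ht.1
        have : 0 ≤ t - a := by linarith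
        positivity
      have := hφ0 t
      nlinarith
  intro t ht
  refine (hco t (x t)).trans ?_
  have hcont : Continuous fun ε : ℝ => Real.exp (Γ * (t - a)) * (y a + (2 * (∫ s in a..t, φ s) +
    (t - a) * ε)) := by fun_prop
  have hlim : Tendsto (fun ε : ℝ => Real.exp (Γ * (t - a)) * (y a + (2 * (∫ s in a..t, φ s) +
    (t - a) * ε))) (𝓝[>] 0) (𝓝 (Real.exp (Γ * (t - a)) * (y a + 2 * ∫ s in a..t, φ s))) := by
    have := (hcont.tendsto 0).mono_left (nhdsWithin_le_nhds (s := Ioi 0))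
    simpa using this
  refine ge_of_tendsto hlim ?_
  filter_upwards [self_mem_nhdsWithin] with ε hε
  refine (key ε hε t ht).trans_eq ?_
  rw [intervalIntegral.integral_add ((hφ.const_mul 2).intervalIntegrable _ _)
    intervalIntegrable_const, intervalIntegral.integral_const_mul, intervalIntegral.integral_const,
    smul_eq_mul]

end Energy

/-! ### Maximal dissipative operators and their Yosida approximations -/

section Abstract

open scoped RealInnerProductSpace

variable {X : Type*} [NormedAddCommGroup X] [InnerProductSpace ℝ X]

/-- A maximal dissipative operator on a real Hilbert space. -/
structure MaxDissipative (A : X →ₗ.[ℝ] X) : Prop where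
  inner_nonpos : ∀ u : A.domain, ⟪A u, (u : X)⟫ ≤ 0
  surj : ∀ h : ℝ, 0 < h → ∀ x, ∃ u : A.domain, (u : X) - h • A u = x

/-- `Y` is the Yosida approximation `A (1 - h A)⁻¹` of `A`. -/
def IsYosida (A : X →ₗ.[ℝ] X) (h : ℝ) (Y : X →L[ℝ] X) : Prop :=
  ∀ u v, (u, v) ∈ A.graph ↔ Y (u - h • v) = v

namespace MaxDissipative

variable {A : X →ₗ.[ℝ] X}

theorem inner_graph (hA : MaxDissipative A) {u v : X} (h : (u, v) ∈ A.graph) : ⟪v, u⟫ ≤ 0 := by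
  obtain ⟨w, rfl, rfl⟩ := (LinearPMap.mem_graph_iff A).1 h
  exact hA.inner_nonpos w

theorem norm_le (hA : MaxDissipative A) {h : ℝ} (hh : 0 < h) {u v : X} (huv : (u, v) ∈ A.graph) :
    ‖u‖ ≤ ‖u - h • v‖ := by
  have h1 := hA.inner_graph huv
  have h2 : ‖u‖ ^ 2 ≤ ‖u - h • v‖ ^ 2 := by
    rw [norm_sub_sq_real, inner_smul_right, real_inner_comm]
    nlinarith [sq_nonneg ‖h • v‖, mul_nonneg hh.le (neg_nonneg.2 h1)]
  exact (sq_le_sq₀ (norm_nonneg _) (norm_nonneg _)).1 h2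

/-- By dissipativity 1 - hA is injective with a contractive inverse J, and surjectivity makes J
linear and everywhere defined. The approximation is (J - 1)/h. -/
theorem exists_yosida (hA : MaxDissipative A) {h : ℝ} (hh : 0 < h) :
    ∃ Y : X →L[ℝ] X, IsYosida A h Y := by
  choose R hR using hA.surj h hh
  have huniq : ∀ u v x, (u, v) ∈ A.graph → u - h • v = x → u = R x ∧ v = A (R x) := by
    intro u v x huv hx
    have h1 : (u - R x, v - A (R x)) ∈ A.graph := A.graph.sub_mem huv (A.mem_graph (R x))
    have h2 := hA.norm_le hh h1
    have h3 : u - R x - h • (v - A (R x)) = 0 := by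
      rw [smul_sub, ← sub_eq_zero.2 (hx.trans (hR x).symm)]; abel
    rw [h3, norm_zero, norm_le_zero_iff, sub_eq_zero] at h2
    refine ⟨h2, ?_⟩
    rw [h2, sub_self, zero_sub, neg_eq_zero, smul_eq_zero] at h3
    exact sub_eq_zero.1 (h3.resolve_left hh.ne')
  let J : X →ₗ[ℝ] X :=
    { toFun := fun x => R x
      map_add' := fun x y => by
        refine ((huniq (R x + R y) (A (R x) + A (R y)) (x + y) (A.graph.add_mem
          (A.mem_graph (R x)) (A.mem_graph (R y))) ?_).1).symm
        nth_rewrite 3 [← hR x]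
        nth_rewrite 3 [← hR y]
        rw [smul_add]; abel
      map_smul' := fun c x => by
        refine ((huniq (c • R x) (c • A (R x)) (c • x) (A.graph.smul_mem c
          (A.mem_graph (R x))) ?_).1).symm
        nth_rewrite 3 [← hR x]
        rw [smul_comm, smul_sub] }
  let J' : X →L[ℝ] X := J.mkContinuous 1 fun x => by
    have := hA.norm_le hh (A.mem_graph (R x))
    rw [hR x] at this
    simpa [J] using this
  refine ⟨h⁻¹ • (J' - ContinuousLinearMap.id ℝ X), fun u v => ?_⟩
  have hY : ∀ x, (h⁻¹ • (J' - ContinuousLinearMap.id ℝ X)) x = A (R x) := by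
    intro x
    change h⁻¹ • ((R x : X) - x) = A (R x)
    nth_rewrite 2 [← hR x]
    rw [sub_sub_cancel, inv_smul_smul₀ hh.ne']
  rw [hY]
  constructor
  · intro huv
    exact ((huniq u v _ huv rfl).2).symm
  · intro e
    have h1 := hR (u - h • v)
    rw [e, sub_left_inj] at h1
    have := A.mem_graph (R (u - h • v))
    rwa [e, h1] at this

end MaxDissipative

namespace IsYosida

variable {A : X →ₗ.[ℝ] X} {h : ℝ} {Y : X →L[ℝ] X}

/-- This is the identity Y = AJ with J = 1 + hY the resolvent. All later monotonicity arguments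
apply dissipativity of A to such points of the graph. -/
theorem mem_graph (hY : IsYosida A h Y) (x : X) : (x + h • Y x, Y x) ∈ A.graph :=
  (hY _ _).2 (by rw [add_sub_cancel_right])

theorem inner_nonpos (hY : IsYosida A h Y) (hA : MaxDissipative A) (hh : 0 < h) (x : X) :
    ⟪Y x, x⟫ ≤ 0 := by
  have := hA.inner_graph (hY.mem_graph x)
  rw [inner_add_right, inner_smul_right] at this
  have h2 := mul_nonneg hh.le (real_inner_self_nonneg (x := Y x))
  linarith

/-- Dissipativity for the difference of the graph points (u + hYu, Yu) and (u, v) gives ⟨Yu - v, Yu⟩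
≤ 0. It bounds Yp at time 0 uniformly in h. -/
theorem norm_le (hY : IsYosida A h Y) (hA : MaxDissipative A) (hh : 0 < h) {u v : X}
    (huv : (u, v) ∈ A.graph) : ‖Y u‖ ≤ ‖v‖ := by
  have h1 := hA.inner_graph (A.graph.sub_mem (hY.mem_graph u) huv)
  have h2 : ⟪Y u - v, h • Y u⟫ ≤ 0 := by simpa using h1
  rw [inner_smul_right, inner_sub_left, real_inner_self_eq_norm_sq] at h2
  have h3 : ‖Y u‖ ^ 2 - ⟪v, Y u⟫ ≤ 0 := by
    by_contra! h4
    exact absurd h2 (not_le.2 (mul_pos hh h4))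
  have h4 := real_inner_le_norm v (Y u)
  by_contra! h5
  nlinarith [norm_nonneg v]

/-- Dissipativity holds exactly with x + hYx and y + kZy in place of x and y; the correction costs
at most (2R)(hR + kR). This is what makes solutions with different Yosida parameters close. -/
theorem inner_sub_le {k : ℝ} {Z : X →L[ℝ] X} (hY : IsYosida A h Y) (hZ : IsYosida A k Z)
    (hA : MaxDissipative A) (hh : 0 < h) (hk : 0 < k) {R : ℝ} {x y : X}
    (hx : ‖Y x‖ ≤ R) (hy : ‖Z y‖ ≤ R) : ⟪Y x - Z y, x - y⟫ ≤ 2 * R ^ 2 * (h + k) := by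
  have h1 := hA.inner_graph (A.graph.sub_mem (hY.mem_graph x) (hZ.mem_graph y))
  have e : x + h • Y x - (y + k • Z y) = (x - y) + (h • Y x - k • Z y) := by abel
  change ⟪Y x - Z y, x + h • Y x - (y + k • Z y)⟫ ≤ 0 at h1
  rw [e] at h1
  rw [inner_add_right] at h1
  have hR : 0 ≤ R := (norm_nonneg _).trans hx
  have h2 : -⟪Y x - Z y, h • Y x - k • Z y⟫ ≤ (R + R) * (h * R + k * R) := by
    rw [← inner_neg_left]
    refine (real_inner_le_norm _ _).trans ?_
    rw [norm_neg]
    gcongr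
    · exact (norm_sub_le _ _).trans (by gcongr)
    · refine (norm_sub_le _ _).trans ?_
      rw [norm_smul, norm_smul, Real.norm_of_nonneg hh.le, Real.norm_of_nonneg hk.le]
      gcongr
  linarith

/-- The graph is the set where two continuous functions agree, namely Y(u - hv) and v. -/
theorem isClosed_graph (hY : IsYosida A h Y) : IsClosed (A.graph : Set (X × X)) := by
  have : (A.graph : Set (X × X)) = {q | Y (q.1 - h • q.2) = q.2} := by
    ext ⟨u, v⟩; exact hY u v
  rw [this]
  exact isClosed_eq (by fun_prop) (by fun_prop)

end IsYosida

theorem MaxDissipative.isClosed_graph {A : X →ₗ.[ℝ] X} (hA : MaxDissipative A) :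
    IsClosed (A.graph : Set (X × X)) :=
  (hA.exists_yosida one_pos).choose_spec.isClosed_graph

/-- If x is orthogonal to the domain, write x = u - Au; pairing with u gives ‖u‖² = ⟨Au, u⟩ ≤ 0, so
u = 0 and x = 0. -/
theorem MaxDissipative.dense_domain [CompleteSpace X] {A : X →ₗ.[ℝ] X} (hA : MaxDissipative A) :
    Dense (A.domain : Set X) := by
  rw [Submodule.dense_iff_topologicalClosure_eq_top, Submodule.topologicalClosure_eq_top_iff,
    Submodule.eq_bot_iff]
  intro x hx
  obtain ⟨u, hu⟩ := hA.surj 1 one_pos x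
  have h1 : ⟪(u : X), x⟫ = 0 := hx u u.2
  rw [← hu, one_smul, inner_sub_right, real_inner_self_eq_norm_sq, real_inner_comm] at h1
  have h2 := hA.inner_nonpos u
  have h3 : ‖(u : X)‖ = 0 := by nlinarith [sq_nonneg ‖(u : X)‖]
  have h4 : u = 0 := Subtype.ext (norm_eq_zero.1 h3)
  rw [← hu, h4]; simp

/-- Time-dependent coefficients: `P` and `N` are inverse to each other, symmetric, uniformly
bounded, coercive and Lipschitz continuous in time. -/
structure IsCoeff (P N : ℝ → X →L[ℝ] X) (K c : ℝ) : Prop where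
  c_pos : 0 < c
  K_nonneg : 0 ≤ K
  lipP : ∀ s t, ‖P s - P t‖ ≤ K * |s - t|
  lipN : ∀ s t, ‖N s - N t‖ ≤ K * |s - t|
  boundP : ∀ t, ‖P t‖ ≤ K
  boundN : ∀ t, ‖N t‖ ≤ K
  symmP : ∀ t u v, ⟪P t u, v⟫ = ⟪u, P t v⟫
  symmN : ∀ t u v, ⟪N t u, v⟫ = ⟪u, N t v⟫
  coP : ∀ t u, c * ‖u‖ ^ 2 ≤ ⟪P t u, u⟫
  coN : ∀ t u, c * ‖u‖ ^ 2 ≤ ⟪N t u, u⟫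
  PN : ∀ t u, P t (N t u) = u

theorem continuous_of_lip {Z : Type*} [NormedAddCommGroup Z] {P : ℝ → Z} {K : ℝ}
    (hK : 0 ≤ K) (h : ∀ s t, ‖P s - P t‖ ≤ K * |s - t|) : Continuous P := by
  have : LipschitzWith K.toNNReal P := LipschitzWith.of_dist_le_mul fun s t => by
    rw [dist_eq_norm, Real.dist_eq, Real.coe_toNNReal _ hK]; exact h s t
  exact this.continuous

/-- `p` solves `P p' = Y p - B p` on `[0, T]`. -/
structure IsApproxSol (N : ℝ → X →L[ℝ] X) (Y : X →L[ℝ] X) (B : ℝ → X →L[ℝ] X) (T : ℝ)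
    (p : ℝ → X) : Prop where
  cont : Continuous p
  deriv : ∀ t ∈ Icc 0 T, HasDerivAt p (N t (Y (p t) - B t (p t))) t

variable {P N : ℝ → X →L[ℝ] X} {K c T : ℝ} {A : X →ₗ.[ℝ] X}

/-! ### A priori estimates for the approximate equation -/

namespace IsCoeff

theorem contP (hc : IsCoeff P N K c) : Continuous P := continuous_of_lip hc.K_nonneg hc.lipP

theorem contN (hc : IsCoeff P N K c) : Continuous N := continuous_of_lip hc.K_nonneg hc.lipN

theorem exists_approxSol [CompleteSpace X] (hc : IsCoeff P N K c) (hT : 0 ≤ T) (Y : X →L[ℝ] X)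
    {B : ℝ → X →L[ℝ] X} (hB : Continuous B) (p₀ : X) :
    ∃ p, IsApproxSol N Y B T p ∧ p 0 = p₀ := by
  obtain ⟨p, h1, h2, h3⟩ := exists_hasDerivAt_linear hT
    (F := fun t => (N t).comp (Y - B t)) (hc.contN.clm_comp (continuous_const.sub hB))
    (continuous_const (y := (0 : X))) p₀
  exact ⟨p, ⟨h1, fun t ht => by simpa using h3 t ht⟩, h2⟩

/-- Dependence of the approximate solutions on the initial value and on `B`. -/
theorem exists_approxSol_bound (hc : IsCoeff P N K c) (hA : MaxDissipative A) (hT : 0 ≤ T)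
    {K₁ : ℝ} (hK₁ : 0 ≤ K₁) : ∃ C, 0 ≤ C ∧ ∀ (h : ℝ) (Y : X →L[ℝ] X) (B B' : ℝ → X →L[ℝ] X)
    (p q : ℝ → X), 0 < h → IsYosida A h Y → Continuous B → Continuous B' → (∀ t, ‖B t‖ ≤ K₁) →
    (∀ t, ‖B' t‖ ≤ K₁) → IsApproxSol N Y B T p → IsApproxSol N Y B' T q → ∀ t ∈ Icc 0 T,
    ‖q t‖ ^ 2 ≤ C * ‖q 0‖ ^ 2 ∧
    ‖p t - q t‖ ^ 2 ≤ C * (‖p 0 - q 0‖ ^ 2 + ‖q 0‖ ^ 2 * ∫ s in (0 : ℝ)..T, ‖B s - B' s‖ ^ 2) := by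
  set E := Real.exp ((K + 2 * (K₁ + 1)) / c * T) with hE
  have hE0 : 0 ≤ E := (Real.exp_pos _).le
  have hK := hc.K_nonneg
  have hcp := hc.c_pos
  set C₁ := E * (K + 1) / c with hC₁
  have hC₁0 : 0 ≤ C₁ := by positivity
  -- The difference x = p - q satisfies Px' = Yx - Bx - (B - B')q. The term with Y is dissipative,
  -- and Young's inequality for the last one accounts for the constant K₁ + 1.
  have main : ∀ (h : ℝ) (Y : X →L[ℝ] X) (B B' : ℝ → X →L[ℝ] X)
    (p q : ℝ → X), 0 < h → IsYosida A h Y → Continuous B → Continuous B' → (∀ t, ‖B t‖ ≤ K₁) →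
    IsApproxSol N Y B T p → IsApproxSol N Y B' T q → ∀ t ∈ Icc 0 T,
    ‖p t - q t‖ ^ 2 ≤ C₁ * (‖p 0 - q 0‖ ^ 2 + ∫ s in (0 : ℝ)..T, ‖(B s - B' s) (q s)‖ ^ 2) := by
    intro h Y B B' p q hh hY hB hB' hBK hp hq t ht
    have hcont : Continuous fun s => ‖(B s - B' s) (q s)‖ ^ 2 :=
      (((hB.sub hB').clm_apply hq.cont).norm).pow 2
    have := energy_bound (P := P) (x := fun t => p t - q t) (a := 0) (b := T) (C₀ := K₁ + 1)
      (φ := fun s => 1 / 2 * ‖(B s - B' s) (q s)‖ ^ 2) hcp hK (by positivity) hc.lipP hc.symmP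
      hc.coP (hp.cont.sub hq.cont).continuousOn
      (fun t ht => ((hp.deriv t ⟨ht.1, ht.2.le⟩).sub (hq.deriv t ⟨ht.1, ht.2.le⟩)).hasDerivWithinAt)
      (by fun_prop) (fun t => by positivity) ?_ t ht
    · rw [intervalIntegral.integral_const_mul] at this
      have i1 : ∫ s in (0 : ℝ)..t, ‖(B s - B' s) (q s)‖ ^ 2 ≤
          ∫ s in (0 : ℝ)..T, ‖(B s - B' s) (q s)‖ ^ 2 := by
        refine intervalIntegral.integral_mono_interval le_rfl ht.1 ht.2 ?_
          (hcont.intervalIntegrable _ _)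
        exact Eventually.of_forall fun s => by positivity
      have i0 : 0 ≤ ∫ s in (0 : ℝ)..t, ‖(B s - B' s) (q s)‖ ^ 2 :=
        intervalIntegral.integral_nonneg ht.1 fun s _ => by positivity
      have i2 : ⟪P 0 (p 0 - q 0), p 0 - q 0⟫ ≤ K * ‖p 0 - q 0‖ ^ 2 := by
        refine (real_inner_le_norm _ _).trans ?_
        rw [pow_two, ← mul_assoc]
        gcongr
        exact (P 0).le_of_opNorm_le (hc.boundP 0) _
      have i3 : Real.exp ((K + 2 * (K₁ + 1)) / c * (t - 0)) ≤ E := by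
        rw [hE, sub_zero]
        gcongr
        exact ht.2
      rw [hC₁, div_mul_eq_mul_div, le_div_iff₀ hcp, mul_comm _ c]
      refine this.trans ?_
      rw [mul_assoc E]
      refine mul_le_mul i3 ?_ ?_ hE0
      · nlinarith [sq_nonneg ‖p 0 - q 0‖]
      · have : 0 ≤ ⟪P 0 (p 0 - q 0), p 0 - q 0⟫ := le_trans (by positivity) (hc.coP 0 (p 0 - q 0))
        linarith
    · intro t ht
      rw [map_sub, hc.PN, hc.PN]
      set x := p t - q t with hx
      have e : Y (p t) - B t (p t) - (Y (q t) - B' t (q t)) =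
          Y x - B t x - (B t - B' t) (q t) := by
        simp only [hx, map_sub, sub_apply]; abel
      rw [e, inner_sub_left, inner_sub_left]
      have j1 := hY.inner_nonpos hA hh x
      have j2 : -⟪B t x, x⟫ ≤ K₁ * ‖x‖ ^ 2 := by
        rw [← inner_neg_left]
        refine (real_inner_le_norm _ _).trans ?_
        rw [pow_two, ← mul_assoc, norm_neg]
        gcongr
        exact (B t).le_of_opNorm_le (hBK t) _
      have j3 : -⟪(B t - B' t) (q t), x⟫ ≤ ‖(B t - B' t) (q t)‖ * ‖x‖ := by
        rw [← inner_neg_left]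
        refine (real_inner_le_norm _ _).trans ?_
        rw [norm_neg]
      nlinarith [sq_nonneg (‖(B t - B' t) (q t)‖ - ‖x‖), sq_nonneg ‖x‖]
  refine ⟨C₁ * (C₁ + 1), by positivity, ?_⟩
  intro h Y B B' p q hh hY hB hB' hBK hBK' hp hq t ht
  -- Comparison with the zero solution turns the difference estimate into a bound for q itself.
  have hz : IsApproxSol N Y B' T (fun _ => (0 : X)) :=
    ⟨continuous_const, fun t _ => by simpa using hasDerivAt_const t (0 : X)⟩
  have h1 : ∀ t ∈ Icc 0 T, ‖q t‖ ^ 2 ≤ C₁ * ‖q 0‖ ^ 2 := fun t ht => by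
    simpa using main h Y B' B' q _ hh hY hB' hB' hBK' hq hz t ht
  have hi : IntervalIntegrable (fun s => ‖B s - B' s‖ ^ 2) volume 0 T :=
    Continuous.intervalIntegrable (by fun_prop) _ _
  have h3 : ∫ s in (0 : ℝ)..T, ‖(B s - B' s) (q s)‖ ^ 2 ≤
      (C₁ * ‖q 0‖ ^ 2) * ∫ s in (0 : ℝ)..T, ‖B s - B' s‖ ^ 2 := by
    rw [← intervalIntegral.integral_const_mul]
    refine intervalIntegral.integral_mono_on hT ?_ (hi.const_mul _) fun s hs => ?_
    · exact ((((hB.sub hB').clm_apply hq.cont).norm).pow 2).intervalIntegrable _ _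
    · calc ‖(B s - B' s) (q s)‖ ^ 2 ≤ (‖B s - B' s‖ * ‖q s‖) ^ 2 := by
            gcongr; exact (B s - B' s).le_opNorm _
        _ = ‖B s - B' s‖ ^ 2 * ‖q s‖ ^ 2 := by ring
        _ ≤ ‖B s - B' s‖ ^ 2 * (C₁ * ‖q 0‖ ^ 2) := by gcongr; exact h1 s hs
        _ = _ := by ring
  have h4 : 0 ≤ ∫ s in (0 : ℝ)..T, ‖B s - B' s‖ ^ 2 :=
    intervalIntegral.integral_nonneg hT fun s _ => by positivity
  refine ⟨(h1 t ht).trans ?_, (main h Y B B' p q hh hY hB hB' hBK hp hq t ht).trans ?_⟩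
  · gcongr; nlinarith
  · rw [mul_assoc]
    gcongr
    have : 0 ≤ ‖q 0‖ ^ 2 * ∫ s in (0 : ℝ)..T, ‖B s - B' s‖ ^ 2 := by positivity
    nlinarith [sq_nonneg ‖p 0 - q 0‖]

/-- Convergence estimate for the Yosida approximation. -/
theorem exists_approxSol_cauchy (hc : IsCoeff P N K c) (hA : MaxDissipative A) (hT : 0 ≤ T)
    {K₁ : ℝ} (hK₁ : 0 ≤ K₁) (R : ℝ) : ∃ C, 0 ≤ C ∧ ∀ (h k : ℝ) (Y Z : X →L[ℝ] X)
    (B : ℝ → X →L[ℝ] X)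
    (p q : ℝ → X), 0 < h → 0 < k → IsYosida A h Y → IsYosida A k Z → (∀ t, ‖B t‖ ≤ K₁) →
    IsApproxSol N Y B T p → IsApproxSol N Z B T q → p 0 = q 0 → (∀ t ∈ Icc 0 T, ‖Y (p t)‖ ≤ R) →
    (∀ t ∈ Icc 0 T, ‖Z (q t)‖ ≤ R) → ∀ t ∈ Icc 0 T, ‖p t - q t‖ ^ 2 ≤ C * (h + k) := by
  have hK := hc.K_nonneg
  have hcp := hc.c_pos
  refine ⟨Real.exp ((K + 2 * K₁) / c * T) * (4 * R ^ 2 * T) / c, by positivity, ?_⟩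
  intro h k Y Z B p q hh hk hY hZ hBK hp hq h0 hpR hqR t ht
  have := energy_bound (P := P) (x := fun t => p t - q t) (a := 0) (b := T) (C₀ := K₁)
    (φ := fun _ => 2 * R ^ 2 * (h + k)) hcp hK hK₁ hc.lipP hc.symmP
    hc.coP (hp.cont.sub hq.cont).continuousOn
    (fun t ht => ((hp.deriv t ⟨ht.1, ht.2.le⟩).sub (hq.deriv t ⟨ht.1, ht.2.le⟩)).hasDerivWithinAt)
    (by fun_prop) (fun t => by positivity) ?_ t ht
  · rw [h0, sub_self, inner_zero_right, zero_add, intervalIntegral.integral_const, sub_zero,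
      smul_eq_mul] at this
    rw [div_mul_eq_mul_div, le_div_iff₀ hcp, mul_comm _ c]
    refine this.trans ?_
    calc Real.exp ((K + 2 * K₁) / c * t) * (2 * (t * (2 * R ^ 2 * (h + k))))
        ≤ Real.exp ((K + 2 * K₁) / c * T) * (2 * (T * (2 * R ^ 2 * (h + k)))) := by
          have h1 := ht.2
          have h2 := ht.1
          gcongr
      _ = _ := by ring
  · intro t ht
    rw [map_sub, hc.PN, hc.PN]
    have e : Y (p t) - B t (p t) - (Z (q t) - B t (q t)) =
        (Y (p t) - Z (q t)) - B t (p t - q t) := by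
      simp only [map_sub]; abel
    rw [e, inner_sub_left]
    have ht' : t ∈ Icc 0 T := ⟨ht.1, ht.2.le⟩
    -- For different Yosida parameters dissipativity fails only by 2R²(h + k), which enters the
    -- energy inequality as a constant source.
    have j1 := hY.inner_sub_le hZ hA hh hk (hpR t ht') (hqR t ht')
    have j2 : -⟪B t (p t - q t), p t - q t⟫ ≤ K₁ * ‖p t - q t‖ ^ 2 := by
      rw [← inner_neg_left]
      refine (real_inner_le_norm _ _).trans ?_
      rw [pow_two, ← mul_assoc, norm_neg]
      gcongr
      exact (B t).le_of_opNorm_le (hBK t) _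
    linarith

/-- Uniform bound for `Y p` for initial values in the domain and `B` of class `C¹`. -/
theorem exists_approxSol_graph_bound (hc : IsCoeff P N K c) (hA : MaxDissipative A) (hT : 0 ≤ T)
    {K₁ : ℝ} (hK₁ : 0 ≤ K₁) {B B' : ℝ → X →L[ℝ] X} (hB : ∀ t, HasDerivAt B (B' t) t)
    (hB' : Continuous B') (hBK : ∀ t, ‖B t‖ ≤ K₁) {p₀ v₀ : X} (hp₀ : (p₀, v₀) ∈ A.graph) :
    ∃ R, ∀ (h : ℝ) (Y : X →L[ℝ] X) (p : ℝ → X), 0 < h → IsYosida A h Y →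
    IsApproxSol N Y B T p → p 0 = p₀ → ∀ t ∈ Icc 0 T, ‖Y (p t)‖ ≤ R := by
  have hK := hc.K_nonneg
  have hcp := hc.c_pos
  have hBc : Continuous B := continuous_iff_continuousAt.2 fun t => (hB t).continuousAt
  obtain ⟨C, hC0, hC⟩ := hc.exists_approxSol_bound hA hT hK₁
  obtain ⟨K₂, hK₂⟩ := isCompact_Icc.exists_bound_of_continuousOn (s := Icc 0 T) hB'.continuousOn
  have hK₂0 : 0 ≤ K₂ := (norm_nonneg _).trans (hK₂ 0 ⟨le_rfl, hT⟩)
  set C₀ := (K₁ + 1) * K ^ 2 with hC₀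
  set W := K₂ ^ 2 * (C * ‖p₀‖ ^ 2) with hW
  have hC₀0 : 0 ≤ C₀ := by positivity
  set R₁ := Real.exp ((K + 2 * C₀) / c * T) * (K * (‖v₀‖ + K₁ * ‖p₀‖) ^ 2 + 2 * (T * W)) / c
    with hR₁
  have hR₁0 : 0 ≤ R₁ := by positivity
  refine ⟨√R₁ + K₁ * √(C * ‖p₀‖ ^ 2), ?_⟩
  intro h Y p hh hY hp h0 t ht
  have hpb : ∀ t ∈ Icc 0 T, ‖p t‖ ^ 2 ≤ C * ‖p₀‖ ^ 2 := fun t ht => by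
    rw [← h0]
    exact (hC h Y B B p p hh hY hBc hBc hBK hBK hp hp t ht).1
  -- Here q = Pp' satisfies q' = Y(Nq) - B'p - B(Nq). Testing with w = Nq uses the dissipativity of
  -- Y again, so the right energy for q is ⟨Nq, q⟩; this is where B has to be C¹.
  let q : ℝ → X := fun t => Y (p t) - B t (p t)
  have hq : ∀ t ∈ Icc 0 T, HasDerivAt q (Y (N t (q t)) - (B' t (p t) + B t (N t (q t)))) t := by
    intro t ht
    exact (Y.hasFDerivAt.comp_hasDerivAt t (hp.deriv t ht)).sub
      ((hB t).clm_apply (hp.deriv t ht))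
  have hqc : Continuous q := (Y.continuous.comp hp.cont).sub (hBc.clm_apply hp.cont)
  have := energy_bound (P := N) (x := q) (a := 0) (b := T) (C₀ := C₀)
    (φ := fun _ => W) hcp hK hC₀0 hc.lipN hc.symmN
    hc.coN hqc.continuousOn
    (fun t ht => (hq t ⟨ht.1, ht.2.le⟩).hasDerivWithinAt)
    (by fun_prop) (fun t => by positivity) ?_ t ht
  · have hqt : ‖q t‖ ^ 2 ≤ R₁ := by
      rw [hR₁, le_div_iff₀ hcp, mul_comm _ c]
      refine this.trans ?_
      rw [intervalIntegral.integral_const, sub_zero, smul_eq_mul]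
      have i2 : ⟪N 0 (q 0), q 0⟫ ≤ K * (‖v₀‖ + K₁ * ‖p₀‖) ^ 2 := by
        have : ‖q 0‖ ≤ ‖v₀‖ + K₁ * ‖p₀‖ := by
          refine (norm_sub_le _ _).trans ?_
          rw [h0]
          exact add_le_add (hY.norm_le hA hh hp₀) ((B 0).le_of_opNorm_le (hBK 0) _)
        refine (real_inner_le_norm _ _).trans ?_
        rw [pow_two, ← mul_assoc]
        gcongr
        exact ((N 0).le_of_opNorm_le (hc.boundN 0) _).trans (by gcongr)
      have h1 := ht.2
      have h2 := ht.1
      have h3 : 0 ≤ ⟪N 0 (q 0), q 0⟫ := le_trans (by positivity) (hc.coN 0 (q 0))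
      have h4 : 0 ≤ W := by positivity
      have h5 : 0 ≤ ⟪N 0 (q 0), q 0⟫ + 2 * (t * W) := by positivity
      gcongr
    have h1 : ‖q t‖ ≤ √R₁ := Real.le_sqrt_of_sq_le hqt
    have h2 : ‖p t‖ ≤ √(C * ‖p₀‖ ^ 2) := Real.le_sqrt_of_sq_le (hpb t ht)
    have e : Y (p t) = q t + B t (p t) := by simp [q]
    rw [e]
    refine (norm_add_le _ _).trans (add_le_add h1 (((B t).le_of_opNorm_le (hBK t) _).trans ?_))
    gcongr
  · intro t ht
    have ht' : t ∈ Icc 0 T := ⟨ht.1, ht.2.le⟩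
    rw [hc.symmN, inner_sub_left, inner_add_left]
    set w := N t (q t) with hw
    have j1 := hY.inner_nonpos hA hh w
    have j2 : -⟪B t w, w⟫ ≤ K₁ * ‖w‖ ^ 2 := by
      rw [← inner_neg_left]
      refine (real_inner_le_norm _ _).trans ?_
      rw [pow_two, ← mul_assoc, norm_neg]
      gcongr
      exact (B t).le_of_opNorm_le (hBK t) _
    have j3 : -⟪B' t (p t), w⟫ ≤ ‖B' t (p t)‖ * ‖w‖ := by
      rw [← inner_neg_left]
      refine (real_inner_le_norm _ _).trans ?_
      rw [norm_neg]
    have j4 : ‖B' t (p t)‖ ^ 2 ≤ W := by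
      calc ‖B' t (p t)‖ ^ 2 ≤ (K₂ * ‖p t‖) ^ 2 := by
            gcongr; exact (B' t).le_of_opNorm_le (hK₂ t ht') _
        _ = K₂ ^ 2 * ‖p t‖ ^ 2 := by ring
        _ ≤ _ := by rw [hW]; gcongr; exact hpb t ht'
    have j5 : ‖w‖ ^ 2 ≤ K ^ 2 * ‖q t‖ ^ 2 := by
      rw [← mul_pow]; gcongr; exact (N t).le_of_opNorm_le (hc.boundN t) _
    have j6 : (K₁ + 1) * ‖w‖ ^ 2 ≤ C₀ * ‖q t‖ ^ 2 := by
      rw [hC₀, mul_assoc]; gcongr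
    nlinarith [sq_nonneg (‖B' t (p t)‖ - ‖w‖), sq_nonneg ‖w‖, sq_nonneg ‖B' t (p t)‖]

end IsCoeff

end Abstract
-- Limits of integrals, the product rule and mollification
section Abstract

open scoped RealInnerProductSpace

variable {X : Type*} [NormedAddCommGroup X]

theorem exists_tendstoUniformlyOn_of_sq_le [CompleteSpace X] {f : ℕ → ℝ → X} {S : Set ℝ}
    {b : ℕ → ℝ}
    (h : ∀ i j, ∀ t ∈ S, ‖f i t - f j t‖ ^ 2 ≤ b i + b j) (hb : Tendsto b atTop (𝓝 0)) :
    ∃ g, TendstoUniformlyOn f g atTop S := by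
  have hC : UniformCauchySeqOn f atTop S := by
    rw [Metric.uniformCauchySeqOn_iff]
    intro ε hε
    have : ∀ᶠ n in atTop, b n < ε ^ 2 / 2 := hb.eventually_lt_const (by positivity)
    obtain ⟨n₀, hn₀⟩ := eventually_atTop.1 this
    refine ⟨n₀, fun m hm n hn t ht => ?_⟩
    rw [dist_eq_norm]
    have h1 := h m n t ht
    have h2 := hn₀ m hm
    have h3 := hn₀ n hn
    exact lt_of_pow_lt_pow_left₀ 2 hε.le (by linarith)
  have hlim : ∀ t ∈ S, ∃ x, Tendsto (fun n => f n t) atTop (𝓝 x) := fun t ht =>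
    cauchySeq_tendsto_of_complete (hC.cauchySeq ht)
  choose! g hg using hlim
  exact ⟨g, hC.tendstoUniformlyOn_of_tendsto hg⟩

theorem lipschitzOnWith_of_norm_sub_le {f : ℝ → X} {S : Set ℝ} {K : ℝ} (hK : 0 ≤ K)
    (h : ∀ s ∈ S, ∀ t ∈ S, ‖f s - f t‖ ≤ K * |s - t|) : LipschitzOnWith K.toNNReal f S :=
  LipschitzOnWith.of_dist_le_mul fun s hs t ht => by
    rw [dist_eq_norm, Real.dist_eq, Real.coe_toNNReal _ hK]; exact h s hs t ht

variable [NormedSpace ℝ X]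

theorem tendsto_integral_clm_apply {H : ℕ → ℝ → X →L[ℝ] X} {G : ℝ → X →L[ℝ] X} {p : ℕ → ℝ → X}
    {q : ℝ → X} {T K M : ℝ} (hH : ∀ j, AEStronglyMeasurable (H j)) (hHK : ∀ j t, ‖H j t‖ ≤ K)
    (hHG : ∀ᵐ t, Tendsto (fun j => H j t) atTop (𝓝 (G t)))
    (hp : ∀ j, ContinuousOn (p j) (Icc 0 T))
    (hpM : ∀ j, ∀ t ∈ Icc 0 T, ‖p j t‖ ≤ M)
    (hpq : ∀ t ∈ Icc 0 T, Tendsto (fun j => p j t) atTop (𝓝 (q t))) {t : ℝ} (ht : t ∈ Icc 0 T) :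
    Tendsto (fun j => ∫ s in (0 : ℝ)..t, H j s (p j s)) atTop
      (𝓝 (∫ s in (0 : ℝ)..t, G s (q s))) := by
  have hsub : uIoc 0 t ⊆ Icc 0 T := by
    rw [uIoc_of_le ht.1]
    exact fun s hs => ⟨hs.1.le, hs.2.trans ht.2⟩
  refine intervalIntegral.tendsto_integral_filter_of_dominated_convergence (fun _ => K * M)
    (Eventually.of_forall fun j => ?_) (Eventually.of_forall fun j => ae_of_all _ fun s hs => ?_)
    intervalIntegrable_const ?_
  · exact isBoundedBilinearMap_apply.continuous.comp_aestronglyMeasurable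
      ((hH j).restrict.prodMk
        (((hp j).mono hsub).aestronglyMeasurable measurableSet_uIoc))
  · have hK : 0 ≤ K := (norm_nonneg _).trans (hHK j s)
    exact ((H j s).le_of_opNorm_le (hHK j s) _).trans (by gcongr; exact hpM j s (hsub hs))
  · filter_upwards [hHG] with s hs hst
    exact (isBoundedBilinearMap_apply.continuous.tendsto (G s, q s)).comp
      (hs.prodMk_nhds (hpq s (hsub hst)))

theorem norm_deriv_le_of_lip {Z : Type*} [NormedAddCommGroup Z] [NormedSpace ℝ Z] {P : ℝ → Z}
    {K : ℝ} (hK : 0 ≤ K) (h : ∀ s t, ‖P s - P t‖ ≤ K * |s - t|) (t : ℝ) : ‖deriv P t‖ ≤ K := by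
  have : LipschitzWith K.toNNReal P := LipschitzWith.of_dist_le_mul fun s t => by
    rw [dist_eq_norm, Real.dist_eq, Real.coe_toNNReal _ hK]; exact h s t
  simpa [hK] using norm_deriv_le_of_lipschitz (x₀ := t) this

variable [CompleteSpace X]

/-- The product rule for a Lipschitz family of operators applied to a `C¹` function. -/
theorem clm_apply_sub_eq_integral {P : ℝ → X →L[ℝ] X} {K T : ℝ} (hK : 0 ≤ K)
    (hP : ∀ s t, ‖P s - P t‖ ≤ K * |s - t|) (hPK : ∀ t, ‖P t‖ ≤ K)
    (hd : ∀ᵐ t, DifferentiableAt ℝ P t) {p p' : ℝ → X} (hp : Continuous p) (hp' : Continuous p')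
    (h : ∀ t ∈ Icc 0 T, HasDerivAt p (p' t) t) {t : ℝ} (ht : t ∈ Icc 0 T) :
    P t (p t) - P 0 (p 0) = ∫ s in (0 : ℝ)..t, (P s (p' s) + deriv P s (p s)) := by
  have hPc : Continuous P := continuous_of_lip hK hP
  have hT : 0 ≤ T := ht.1.trans ht.2
  obtain ⟨M, hM⟩ := isCompact_Icc.exists_bound_of_continuousOn (s := Icc 0 T) hp.continuousOn
  obtain ⟨M', hM'⟩ := isCompact_Icc.exists_bound_of_continuousOn (s := Icc 0 T) hp'.continuousOn
  have hM0 : 0 ≤ M := (norm_nonneg _).trans (hM 0 ⟨le_rfl, hT⟩)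
  have hM'0 : 0 ≤ M' := (norm_nonneg _).trans (hM' 0 ⟨le_rfl, hT⟩)
  set G : ℝ → X := fun s => P s (p' s) + deriv P s (p s) with hG
  have hGm : AEStronglyMeasurable G :=
    (hPc.clm_apply hp').aestronglyMeasurable.add
      (isBoundedBilinearMap_apply.continuous.comp_aestronglyMeasurable
        ((stronglyMeasurable_deriv P).aestronglyMeasurable.prodMk hp.aestronglyMeasurable))
  have hGb : ∀ s ∈ Icc 0 T, ‖G s‖ ≤ K * M' + K * M := fun s hs => by
    refine (norm_add_le _ _).trans (add_le_add ?_ ?_)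
    · exact ((P s).le_of_opNorm_le (hPK s) _).trans (by gcongr; exact hM' s hs)
    · exact ((deriv P s).le_of_opNorm_le (norm_deriv_le_of_lip hK hP s) _).trans
        (by gcongr; exact hM s hs)
  have hGi : ∀ a ∈ Icc 0 T, ∀ b ∈ Icc 0 T, IntervalIntegrable G volume a b := by
    intro a ha b hb
    rw [intervalIntegrable_iff]
    refine Measure.integrableOn_of_bounded (M := K * M' + K * M) (by simp) hGm ?_
    rw [ae_restrict_iff' measurableSet_uIoc]
    refine ae_of_all _ fun s hs => hGb s ?_
    exact (ordConnected_Icc.uIcc_subset ha hb) (uIoc_subset_uIcc hs)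
  have h0 : (0 : ℝ) ∈ Icc 0 T := ⟨le_rfl, hT⟩
  have hlip1 : LipschitzOnWith (K * M + K * M').toNNReal (fun t => P t (p t)) (uIcc 0 T) := by
    rw [uIcc_of_le hT]
    refine lipschitzOnWith_of_norm_sub_le (by positivity) fun s hs t ht => ?_
    have e : P s (p s) - P t (p t) = (P s - P t) (p s) + P t (p s - p t) := by
      simp
    rw [e, add_mul]
    refine (norm_add_le _ _).trans (add_le_add ?_ ?_)
    · calc _ ≤ (K * |s - t|) * ‖p s‖ := (P s - P t).le_of_opNorm_le (hP s t) _
        _ ≤ (K * |s - t|) * M := by gcongr; exact hM s hs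
        _ = _ := by ring
    · have : ‖p s - p t‖ ≤ M' * |s - t| :=
        Convex.norm_image_sub_le_of_norm_hasDerivWithin_le (fun x hx => (h x hx).hasDerivWithinAt)
          hM' (convex_Icc 0 T) ht hs
      calc _ ≤ K * ‖p s - p t‖ := (P t).le_of_opNorm_le (hPK t) _
        _ ≤ K * (M' * |s - t|) := by gcongr
        _ = _ := by ring
  have hlip2 : LipschitzOnWith (K * M' + K * M).toNNReal (fun t => ∫ s in (0 : ℝ)..t, G s)
      (uIcc 0 T) := by
    rw [uIcc_of_le hT]
    refine lipschitzOnWith_of_norm_sub_le (by positivity) fun s hs t ht => ?_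
    rw [intervalIntegral.integral_interval_sub_left (hGi 0 h0 s hs) (hGi 0 h0 t ht)]
    refine intervalIntegral.norm_integral_le_of_norm_le_const fun r hr => hGb r ?_
    exact (ordConnected_Icc.uIcc_subset ht hs) (uIoc_subset_uIcc hr)
  -- Both sides are Lipschitz, hence absolutely continuous, and have the same derivative almost
  -- everywhere, so they differ by a constant.
  have hac := hlip1.absolutelyContinuousOnInterval.sub hlip2.absolutelyContinuousOnInterval
  obtain ⟨C, hC⟩ := hac.const_of_ae_hasDerivAt_zero (by
    filter_upwards [hd, (hGi 0 h0 T ⟨hT, le_rfl⟩).ae_hasDerivAt_integral] with s hs1 hs2 hs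
    have hs' : s ∈ Icc 0 T := by rwa [uIcc_of_le hT] at hs
    have h1 := (hs1.hasDerivAt.clm_apply (h s hs')).sub (hs2 hs 0 left_mem_uIcc)
    refine h1.congr_deriv ?_
    simp only [hG]
    abel)
  rw [uIcc_of_le hT] at hC
  have e1 := hC t ht
  have e0 := hC 0 h0
  simp only [Pi.sub_apply, intervalIntegral.integral_same, sub_zero] at e1 e0
  rw [e0, ← e1, sub_sub_cancel]

/-- Mollification of a bounded strongly measurable function. -/
theorem exists_smooth_approx {Z : Type*} [NormedAddCommGroup Z] [NormedSpace ℝ Z] [CompleteSpace Z]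
    {G : ℝ → Z} {K : ℝ} (hG : StronglyMeasurable G) (hGK : ∀ t, ‖G t‖ ≤ K) :
    ∃ B : ℕ → ℝ → Z, (∀ j, ContDiff ℝ 1 (B j)) ∧ (∀ j t, ‖B j t‖ ≤ 3 * K) ∧
      ∀ᵐ t, Tendsto (fun j => B j t) atTop (𝓝 (G t)) := by
  have hK : 0 ≤ K := (norm_nonneg _).trans (hGK 0)
  have hloc : LocallyIntegrable G := by
    refine (locallyIntegrable_const (K : ℝ)).mono hG.aestronglyMeasurable (ae_of_all _ fun t => ?_)
    rw [Real.norm_of_nonneg hK]; exact hGK t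
  -- The inner radius is half the outer one; this fixed ratio is what almost everywhere convergence
  -- of the mollifications requires.
  let φ : ℕ → ContDiffBump (0 : ℝ) := fun j =>
    ⟨1 / ((j : ℝ) + 1) / 2, 1 / ((j : ℝ) + 1), by positivity, half_lt_self (by positivity)⟩
  have hφ : Tendsto (fun j => (φ j).rOut) atTop (𝓝 0) := tendsto_one_div_add_atTop_nhds_zero_nat
  refine ⟨fun j => convolution ((φ j).normed volume) G (ContinuousLinearMap.lsmul ℝ ℝ) volume,
    fun j => ?_, fun j t => ?_, ?_⟩
  · exact (φ j).hasCompactSupport_normed.contDiff_convolution_left (n := 1) _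
      (φ j).contDiff_normed hloc
  -- Values of G differ by at most 2K, so an average differs from G t by at most 2K; adding ‖G t‖ ≤
  -- K yields the factor 3.
  · have h1 := (φ j).dist_normed_convolution_le (μ := volume) (x₀ := t) (ε := 2 * K) hG.aestronglyMeasurable
      (fun x _ => by
        rw [dist_eq_norm]
        exact (norm_sub_le _ _).trans (by linarith [hGK x, hGK t]))
    rw [dist_eq_norm] at h1
    have h2 := norm_le_norm_add_norm_sub' (convolution ((φ j).normed volume) G
      (ContinuousLinearMap.lsmul ℝ ℝ) volume t) (G t)
    linarith [hGK t]
  · exact ContDiffBump.ae_convolution_tendsto_right_of_locallyIntegrable (K := 2) hφ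
      (Eventually.of_forall fun j => by simp only [φ]; linarith) hloc

end Abstract

/-! ### Removing the Yosida approximation -/

section Mild

open scoped RealInnerProductSpace

variable {X : Type*} [NormedAddCommGroup X] [InnerProductSpace ℝ X] [CompleteSpace X]
  {P N : ℝ → X →L[ℝ] X} {K c T : ℝ} {A : X →ₗ.[ℝ] X}

/-- Solutions of `P p' = A p - B p` obtained from the Yosida approximation. -/
theorem IsCoeff.exists_mild_of_smooth (hc : IsCoeff P N K c) (hA : MaxDissipative A) (hT : 0 ≤ T)
    (hd : ∀ᵐ t, DifferentiableAt ℝ P t) {Y : ℕ → X →L[ℝ] X}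
    (hY : ∀ m : ℕ, IsYosida A (1 / ((m : ℝ) + 1)) (Y m)) {B : ℝ → X →L[ℝ] X} {K₁ : ℝ}
    (hB : ContDiff ℝ 1 B) (hBK : ∀ t, ‖B t‖ ≤ K₁) {p₀ : X} (hp₀ : p₀ ∈ A.domain) :
    ∃ (q : ℕ → ℝ → X) (p : ℝ → X), (∀ m, IsApproxSol N (Y m) B T (q m)) ∧ (∀ m, q m 0 = p₀) ∧
      (∀ t ∈ Icc 0 T, Tendsto (fun m => q m t) atTop (𝓝 (p t))) ∧ ContinuousOn p (Icc 0 T) ∧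
      p 0 = p₀ ∧ ∀ t ∈ Icc 0 T, (∫ s in (0 : ℝ)..t, p s,
        P t (p t) - P 0 p₀ + ∫ s in (0 : ℝ)..t, (B s - deriv P s) (p s)) ∈ A.graph := by
  have hK := hc.K_nonneg
  have hK₁ : 0 ≤ K₁ := (norm_nonneg _).trans (hBK 0)
  have hBc := hB.continuous
  have hpos : ∀ m : ℕ, (0 : ℝ) < 1 / ((m : ℝ) + 1) := fun m => by positivity
  have h0 : (0 : ℝ) ∈ Icc 0 T := ⟨le_rfl, hT⟩
  choose q hq hq0 using fun m => hc.exists_approxSol hT (Y m) hBc p₀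
  obtain ⟨R, hR⟩ := hc.exists_approxSol_graph_bound hA hT hK₁ (B := B) (B' := deriv B)
    (fun t => (hB.differentiable (by simp) t).hasDerivAt) (hB.continuous_deriv (by simp)) hBK
    (A.mem_graph ⟨p₀, hp₀⟩)
  obtain ⟨C, hC0, hC⟩ := hc.exists_approxSol_cauchy hA hT hK₁ R
  obtain ⟨C', hC'0, hC'⟩ := hc.exists_approxSol_bound hA hT hK₁
  have hR' : ∀ m, ∀ t ∈ Icc 0 T, ‖Y m (q m t)‖ ≤ R := fun m =>
    hR _ _ _ (hpos m) (hY m) (hq m) (hq0 m)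
  have hh : Tendsto (fun m : ℕ => 1 / ((m : ℝ) + 1)) atTop (𝓝 0) :=
    tendsto_one_div_add_atTop_nhds_zero_nat
  obtain ⟨p, hp⟩ := exists_tendstoUniformlyOn_of_sq_le (f := q) (S := Icc 0 T)
    (b := fun m => C * (1 / ((m : ℝ) + 1)))
    (fun i j t ht => by
      rw [← mul_add]
      exact hC _ _ _ _ _ _ _ (hpos i) (hpos j) (hY i) (hY j) hBK (hq i) (hq j)
        ((hq0 i).trans (hq0 j).symm) (hR' i) (hR' j) t ht)
    (by simpa using hh.const_mul C)
  have hpt : ∀ t ∈ Icc 0 T, Tendsto (fun m => q m t) atTop (𝓝 (p t)) := fun t ht =>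
    hp.tendsto_at ht
  have hp0 : p 0 = p₀ := by
    refine tendsto_nhds_unique (hpt 0 h0) ?_
    simp only [hq0]; exact tendsto_const_nhds
  have hpc : ContinuousOn p (Icc 0 T) :=
    hp.continuousOn (Eventually.of_forall fun m => (hq m).cont.continuousOn).frequently
  refine ⟨q, p, hq, hq0, hpt, hpc, hp0, fun t ht => ?_⟩
  have hbd : ∀ m, ∀ t ∈ Icc 0 T, ‖q m t‖ ≤ √(C' * ‖p₀‖ ^ 2) := fun m t ht => by
    refine Real.le_sqrt_of_sq_le ?_
    have := (hC' _ _ _ _ _ _ (hpos m) (hY m) hBc hBc hBK hBK (hq m) (hq m) t ht).1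
    rwa [hq0] at this
  have l1 : Tendsto (fun m => ∫ s in (0 : ℝ)..t, q m s) atTop (𝓝 (∫ s in (0 : ℝ)..t, p s)) := by
    simpa using tendsto_integral_clm_apply (H := fun _ _ => ContinuousLinearMap.id ℝ X)
      (G := fun _ => ContinuousLinearMap.id ℝ X) (K := 1)
      (fun _ => aestronglyMeasurable_const) (fun _ _ => ContinuousLinearMap.norm_id_le)
      (ae_of_all _ fun _ => tendsto_const_nhds) (fun m => (hq m).cont.continuousOn) hbd hpt ht
  have hDm : AEStronglyMeasurable fun s => B s - deriv P s :=
    hBc.aestronglyMeasurable.sub (stronglyMeasurable_deriv P).aestronglyMeasurable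
  have l2 : Tendsto (fun m => ∫ s in (0 : ℝ)..t, (B s - deriv P s) (q m s)) atTop
      (𝓝 (∫ s in (0 : ℝ)..t, (B s - deriv P s) (p s))) :=
    tendsto_integral_clm_apply (H := fun _ s => B s - deriv P s) (G := fun s => B s - deriv P s)
      (K := K₁ + K) (fun _ => hDm)
      (fun _ s => (norm_sub_le _ _).trans (add_le_add (hBK s) (norm_deriv_le_of_lip hK hc.lipP s)))
      (ae_of_all _ fun _ => tendsto_const_nhds) (fun m => (hq m).cont.continuousOn) hbd hpt ht
  -- Integrating (Pq)' = Yq - (B - P')q removes the derivative of q, which need not converge.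
  have hint : ∀ m, ∫ s in (0 : ℝ)..t, Y m (q m s) = P t (q m t) - P 0 p₀ +
      ∫ s in (0 : ℝ)..t, (B s - deriv P s) (q m s) := by
    intro m
    have hYB : Continuous fun s => Y m (q m s) - B s (q m s) :=
      ((Y m).continuous.comp (hq m).cont).sub (hBc.clm_apply (hq m).cont)
    have e := clm_apply_sub_eq_integral hK hc.lipP hc.boundP hd (hq m).cont
      (hc.contN.clm_apply hYB) (hq m).deriv ht
    rw [hq0 m] at e
    have hDi : IntervalIntegrable (fun s => (B s - deriv P s) (q m s)) volume 0 t := by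
      have hcont : Continuous fun s => (K₁ + K) * ‖q m s‖ := by
        have := (hq m).cont
        fun_prop
      refine (hcont.intervalIntegrable 0 t).mono_fun' ?_ (ae_of_all _ fun s => ?_)
      · exact (isBoundedBilinearMap_apply.continuous.comp_aestronglyMeasurable
          (hDm.prodMk (hq m).cont.aestronglyMeasurable)).restrict
      · exact (B s - deriv P s).le_of_opNorm_le ((norm_sub_le _ _).trans
          (add_le_add (hBK s) (norm_deriv_le_of_lip hK hc.lipP s))) _
    have hYi : IntervalIntegrable (fun s => Y m (q m s)) volume 0 t :=
      ((Y m).continuous.comp (hq m).cont).intervalIntegrable _ _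
    have e2 : ∀ s, P s (N s (Y m (q m s) - B s (q m s))) + deriv P s (q m s) =
        Y m (q m s) - (B s - deriv P s) (q m s) := fun s => by
      rw [hc.PN, sub_apply]; abel
    simp only [e2] at e
    rw [e, intervalIntegral.integral_sub hYi hDi, sub_add_cancel]
  -- Y commutes with the integral, so the integrated solution lies on the graph up to a term with
  -- factor 1/(m+1); closedness of the graph then gives the limit.
  have hgr : ∀ m : ℕ, ((∫ s in (0 : ℝ)..t, q m s) + (1 / ((m : ℝ) + 1)) •
      ∫ s in (0 : ℝ)..t, Y m (q m s), ∫ s in (0 : ℝ)..t, Y m (q m s)) ∈ A.graph := by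
    intro m
    rw [(Y m).intervalIntegral_comp_comm ((hq m).cont.intervalIntegrable _ _)]
    exact (hY m).mem_graph _
  have l3 : Tendsto (fun m => ∫ s in (0 : ℝ)..t, Y m (q m s)) atTop (𝓝 (P t (p t) - P 0 p₀ +
      ∫ s in (0 : ℝ)..t, (B s - deriv P s) (p s))) := by
    simp only [hint]
    exact ((((P t).continuous.tendsto _).comp (hpt t ht)).sub_const _).add l2
  have l4 := l1.add (hh.smul l3)
  rw [zero_smul, add_zero] at l4
  exact hA.isClosed_graph.mem_of_tendsto (l4.prodMk_nhds l3) (Eventually.of_forall hgr)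

end Mild
-- Removing the mollification; classical solutions on bounded intervals
section Mild

open scoped RealInnerProductSpace

variable {X : Type*} [NormedAddCommGroup X] [InnerProductSpace ℝ X]
  {P N : ℝ → X →L[ℝ] X} {K c T : ℝ} {A : X →ₗ.[ℝ] X}

/-- Mild solutions of `(P p)' = A p`. -/
theorem IsCoeff.exists_mild [CompleteSpace X] (hc : IsCoeff P N K c) (hA : MaxDissipative A)
    (hT : 0 ≤ T) (hd : ∀ᵐ t, DifferentiableAt ℝ P t) (p₀ : X) :
    ∃ p : ℝ → X, ContinuousOn p (Icc 0 T) ∧ p 0 = p₀ ∧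
      ∀ t ∈ Icc 0 T, (∫ s in (0 : ℝ)..t, p s, P t (p t) - P 0 p₀) ∈ A.graph := by
  have hK := hc.K_nonneg
  have h0 : (0 : ℝ) ∈ Icc 0 T := ⟨le_rfl, hT⟩
  choose Y hY using fun m : ℕ => hA.exists_yosida (h := 1 / ((m : ℝ) + 1)) (by positivity)
  -- The true coefficient is P', which is only bounded and measurable, whereas the bound for Yp
  -- needs a C¹ coefficient.
  obtain ⟨B, hB, hBK, hBG⟩ := exists_smooth_approx (stronglyMeasurable_deriv P)
    (norm_deriv_le_of_lip hK hc.lipP)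
  obtain ⟨x, hx, hxp⟩ := mem_closure_iff_seq_limit.1 (hA.dense_domain p₀)
  -- The sequence `Y` is the same for all j, so `q i m` and `q j m` solve equations that differ only
  -- in B, and the stability estimate passes to m → ∞.
  choose q p hq hq0 hqp hpc hp0 hp using fun j =>
    hc.exists_mild_of_smooth hA hT hd hY (hB j) (hBK j) (hx j)
  obtain ⟨C, hC0, hC⟩ := hc.exists_approxSol_bound hA hT (K₁ := 3 * K) (by positivity)
  obtain ⟨M, hM⟩ : ∃ M, ∀ j, ‖x j‖ ≤ M := by
    obtain ⟨M, hM⟩ := (Metric.isBounded_range_of_tendsto x hxp).exists_norm_le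
    exact ⟨M, fun j => hM _ (mem_range_self j)⟩
  have hM0 : 0 ≤ M := (norm_nonneg _).trans (hM 0)
  set e : ℕ → ℝ := fun j => ∫ s in (0 : ℝ)..T, ‖B j s - deriv P s‖ ^ 2 with he
  have hmeas : ∀ j, AEStronglyMeasurable fun s => B j s - deriv P s := fun j =>
    (hB j).continuous.aestronglyMeasurable.sub (stronglyMeasurable_deriv P).aestronglyMeasurable
  have hbd4 : ∀ j s, ‖B j s - deriv P s‖ ≤ 3 * K + K := fun j s =>
    (norm_sub_le _ _).trans (add_le_add (hBK j s) (norm_deriv_le_of_lip hK hc.lipP s))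
  have hsq : ∀ j s, ‖‖B j s - deriv P s‖ ^ 2‖ ≤ (3 * K + K) ^ 2 := fun j s => by
    rw [Real.norm_of_nonneg (by positivity)]
    gcongr
    exact hbd4 j s
  have hei : ∀ j, IntervalIntegrable (fun s => ‖B j s - deriv P s‖ ^ 2) volume 0 T := fun j =>
    (intervalIntegrable_const (c := (3 * K + K) ^ 2)).mono_fun' ((hmeas j).norm.pow 2).restrict
      (ae_of_all _ (hsq j))
  have he0 : Tendsto e atTop (𝓝 0) := by
    have : Tendsto e atTop (𝓝 (∫ s in (0 : ℝ)..T, (0 : ℝ))) := by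
      refine intervalIntegral.tendsto_integral_filter_of_dominated_convergence
        (fun _ => (3 * K + K) ^ 2) (Eventually.of_forall fun j => ((hmeas j).norm.pow 2).restrict)
        (Eventually.of_forall fun j => ae_of_all _ fun s _ => hsq j s)
        intervalIntegrable_const ?_
      filter_upwards [hBG] with s hs _
      have := ((hs.sub_const (deriv P s)).norm).pow 2
      simpa using this
    simpa using this
  have hij : ∀ i j, ∫ s in (0 : ℝ)..T, ‖B i s - B j s‖ ^ 2 ≤ 2 * e i + 2 * e j := by
    intro i j
    rw [he, ← intervalIntegral.integral_const_mul, ← intervalIntegral.integral_const_mul,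
      ← intervalIntegral.integral_add ((hei i).const_mul 2) ((hei j).const_mul 2)]
    refine intervalIntegral.integral_mono_on hT ?_
      (((hei i).const_mul 2).add ((hei j).const_mul 2)) fun s _ => ?_
    · exact Continuous.intervalIntegrable
        ((((hB i).continuous.sub (hB j).continuous).norm).pow 2) _ _
    · have h1 : ‖B i s - B j s‖ ≤ ‖B i s - deriv P s‖ + ‖B j s - deriv P s‖ := by
        rw [← sub_sub_sub_cancel_right (B i s) (B j s) (deriv P s)]
        exact norm_sub_le _ _
      have h2 := norm_nonneg (B i s - B j s)
      nlinarith [sq_nonneg (‖B i s - deriv P s‖ - ‖B j s - deriv P s‖)]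
  have hpb : ∀ j, ∀ t ∈ Icc 0 T, ‖p j t‖ ≤ √(C * M ^ 2) := fun j t ht => by
    refine Real.le_sqrt_of_sq_le ?_
    refine le_of_tendsto (((hqp j t ht).norm).pow 2) (Eventually.of_forall fun m => ?_)
    have := (hC _ _ _ _ _ _ (by positivity) (hY m) (hB j).continuous (hB j).continuous (hBK j)
      (hBK j) (hq j m) (hq j m) t ht).1
    rw [hq0] at this
    exact this.trans (by gcongr; exact hM j)
  set b : ℕ → ℝ := fun j => C * (2 * ‖x j - p₀‖ ^ 2 + M ^ 2 * (2 * e j)) with hb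
  have hb0 : Tendsto b atTop (𝓝 0) := by
    have h1 : Tendsto (fun j => ‖x j - p₀‖ ^ 2) atTop (𝓝 0) := by
      simpa using ((hxp.sub_const p₀).norm).pow 2
    simpa using (((h1.const_mul 2).add ((he0.const_mul 2).const_mul (M ^ 2))).const_mul C)
  obtain ⟨r, hr⟩ := exists_tendstoUniformlyOn_of_sq_le (f := p) (S := Icc 0 T) (b := b)
    (fun i j t ht => by
      refine le_of_tendsto ((((hqp i t ht).sub (hqp j t ht)).norm).pow 2)
        (Eventually.of_forall fun m => ?_)
      have := (hC _ _ _ _ _ _ (by positivity) (hY m) (hB i).continuous (hB j).continuous (hBK i)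
        (hBK j) (hq i m) (hq j m) t ht).2
      rw [hq0, hq0] at this
      refine this.trans ?_
      rw [hb, ← mul_add]
      have h1 : ‖x i - x j‖ ≤ ‖x i - p₀‖ + ‖x j - p₀‖ := by
        rw [← sub_sub_sub_cancel_right (x i) (x j) p₀]
        exact norm_sub_le _ _
      have h2 := norm_nonneg (x i - x j)
      have h3 : ‖x j‖ ^ 2 * ∫ s in (0 : ℝ)..T, ‖B i s - B j s‖ ^ 2 ≤
          M ^ 2 * (2 * e i + 2 * e j) := by
        gcongr
        · exact intervalIntegral.integral_nonneg hT fun s _ => by positivity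
        · exact hM j
        · exact hij i j
      refine mul_le_mul_of_nonneg_left ?_ hC0
      have h5 : ‖x i - x j‖ ^ 2 ≤ 2 * ‖x i - p₀‖ ^ 2 + 2 * ‖x j - p₀‖ ^ 2 := by
        nlinarith [sq_nonneg (‖x i - p₀‖ - ‖x j - p₀‖)]
      linarith)
    hb0
  have hrt : ∀ t ∈ Icc 0 T, Tendsto (fun j => p j t) atTop (𝓝 (r t)) := fun t ht =>
    hr.tendsto_at ht
  refine ⟨r, hr.continuousOn (Eventually.of_forall hpc).frequently,
    tendsto_nhds_unique (hrt 0 h0) (by simpa only [hp0] using hxp), fun t ht => ?_⟩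
  have l1 : Tendsto (fun j => ∫ s in (0 : ℝ)..t, p j s) atTop (𝓝 (∫ s in (0 : ℝ)..t, r s)) := by
    simpa using tendsto_integral_clm_apply (H := fun _ _ => ContinuousLinearMap.id ℝ X)
      (G := fun _ => ContinuousLinearMap.id ℝ X) (K := 1)
      (fun _ => aestronglyMeasurable_const) (fun _ _ => ContinuousLinearMap.norm_id_le)
      (ae_of_all _ fun _ => tendsto_const_nhds) hpc hpb hrt ht
  -- The defect caused by mollification vanishes by dominated convergence, since the B j tend to P'
  -- almost everywhere with a uniform bound.
  have l2 : Tendsto (fun j => ∫ s in (0 : ℝ)..t, (B j s - deriv P s) (p j s)) atTop (𝓝 0) := by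
    simpa using tendsto_integral_clm_apply (H := fun j s => B j s - deriv P s)
      (G := fun _ => 0) (K := 3 * K + K) hmeas hbd4 (by
        filter_upwards [hBG] with s hs
        simpa using hs.sub_const (deriv P s)) hpc hpb hrt ht
  have l3 : Tendsto (fun j => P t (p j t) - P 0 (x j) +
      ∫ s in (0 : ℝ)..t, (B j s - deriv P s) (p j s)) atTop (𝓝 (P t (r t) - P 0 p₀)) := by
    simpa using ((((P t).continuous.tendsto _).comp (hrt t ht)).sub
      (((P 0).continuous.tendsto _).comp hxp)).add l2
  exact hA.isClosed_graph.mem_of_tendsto (l1.prodMk_nhds l3)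
    (Eventually.of_forall fun j => hp j t ht)

/-- Classical solutions of `u' = N A u` on `[0, T]`. -/
theorem IsCoeff.exists_classical [CompleteSpace X] (hc : IsCoeff P N K c) (hA : MaxDissipative A)
    (hT : 0 ≤ T) (hd : ∀ᵐ t, DifferentiableAt ℝ P t) {u₀ v₀ : X} (h : (u₀, v₀) ∈ A.graph)
    (hNP : P 0 (N 0 v₀) = v₀) :
    ∃ u p : ℝ → X, Continuous p ∧ u 0 = u₀ ∧ (∀ t, HasDerivAt u (p t) t) ∧
      ∀ t ∈ Icc 0 T, (u t, P t (p t)) ∈ A.graph := by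
  -- p is to be u', so its initial value is N(0)Au₀.
  obtain ⟨p, hpc, hp0, hp⟩ := hc.exists_mild hA hT hd (N 0 v₀)
  have hpe : Continuous (IccExtend hT ((Icc 0 T).domRestrict p)) :=
    (continuousOn_iff_continuous_domRestrict.1 hpc).Icc_extend'
  have heq : ∀ t ∈ Icc 0 T, IccExtend hT ((Icc 0 T).domRestrict p) t = p t := fun t ht => by
    rw [IccExtend_of_mem hT _ ht]; rfl
  refine ⟨fun t => u₀ + ∫ s in (0 : ℝ)..t, IccExtend hT ((Icc 0 T).domRestrict p) s, _, hpe,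
    by simp, fun t => ?_, fun t ht => ?_⟩
  · exact (intervalIntegral.integral_hasDerivAt_right (hpe.intervalIntegrable _ _)
      (hpe.stronglyMeasurableAtFilter _ _) hpe.continuousAt).const_add _
  · have h1 : ∫ s in (0 : ℝ)..t, IccExtend hT ((Icc 0 T).domRestrict p) s =
        ∫ s in (0 : ℝ)..t, p s := by
      refine intervalIntegral.integral_congr fun s hs => heq s ?_
      rw [uIcc_of_le ht.1] at hs
      exact ⟨hs.1, hs.2.trans ht.2⟩
    -- Adding (u₀, v₀) to the integrated equation cancels P(0)p(0) = v₀ and leaves Au = Pp.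
    have h2 := A.graph.add_mem h (hp t ht)
    rw [hNP, Prod.mk_add_mk, add_sub_cancel] at h2
    beta_reduce
    rw [heq t ht, h1]
    exact h2

/-- Energy estimate for classical solutions. -/
theorem IsCoeff.exists_classical_bound (hc : IsCoeff P N K c) (hA : MaxDissipative A)
    (T : ℝ) : ∃ C, 0 ≤ C ∧ ∀ u : ℝ → X, ContinuousOn u (Icc 0 T) →
    (∀ t ∈ Ioc 0 T, ∃ v, (u t, v) ∈ A.graph ∧ HasDerivAt u (N t v) t) →
    ∀ t ∈ Icc 0 T, ‖u t‖ ≤ C * ‖u 0‖ := by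
  have hK := hc.K_nonneg
  have hcp := hc.c_pos
  refine ⟨√(Real.exp (K / c * T) * K / c), Real.sqrt_nonneg _, fun u hu h t ht => ?_⟩
  rcases eq_or_lt_of_le ht.1 with rfl | ht0
  -- At t = 0 the claim needs a constant at least 1. This follows from c ≤ K, which coercivity and
  -- boundedness of P yield as soon as u 0 ≠ 0.
  · rcases eq_or_ne (u 0) 0 with h0 | h0
    · simp [h0]
    have h1 : c * ‖u 0‖ ^ 2 ≤ K * ‖u 0‖ ^ 2 := by
      refine (hc.coP 0 _).trans ((real_inner_le_norm _ _).trans ?_)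
      rw [pow_two, ← mul_assoc]
      gcongr
      exact (P 0).le_of_opNorm_le (hc.boundP 0) _
    have h2 : c ≤ K := le_of_mul_le_mul_right h1 (by positivity)
    have h3 : 1 ≤ Real.exp (K / c * T) := Real.one_le_exp (by have := ht.2; positivity)
    have h4 : 1 ≤ √(Real.exp (K / c * T) * K / c) := by
      rw [Real.one_le_sqrt, le_div_iff₀ hcp]; nlinarith
    nlinarith [norm_nonneg (u 0)]
  choose! v hv hvd using h
  -- The equation is not assumed at time 0, so the energy inequality starts at ε and continuity of u
  -- gives the limit ε → 0.
  have key : ∀ ε ∈ Ioo 0 t, c * ‖u t‖ ^ 2 ≤ Real.exp (K / c * T) * (K * ‖u ε‖ ^ 2) := by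
    intro ε hε
    have hsub : ∀ s ∈ Ico ε t, s ∈ Ioc 0 T := fun s hs =>
      ⟨hε.1.trans_le hs.1, hs.2.le.trans ht.2⟩
    have := energy_bound (P := P) (x := u) (a := ε) (b := t) (C₀ := 0)
      (φ := fun _ => 0) hcp hK le_rfl hc.lipP hc.symmP
      hc.coP (hu.mono fun s hs => ⟨hε.1.le.trans hs.1, hs.2.trans ht.2⟩)
      (fun s hs => (hvd s (hsub s hs)).hasDerivWithinAt)
      continuous_const (fun t => le_rfl) (fun s hs => by
        rw [hc.PN]
        simpa using hA.inner_graph (hv s (hsub s hs))) t ⟨hε.2.le, le_rfl⟩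
    refine this.trans ?_
    simp only [intervalIntegral.integral_zero, mul_zero, add_zero]
    have h1 : ⟪P ε (u ε), u ε⟫ ≤ K * ‖u ε‖ ^ 2 := by
      refine (real_inner_le_norm _ _).trans ?_
      rw [pow_two, ← mul_assoc]
      gcongr
      exact (P ε).le_of_opNorm_le (hc.boundP ε) _
    have h2 : 0 ≤ ⟪P ε (u ε), u ε⟫ := le_trans (by positivity) (hc.coP ε (u ε))
    gcongr
    linarith [hε.1, ht.2]
  have hlim : Tendsto (fun ε => Real.exp (K / c * T) * (K * ‖u ε‖ ^ 2)) (𝓝[Ioo 0 t] 0)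
      (𝓝 (Real.exp (K / c * T) * (K * ‖u 0‖ ^ 2))) := by
    have h1 : Tendsto u (𝓝[Ioo 0 t] 0) (𝓝 (u 0)) :=
      (hu 0 ⟨le_rfl, ht.1.trans ht.2⟩).mono fun s hs => ⟨hs.1.le, hs.2.le.trans ht.2⟩
    exact (((h1.norm).pow 2).const_mul K).const_mul _
  have : (𝓝[Ioo 0 t] (0 : ℝ)).NeBot := left_nhdsWithin_Ioo_neBot ht0
  have h2 := ge_of_tendsto hlim (eventually_nhdsWithin_of_forall key)
  refine abs_le_of_sq_le_sq' ?_ (by positivity) |>.2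
  rw [mul_pow, Real.sq_sqrt (by positivity), div_mul_eq_mul_div, le_div_iff₀ hcp]
  linarith

end Mild

/-! ### Uniqueness for factored families -/

section Cauchy

open scoped RealInnerProductSpace

variable {X : Type*} [NormedAddCommGroup X] [InnerProductSpace ℝ X]
  {𝒜 : ℝ → X →ₗ.[ℝ] X} {A : X →ₗ.[ℝ] X}

/-- The operators `𝒜 t` are of the form `N(t) A` with coefficients `N` that are admissible on
bounded time intervals. -/
def IsFactored (𝒜 : ℝ → X →ₗ.[ℝ] X) (A : X →ₗ.[ℝ] X) : Prop :=
  ∀ T > 0, ∃ (P N : ℝ → X →L[ℝ] X) (K c : ℝ), IsCoeff P N K c ∧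
    (∀ᵐ t, DifferentiableAt ℝ P t) ∧
    ∀ t ∈ Icc 0 T, ∀ u w, (u, w) ∈ (𝒜 t).graph ↔ ∃ v, (u, v) ∈ A.graph ∧ N t v = w

/-- The graph form hides the proof of membership in the domain, so that subtraction and replacement
of solutions need no dependent rewriting. -/
theorem isClassicalSolution_iff {U : ℝ → X} : IsClassicalSolution 𝒜 U ↔
    ContinuousOn U (Ici 0) ∧ ∀ t > 0, ∃ w, (U t, w) ∈ (𝒜 t).graph ∧ HasDerivAt U w t := by
  constructor
  · rintro ⟨h1, h2⟩
    refine ⟨h1, fun t ht => ?_⟩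
    obtain ⟨h, hd⟩ := h2 t ht
    exact ⟨_, (𝒜 t).mem_graph ⟨U t, h⟩, hd⟩
  · rintro ⟨h1, h2⟩
    refine ⟨h1, fun t ht => ?_⟩
    obtain ⟨w, hw, hd⟩ := h2 t ht
    obtain ⟨y, hy, rfl⟩ := (LinearPMap.mem_graph_iff _).1 hw
    obtain ⟨y, hy'⟩ := y
    obtain rfl : y = U t := hy
    exact ⟨hy', hd⟩

theorem IsClassicalSolution.sub {U V : ℝ → X} (hU : IsClassicalSolution 𝒜 U)
    (hV : IsClassicalSolution 𝒜 V) : IsClassicalSolution 𝒜 (fun t => U t - V t) := by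
  rw [isClassicalSolution_iff] at *
  refine ⟨hU.1.sub hV.1, fun t ht => ?_⟩
  obtain ⟨w, hw, hwd⟩ := hU.2 t ht
  obtain ⟨w', hw', hwd'⟩ := hV.2 t ht
  exact ⟨w - w', (𝒜 t).graph.sub_mem hw hw', hwd.sub hwd'⟩

theorem IsClassicalSolution.congr {U V : ℝ → X} (hU : IsClassicalSolution 𝒜 U)
    (h : EqOn U V (Ici 0)) : IsClassicalSolution 𝒜 V := by
  rw [isClassicalSolution_iff] at *
  refine ⟨hU.1.congr h.symm, fun t ht => ?_⟩
  obtain ⟨w, hw, hwd⟩ := hU.2 t ht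
  rw [h (le_of_lt ht : (0 : ℝ) ≤ t)] at hw
  refine ⟨w, hw, hwd.congr_of_eventuallyEq ?_⟩
  filter_upwards [lt_mem_nhds ht] with s hs
  exact (h (le_of_lt hs : (0 : ℝ) ≤ s)).symm

theorem IsFactored.exists_bound (h : IsFactored 𝒜 A) (hA : MaxDissipative A) {T : ℝ} (hT : 0 < T) :
    ∃ C, 0 ≤ C ∧ ∀ U, IsClassicalSolution 𝒜 U → ∀ t ∈ Icc 0 T, ‖U t‖ ≤ C * ‖U 0‖ := by
  obtain ⟨P, N, K, c, hc, -, hN⟩ := h T hT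
  obtain ⟨C, hC0, hC⟩ := hc.exists_classical_bound hA T
  refine ⟨C, hC0, fun U hU => hC U (hU.continuousOn.mono fun t ht => ht.1) fun t ht => ?_⟩
  obtain ⟨w, hw, hd⟩ := (isClassicalSolution_iff.1 hU).2 t ht.1
  obtain ⟨v, hv, rfl⟩ := (hN t ⟨ht.1.le, ht.2⟩ _ _).1 hw
  exact ⟨v, hv, hd⟩

/-- Differences of classical approximants satisfy the energy bound. Their initial values need not
agree, but the differences at time 0 tend to U 0 - V 0 = 0. -/
theorem IsFactored.mild_unique (h : IsFactored 𝒜 A) (hA : MaxDissipative A) {U V : ℝ → X}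
    (hU : IsMildSolution 𝒜 U) (hV : IsMildSolution 𝒜 V) (h0 : U 0 = V 0) {t : ℝ} (ht : 0 ≤ t) :
    U t = V t := by
  obtain ⟨-, u, hu, hul⟩ := hU
  obtain ⟨-, v, hv, hvl⟩ := hV
  obtain ⟨C, hC0, hC⟩ := h.exists_bound hA (T := t + 1) (by linarith)
  have h0' : (0 : ℝ) ∈ Icc 0 (t + 1) := ⟨le_rfl, by linarith⟩
  have ht' : t ∈ Icc 0 (t + 1) := ⟨ht, by linarith⟩
  have l1 := ((hul (t + 1) (by linarith)).tendsto_at ht').sub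
    ((hvl (t + 1) (by linarith)).tendsto_at ht')
  have l2 := ((hul (t + 1) (by linarith)).tendsto_at h0').sub
    ((hvl (t + 1) (by linarith)).tendsto_at h0')
  have l3 := le_of_tendsto_of_tendsto l1.norm (l2.norm.const_mul C)
    (Eventually.of_forall fun n => hC _ ((hu n).sub (hv n)) t ht')
  rw [h0, sub_self, norm_zero, mul_zero, norm_le_zero_iff, sub_eq_zero] at l3
  exact l3

end Cauchy
-- Global classical and mild solutions
section Cauchy

open scoped RealInnerProductSpace

variable {X : Type*} [NormedAddCommGroup X] [InnerProductSpace ℝ X]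
  {𝒜 : ℝ → X →ₗ.[ℝ] X} {A : X →ₗ.[ℝ] X}

theorem IsClassicalSolution.isMildSolution {U : ℝ → X} (hU : IsClassicalSolution 𝒜 U) :
    IsMildSolution 𝒜 U :=
  ⟨hU.continuousOn, fun _ => U, fun _ => hU, fun _ _ =>
    Metric.tendstoUniformlyOn_iff.2 fun ε hε => Eventually.of_forall fun _ _ _ => by simpa using hε⟩

theorem IsFactored.domain_zero (h : IsFactored 𝒜 A) : (𝒜 0).domain = A.domain := by
  obtain ⟨P, N, K, c, -, -, hN⟩ := h 1 one_pos
  ext u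
  rw [LinearPMap.mem_domain_iff, LinearPMap.mem_domain_iff]
  constructor
  · rintro ⟨w, hw⟩
    obtain ⟨v, hv, -⟩ := (hN 0 (by simp) _ _).1 hw
    exact ⟨v, hv⟩
  · rintro ⟨v, hv⟩
    exact ⟨_, (hN 0 (by simp) _ _).2 ⟨v, hv, rfl⟩⟩

variable [CompleteSpace X]

/-- Besides u and u' = p the continuous function v = Pp = Au is recorded; it yields continuity in
the graph norm. -/
theorem IsFactored.exists_local (h : IsFactored 𝒜 A) (hA : MaxDissipative A) {T : ℝ} (hT : 0 < T)
    {u₀ : X} (hu₀ : u₀ ∈ A.domain) :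
    ∃ u p v : ℝ → X, Continuous p ∧ u 0 = u₀ ∧ (∀ t, HasDerivAt u (p t) t) ∧
      ContinuousOn v (Icc 0 T) ∧
      ∀ t ∈ Icc 0 T, (u t, v t) ∈ A.graph ∧ (u t, p t) ∈ (𝒜 t).graph := by
  obtain ⟨P, N, K, c, hc, hd, hN⟩ := h T hT
  obtain ⟨u, p, hp, hu0, hu, hg⟩ := hc.exists_classical hA hT.le hd (A.mem_graph ⟨u₀, hu₀⟩)
    (hc.PN 0 _)
  refine ⟨u, p, fun t => P t (p t), hp, hu0, hu, (hc.contP.clm_apply hp).continuousOn,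
    fun t ht => ⟨hg t ht, (hN t ht _ _).2 ⟨_, hg t ht, ?_⟩⟩⟩
  -- Only PN = 1 is part of the coefficient data; NP = 1 follows because coercivity makes P
  -- injective.
  have h1 : P t (N t (P t (p t)) - p t) = 0 := by rw [map_sub, hc.PN, sub_self]
  have h2 := hc.coP t (N t (P t (p t)) - p t)
  rw [h1, inner_zero_left] at h2
  have h3 : ‖N t (P t (p t)) - p t‖ ^ 2 ≤ 0 := by
    by_contra! h4
    exact absurd h2 (not_le.2 (mul_pos hc.c_pos h4))
  exact sub_eq_zero.1 (norm_eq_zero.1 (pow_eq_zero_iff two_ne_zero |>.1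
    (le_antisymm h3 (by positivity))))

/-- Regular initial values give classical solutions. -/
theorem IsFactored.exists_classical (h : IsFactored 𝒜 A) (hA : MaxDissipative A)
    {u₀ : X} (hu₀ : u₀ ∈ A.domain) :
    ∃ U, IsClassicalSolution 𝒜 U ∧ U 0 = u₀ ∧ ContDiffOn ℝ 1 U (Ici 0) ∧
      ∃ V : ℝ → X, ContinuousOn V (Ici 0) ∧ ∀ t ≥ 0, (U t, V t) ∈ A.graph := by
  -- The solutions on [0, n+1] agree by uniqueness and are glued by taking n = ⌈t⌉₊ at time t. The
  -- extra 1 puts t strictly below the right end, so the formula holds near t in [0, ∞).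
  choose u p v hp hu0 hu hv hg using fun n : ℕ =>
    h.exists_local hA (T := (n : ℝ) + 1) (by positivity) hu₀
  have huniq : ∀ m n : ℕ, m ≤ n → ∀ t ∈ Icc 0 ((m : ℝ) + 1), u m t = u n t := by
    intro m n hmn t ht
    obtain ⟨P, N, K, c, hc, -, hN⟩ := h ((m : ℝ) + 1) (by positivity)
    obtain ⟨C, hC0, hC⟩ := hc.exists_classical_bound hA ((m : ℝ) + 1)
    have hmn' : (m : ℝ) ≤ n := by exact_mod_cast hmn
    have := hC (fun t => u m t - u n t)
      (fun s _ => ((hu m s).sub (hu n s)).continuousAt.continuousWithinAt) (fun s hs => by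
        have hs1 : s ∈ Icc 0 ((m : ℝ) + 1) := ⟨hs.1.le, hs.2⟩
        have hs2 : s ∈ Icc 0 ((n : ℝ) + 1) := ⟨hs.1.le, hs.2.trans (by linarith)⟩
        obtain ⟨w, hw, hwp⟩ := (hN s hs1 _ _).1 (hg m s hs1).2
        obtain ⟨w', hw', hwp'⟩ := (hN s hs1 _ _).1 (hg n s hs2).2
        refine ⟨w - w', A.graph.sub_mem hw hw', ?_⟩
        rw [map_sub, hwp, hwp']
        exact (hu m s).sub (hu n s)) t ht
    rw [hu0, hu0, sub_self, norm_zero, mul_zero, norm_le_zero_iff, sub_eq_zero] at this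
    exact this
  have hlt : ∀ t : ℝ, t ≤ ⌈t⌉₊ := fun t => Nat.le_ceil t
  have hUeq : ∀ n : ℕ, ∀ t ∈ Icc 0 ((n : ℝ) + 1), u ⌈t⌉₊ t = u n t := by
    intro n t ht
    rcases le_total ⌈t⌉₊ n with hle | hle
    · exact huniq _ _ hle t ⟨ht.1, (hlt t).trans (by linarith)⟩
    · exact (huniq _ _ hle t ht).symm
  have hVeq : ∀ n : ℕ, ∀ t ∈ Icc 0 ((n : ℝ) + 1), v ⌈t⌉₊ t = v n t := by
    intro n t ht
    exact A.mem_graph_snd_inj' (hg _ t ⟨ht.1, (hlt t).trans (by linarith)⟩).1 (hg n t ht).1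
      (hUeq n t ht)
  have hnhds : ∀ t : ℝ, 0 ≤ t → Icc 0 ((⌈t⌉₊ : ℝ) + 1) ∈ 𝓝[Ici 0] t := fun t ht => by
    rw [← Ici_inter_Iic]
    exact inter_mem self_mem_nhdsWithin (mem_nhdsWithin_of_mem_nhds
      (Iic_mem_nhds ((hlt t).trans_lt (by linarith))))
  have hself : ∀ t : ℝ, 0 ≤ t → t ∈ Icc 0 ((⌈t⌉₊ : ℝ) + 1) := fun t ht =>
    ⟨ht, (hlt t).trans (by linarith)⟩
  have hderiv : ∀ t ≥ 0, HasDerivWithinAt (fun t => u ⌈t⌉₊ t) (p ⌈t⌉₊ t) (Ici 0) t := by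
    intro t ht
    refine (hu ⌈t⌉₊ t).hasDerivWithinAt.congr_of_eventuallyEq ?_ rfl
    filter_upwards [hnhds t ht] with s hs using hUeq _ s hs
  have hcont : ContinuousOn (fun t => u ⌈t⌉₊ t) (Ici 0) := fun t ht =>
    (hderiv t ht).continuousWithinAt
  refine ⟨fun t => u ⌈t⌉₊ t, isClassicalSolution_iff.2 ⟨hcont, fun t ht => ?_⟩, by simp [hu0], ?_,
    fun t => v ⌈t⌉₊ t, fun t ht => ?_, fun t ht => (hg _ t (hself t ht)).1⟩
  · exact ⟨_, (hg _ t (hself t ht.le)).2, (hderiv t ht.le).hasDerivAt (Ici_mem_nhds ht)⟩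
  · rw [contDiffOn_one_iff_derivWithin (uniqueDiffOn_Ici 0)]
    refine ⟨fun t ht => (hderiv t ht).differentiableWithinAt, fun t ht => ?_⟩
    -- The right end is excluded because beyond it the glued function is no longer known to coincide
    -- with this piece.
    have hd : ∀ s ∈ Icc 0 ((⌈t⌉₊ : ℝ) + 1), s ≠ (⌈t⌉₊ : ℝ) + 1 →
        derivWithin (fun t => u ⌈t⌉₊ t) (Ici 0) s = p ⌈t⌉₊ s := by
      intro s hs hs'
      refine HasDerivWithinAt.derivWithin ?_ (uniqueDiffOn_Ici 0 s hs.1)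
      refine (hu ⌈t⌉₊ s).hasDerivWithinAt.congr_of_eventuallyEq ?_ (hUeq _ s hs)
      have : Icc 0 ((⌈t⌉₊ : ℝ) + 1) ∈ 𝓝[Ici 0] s := by
        rw [← Ici_inter_Iic]
        exact inter_mem self_mem_nhdsWithin (mem_nhdsWithin_of_mem_nhds
          (Iic_mem_nhds (lt_of_le_of_ne hs.2 hs')))
      filter_upwards [this] with r hr using hUeq _ r hr
    refine ((hp ⌈t⌉₊).continuousAt.continuousWithinAt (s := Ici 0)).congr_of_eventuallyEq ?_
      (hd t (hself t ht) ((hlt t).trans_lt (by linarith)).ne)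
    filter_upwards [hnhds t ht, mem_nhdsWithin_of_mem_nhds
      (Iio_mem_nhds ((hlt t).trans_lt (by linarith : (⌈t⌉₊ : ℝ) < ⌈t⌉₊ + 1)))] with s hs hs'
    exact hd s hs (ne_of_lt hs')
  · refine ((hv ⌈t⌉₊ t (hself t ht)).mono_of_mem_nhdsWithin (hnhds t ht)).congr_of_eventuallyEq
      ?_ rfl
    filter_upwards [hnhds t ht] with s hs using hVeq _ s hs

/-- Initial values in the dense domain have classical solutions, and the energy bound makes these
uniformly Cauchy on bounded intervals when the initial values converge. -/
theorem IsFactored.exists_mild (h : IsFactored 𝒜 A) (hA : MaxDissipative A) (u₀ : X) :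
    ∃ U, IsMildSolution 𝒜 U ∧ U 0 = u₀ := by
  obtain ⟨x, hx, hxu⟩ := mem_closure_iff_seq_limit.1 (hA.dense_domain u₀)
  choose V hV hV0 _ _ using fun n => h.exists_classical hA (hx n)
  have hC : ∀ T > 0, UniformCauchySeqOn V atTop (Icc 0 T) := by
    intro T hT
    obtain ⟨C, hC0, hC⟩ := h.exists_bound hA hT
    rw [Metric.uniformCauchySeqOn_iff]
    intro ε hε
    obtain ⟨n₀, hn₀⟩ := Metric.cauchySeq_iff.1 hxu.cauchySeq (ε / (C + 1)) (by positivity)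
    refine ⟨n₀, fun m hm n hn t ht => ?_⟩
    have h1 := hC _ ((hV m).sub (hV n)) t ht
    have h2 := hn₀ m hm n hn
    rw [hV0, hV0] at h1
    rw [dist_eq_norm] at h2 ⊢
    rw [lt_div_iff₀ (by positivity)] at h2
    nlinarith [norm_nonneg (x m - x n)]
  have hlim : ∀ t ≥ 0, ∃ y, Tendsto (fun n => V n t) atTop (𝓝 y) := fun t ht =>
    cauchySeq_tendsto_of_complete ((hC (t + 1) (by linarith)).cauchySeq (x := t)
      ⟨ht, by linarith⟩)
  choose! U hU using hlim
  have hunif : ∀ T > 0, TendstoUniformlyOn V U atTop (Icc 0 T) := fun T hT =>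
    (hC T hT).tendstoUniformlyOn_of_tendsto fun t ht => hU t ht.1
  refine ⟨U, ⟨fun t ht => ?_, V, hV, hunif⟩, ?_⟩
  · have ht' : (0 : ℝ) ≤ t := ht
    have h1 := (hunif (t + 1) (by linarith)).continuousOn
      (Eventually.of_forall fun n => (hV n).continuousOn.mono fun s hs => hs.1).frequently
    refine (h1 t ⟨ht, by linarith⟩).mono_of_mem_nhdsWithin ?_
    rw [← Ici_inter_Iic]
    exact inter_mem self_mem_nhdsWithin (mem_nhdsWithin_of_mem_nhds (Iic_mem_nhds (by linarith)))
  · refine tendsto_nhds_unique (hU 0 le_rfl) ?_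
    simpa only [hV0] using hxu

/-- Well-posedness of `U' = N(t) A U` for a maximal dissipative operator `A`. -/
theorem IsFactored.wellPosed (h : IsFactored 𝒜 A) (hA : MaxDissipative A) (u₀ : X) :
    (∃ U : ℝ → X, IsMildSolution 𝒜 U ∧ U 0 = u₀) ∧
    (∀ U V : ℝ → X, IsMildSolution 𝒜 U → IsMildSolution 𝒜 V → U 0 = u₀ → V 0 = u₀ →
      ∀ t ≥ 0, U t = V t) ∧
    (u₀ ∈ (𝒜 0).domain → ∀ U : ℝ → X, IsMildSolution 𝒜 U → U 0 = u₀ →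
      IsClassicalSolution 𝒜 U ∧ ContinuousIntoDomain (𝒜 0) U ∧ ContDiffOn ℝ 1 U (Ici 0)) := by
  refine ⟨h.exists_mild hA u₀, fun U V hU hV hU0 hV0 t ht =>
    h.mild_unique hA hU hV (hU0.trans hV0.symm) ht, fun hu₀ U hU hU0 => ?_⟩
  rw [h.domain_zero] at hu₀
  obtain ⟨W, hW, hW0, hW1, V, hV, hWV⟩ := h.exists_classical hA hu₀
  have heq : EqOn W U (Ici 0) := fun t ht =>
    h.mild_unique hA hW.isMildSolution hU (hW0.trans hU0.symm) ht
  refine ⟨hW.congr heq, ?_, hW1.congr heq.symm⟩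
  obtain ⟨P, N, K, c, -, -, hN⟩ := h 1 one_pos
  -- Graph continuity concerns the operator at time 0, which acts along the solution as N(0)AU(t) =
  -- N(0)V(t).
  refine ⟨fun t => ⟨(U t, N 0 (V t)), (hN 0 (by simp) _ _).2 ⟨V t, ?_, rfl⟩⟩, ?_, fun _ => rfl⟩
  · rw [← heq t.2]; exact hWV t t.2
  · refine Continuous.subtype_mk (Continuous.prodMk ?_ ((N 0).continuous.comp ?_)) _
    · exact continuousOn_iff_continuous_domRestrict.1 hU.1
    · exact continuousOn_iff_continuous_domRestrict.1 hV

end Cauchy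

/-- `u` is a primitive of the integrable function `v` on `[a, b]`. -/
structure IsPrimitive (a b : ℝ) (u v : ℝ → ℝ) : Prop where
  integrable : IntervalIntegrable v volume a b
  eq : ∀ x ∈ Icc a b, u x = u a + ∫ y in a..x, v y

/-! ### Sobolev functions on an interval as iterated primitives -/

section Sobolev

variable {a b : ℝ} {u v u' v' f g : ℝ → ℝ}

theorem ae_restrict_Ioo_iff_uIoc (hab : a ≤ b) {p : ℝ → Prop} :
    (∀ᵐ x ∂volume.restrict (Ioo a b), p x) ↔ ∀ᵐ x, x ∈ uIoc a b → p x := by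
  rw [uIoc_of_le hab, Measure.restrict_congr_set Ioo_ae_eq_Ioc,
    ae_restrict_iff' measurableSet_Ioc]

theorem integral_Ioo_eq (hab : a ≤ b) (f : ℝ → ℝ) : ∫ x in Ioo a b, f x = ∫ x in a..b, f x := by
  rw [intervalIntegral.integral_of_le hab, integral_Ioc_eq_integral_Ioo]

namespace IsPrimitive

theorem continuousOn (h : IsPrimitive a b u v) (hab : a ≤ b) : ContinuousOn u (Icc a b) := by
  have := intervalIntegral.continuousOn_primitive_interval' h.integrable left_mem_uIcc
  rw [uIcc_of_le hab] at this
  exact (continuousOn_const.add this).congr h.eq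

theorem congr_right (h : IsPrimitive a b u v) (hab : a ≤ b)
    (e : v =ᵐ[volume.restrict (Ioo a b)] v') : IsPrimitive a b u v' := by
  have e' := (ae_restrict_Ioo_iff_uIoc hab).1 e
  refine ⟨h.integrable.congr_ae ((ae_restrict_iff' measurableSet_uIoc).2 e'), fun x hx => ?_⟩
  rw [h.eq x hx]
  congr 1
  refine intervalIntegral.integral_congr_ae ?_
  filter_upwards [e'] with y hy hyx
  refine hy ?_
  rw [uIoc_of_le hab]
  rw [uIoc_of_le hx.1] at hyx
  exact ⟨hyx.1, hyx.2.trans hx.2⟩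

theorem of_hasDerivAt (hab : a ≤ b) (hu : ∀ x ∈ Icc a b, HasDerivAt u (v x) x)
    (hv : ContinuousOn v (Icc a b)) : IsPrimitive a b u v := by
  refine ⟨hv.intervalIntegrable_of_Icc hab, fun x hx => ?_⟩
  rw [intervalIntegral.integral_eq_sub_of_hasDerivAt (f := u), add_sub_cancel]
  · intro y hy
    rw [uIcc_of_le hx.1] at hy
    exact hu y ⟨hy.1, hy.2.trans hx.2⟩
  · exact (hv.mono (Icc_subset_Icc_right hx.2)).intervalIntegrable_of_Icc hx.1

/-- Integration by parts. -/
theorem integral_add_eq (h : IsPrimitive a b u u') (k : IsPrimitive a b v v') (hab : a ≤ b) :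
    (∫ x in a..b, u' x * v x) + ∫ x in a..b, u x * v' x = u b * v b - u a * v a := by
  have hu := h.continuousOn hab
  have hv := k.continuousOn hab
  rw [← uIcc_of_le hab] at hu hv
  rw [← intervalIntegral.integral_add (h.integrable.mul_continuousOn hv)
    (k.integrable.continuousOn_mul hu)]
  have acu : AbsolutelyContinuousOnInterval (fun x => u a + ∫ y in a..x, u' y) a b :=
    (LipschitzWith.const (u a) |>.lipschitzOnWith.absolutelyContinuousOnInterval).add
      (h.integrable.absolutelyContinuousOnInterval_intervalIntegral left_mem_uIcc)
  have acv : AbsolutelyContinuousOnInterval (fun x => v a + ∫ y in a..x, v' y) a b :=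
    (LipschitzWith.const (v a) |>.lipschitzOnWith.absolutelyContinuousOnInterval).add
      (k.integrable.absolutelyContinuousOnInterval_intervalIntegral left_mem_uIcc)
  have key := AbsolutelyContinuousOnInterval.integral_deriv_mul_eq_sub acu acv
  rw [← h.eq b ⟨hab, le_rfl⟩, ← k.eq b ⟨hab, le_rfl⟩, ← h.eq a ⟨le_rfl, hab⟩,
    ← k.eq a ⟨le_rfl, hab⟩] at key
  rw [← key]
  refine intervalIntegral.integral_congr_ae ?_
  filter_upwards [h.integrable.ae_hasDerivAt_integral, k.integrable.ae_hasDerivAt_integral]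
    with x h1 h2 hx
  have hx' := uIoc_subset_uIcc hx
  rw [((h1 hx' a left_mem_uIcc).const_add (u a)).deriv,
    ((h2 hx' a left_mem_uIcc).const_add (v a)).deriv]
  rw [uIcc_of_le hab] at hx'
  rw [← h.eq x hx', ← k.eq x hx']

theorem integral_mul_swap (h : IsPrimitive a b u u') (k : IsPrimitive a b v v') (hab : a ≤ b) :
    ∫ x in a..b, u x * v' x = u b * v b - u a * v a - ∫ x in a..b, u' x * v x := by
  rw [← h.integral_add_eq k hab]; ring

theorem hasWeakDeriv (h : IsPrimitive a b u v) (hab : a ≤ b) : HasWeakDeriv a b u v := by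
  refine ⟨?_, ?_, fun φ h1 h2 h3 => ?_⟩
  · exact ((h.continuousOn hab).mono Ioo_subset_Icc_self).locallyIntegrableOn measurableSet_Ioo
  · refine IntegrableOn.locallyIntegrableOn ?_
    exact (intervalIntegrable_iff_integrableOn_Ioo_of_le hab).1 h.integrable
  · have hd : ∀ x, HasDerivAt φ (deriv φ x) x := fun x =>
      (h1.differentiable (by simp) x).hasDerivAt
    have hφ : IsPrimitive a b φ (deriv φ) := .of_hasDerivAt hab (fun x _ => hd x)
      (h1.continuous_deriv (by simp)).continuousOn
    have h0 : ∀ x ∉ Ioo a b, φ x = 0 := fun x hx => image_eq_zero_of_notMem_tsupport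
      fun hx' => hx (h3 hx')
    rw [integral_Ioo_eq hab, integral_Ioo_eq hab, h.integral_mul_swap hφ hab, h0 a (by simp),
      h0 b (by simp)]
    simp

end IsPrimitive

theorem isPrimitive_integral (hg : IntervalIntegrable g volume a b) (c : ℝ) :
    IsPrimitive a b (fun x => c + ∫ y in a..x, g y) g :=
  ⟨hg, fun x _ => by simp⟩

open scoped ContDiff in
-- The primitive from a vanishes to the left of the support of η, and to its right because η has
-- mean zero. So test functions of mean zero are exactly the admissible derivatives.
theorem exists_test_primitive {η : ℝ → ℝ} (h1 : ContDiff ℝ ∞ η)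
    (h2 : HasCompactSupport η) (h3 : tsupport η ⊆ Ioo a b) (h4 : ∫ x, η x = 0) :
    ∃ φ : ℝ → ℝ, ContDiff ℝ ∞ φ ∧ HasCompactSupport φ ∧ tsupport φ ⊆ Ioo a b ∧ deriv φ = η := by
  rcases (tsupport η).eq_empty_or_nonempty with he | hne
  · have : η = 0 := by
      funext x
      exact image_eq_zero_of_notMem_tsupport (by simp [he])
    subst this
    exact ⟨0, contDiff_const, HasCompactSupport.zero, by simp [tsupport], by
      funext x; exact deriv_const x 0⟩
  obtain ⟨c, hc, hcl⟩ := IsCompact.exists_isLeast h2 hne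
  obtain ⟨d, hd, hdl⟩ := IsCompact.exists_isGreatest h2 hne
  have hc' := h3 hc
  have hd' := h3 hd
  have h0 : ∀ x, x < c ∨ d < x → η x = 0 := fun x hx =>
    image_eq_zero_of_notMem_tsupport fun hx' => by
      rcases hx with hx | hx
      · exact absurd (hcl hx') (not_le.2 hx)
      · exact absurd (hdl hx') (not_le.2 hx)
  have hηc := h1.continuous
  have hder : ∀ x, HasDerivAt (fun x => ∫ y in a..x, η y) (η x) x := fun x =>
    intervalIntegral.integral_hasDerivAt_right (hηc.intervalIntegrable _ _)
      (hηc.stronglyMeasurableAtFilter _ _) hηc.continuousAt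
  have hderiv : deriv (fun x => ∫ y in a..x, η y) = η := funext fun x => (hder x).deriv
  have hleft : ∀ x < c, ∫ y in a..x, η y = 0 := by
    intro x hx
    refine intervalIntegral.integral_zero_ae (ae_of_all _ fun y hy => h0 y (Or.inl ?_))
    exact hy.2.trans_lt (max_lt hc'.1 hx)
  have hright : ∀ x, d < x → ∫ y in a..x, η y = 0 := by
    intro x hx
    have hax : a ≤ x := (hd'.1.trans hx).le
    rw [← h4, intervalIntegral.integral_of_le hax]
    refine setIntegral_eq_integral_of_forall_compl_eq_zero fun y hy => h0 y ?_
    by_contra! hcon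
    exact hy ⟨hc'.1.trans_le hcon.1, hcon.2.trans hx.le⟩
  have hsupp : tsupport (fun x => ∫ y in a..x, η y) ⊆ Icc c d := by
    refine closure_minimal (fun x hx => ?_) isClosed_Icc
    by_contra hcon
    rw [mem_Icc, not_and_or, not_le, not_le] at hcon
    rcases hcon with hcon | hcon
    · exact hx (hleft x hcon)
    · exact hx (hright x hcon)
  refine ⟨fun x => ∫ y in a..x, η y, ?_, ?_, ?_, hderiv⟩
  · rw [contDiff_infty_iff_deriv, hderiv]
    exact ⟨fun x => (hder x).differentiableAt, h1⟩
  · exact isCompact_Icc.of_isClosed_subset (isClosed_tsupport _) hsupp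
  · exact hsupp.trans fun x hx => ⟨hc'.1.trans_le hx.1, hx.2.trans_lt hd'.2⟩

open scoped ContDiff in
/-- A function with vanishing weak derivative is constant. -/
theorem HasWeakDeriv.ae_eq_const (hab : a < b) (h : HasWeakDeriv a b f 0) :
    ∃ c, f =ᵐ[volume.restrict (Ioo a b)] fun _ => c := by
  let B : ContDiffBump ((a + b) / 2) :=
    ⟨(b - a) / 8, (b - a) / 4, by linarith, by linarith⟩
  set ψ := B.normed volume with hψ
  have s1 : ContDiff ℝ ∞ ψ := B.contDiff_normed
  have s2 : HasCompactSupport ψ := B.hasCompactSupport_normed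
  have s3 : tsupport ψ ⊆ Ioo a b := by
    rw [hψ, B.tsupport_normed_eq, Real.closedBall_eq_Icc]
    intro x hx
    simp only [B, mem_Icc] at hx
    exact ⟨by linarith [hx.1], by linarith [hx.2]⟩
  have s4 : ∫ x, ψ x = 1 := B.integral_normed
  set c := ∫ x in Ioo a b, f x * ψ x with hc
  refine ⟨c, ?_⟩
  have hci : LocallyIntegrableOn (fun _ : ℝ => c) (Ioo a b) :=
    (locallyIntegrable_const c).locallyIntegrableOn _
  have key := isOpen_Ioo.ae_eq_zero_of_integral_contDiff_smul_eq_zero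
    (μ := volume.restrict (Ioo a b)) (U := Ioo a b) (f := f - fun _ => c) ?_ ?_
  · filter_upwards [key, ae_restrict_mem measurableSet_Ioo] with x hx hm
    exact sub_eq_zero.1 (hx hm)
  · intro x hx
    obtain ⟨t, ht, hi⟩ := (h.left.sub hci) x hx
    exact ⟨t, ht, hi.mono_measure Measure.restrict_le_self⟩
  · intro φ h1 h2 h3
    have hint : ∀ η : ℝ → ℝ, tsupport η ⊆ Ioo a b → ∫ x in Ioo a b, η x = ∫ x, η x := by
      intro η hη
      refine setIntegral_eq_integral_of_forall_compl_eq_zero fun y hy =>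
        image_eq_zero_of_notMem_tsupport fun hy' => hy (hη hy')
    have iφ : Integrable φ := h1.continuous.integrable_of_hasCompactSupport h2
    have iψ : Integrable ψ := s1.continuous.integrable_of_hasCompactSupport s2
    set m := ∫ x, φ x with hm
    -- As ψ has integral 1, φ - mψ has mean zero and is the derivative of a test function. Testing f
    -- with it gives ∫fφ = m∫fψ = c∫φ.
    have ht : tsupport (fun x => φ x - m * ψ x) ⊆ Ioo a b := by
      refine (tsupport_sub φ (fun x => m * ψ x)).trans (union_subset h3 ?_)
      exact (closure_mono (fun x hx => right_ne_zero_of_mul hx)).trans s3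
    obtain ⟨θ, t1, t2, t3, t4⟩ := exists_test_primitive (a := a) (b := b)
      (η := fun x => φ x - m * ψ x) (h1.sub (contDiff_const.mul s1))
      (h2.sub (s2.mul_left)) ht (by
        rw [integral_sub iφ (iψ.const_mul m), integral_const_mul, s4, mul_one, sub_self])
    have e := h.eq θ t1 t2 t3
    rw [t4] at e
    have i1 := integrable_mul_test h.left h1.continuous h2 h3
    have i2 := integrable_mul_test h.left s1.continuous s2 s3
    simp only [Pi.zero_apply, zero_mul, integral_zero, neg_zero] at e
    have e1 : ∀ x, f x * (φ x - m * ψ x) = f x * φ x - m * (f x * ψ x) := fun x => by ring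
    simp only [e1] at e
    rw [integral_sub i1 (i2.const_mul m), integral_const_mul, ← hc] at e
    have e2 : ∀ x, φ x • (f - fun _ => c : ℝ → ℝ) x = f x * φ x - c * φ x := fun x => by
      simp only [Pi.sub_apply, smul_eq_mul]; ring
    simp only [e2]
    rw [integral_sub i1 (iφ.restrict.const_mul c), integral_const_mul, hint φ h3, ← hm]
    linarith

/-- f minus a primitive of g has weak derivative zero, hence is a constant, which is added to the
primitive. -/
theorem HasWeakDeriv.exists_isPrimitive (hab : a < b) (h : HasWeakDeriv a b f g)
    (hg : IntegrableOn g (Ioo a b)) :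
    ∃ u, f =ᵐ[volume.restrict (Ioo a b)] u ∧ IsPrimitive a b u g := by
  have hgi : IntervalIntegrable g volume a b :=
    (intervalIntegrable_iff_integrableOn_Ioo_of_le hab.le).2 hg
  have h1 := (isPrimitive_integral hgi 0).hasWeakDeriv hab.le
  have h2 := h.add (h1.smul (-1))
  have e : g + (-1 : ℝ) • g = 0 := by
    funext x; simp
  rw [e] at h2
  obtain ⟨c, hc⟩ := h2.ae_eq_const hab
  refine ⟨fun x => c + ∫ y in a..x, g y, ?_, isPrimitive_integral hgi c⟩
  filter_upwards [hc] with x hx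
  simp only [Pi.add_apply, Pi.smul_apply, smul_eq_mul, zero_add] at hx
  linarith

/-- A Sobolev function and its weak derivatives have absolutely continuous representatives. -/
theorem MemSobolev.exists_chain (hab : a < b) {p : ℝ≥0∞} (hp : 1 ≤ p) {k : ℕ}
    (h : MemSobolev a b p k f) :
    ∃ u : ℕ → ℝ → ℝ, (∀ i ≤ k, DelayedBoussinesq.iterWeakDeriv a b i f =ᵐ[volume.restrict (Ioo a b)] u i) ∧
      (∀ i < k, IsPrimitive a b (u i) (u (i + 1))) ∧
      MemLp (u k) p (volume.restrict (Ioo a b)) := by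
  induction k generalizing f with
  | zero => exact ⟨fun _ => f, fun i hi => by obtain rfl : i = 0 := by omega
                                              exact EventuallyEq.rfl, by simp, h⟩
  | succ k ih =>
    obtain ⟨u, h1, h2, h3⟩ := ih h.weakDeriv
    obtain ⟨w, hw, hw'⟩ := h.hasWeakDeriv.exists_isPrimitive hab
      (h.weakDeriv.memLp.integrable hp)
    refine ⟨fun i => Nat.casesOn i w u, ?_, ?_, h3⟩
    · rintro (_ | i) hi
      · exact hw
      · exact h1 i (by omega)
    · rintro (_ | i) hi
      · exact hw'.congr_right hab.le (h1 0 (by omega))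
      · exact h2 i (by omega)

theorem memLp_of_continuousOn {p : ℝ≥0∞} (h : ContinuousOn f (Icc a b)) :
    MemLp f p (volume.restrict (Ioo a b)) := by
  obtain ⟨C, hC⟩ := isCompact_Icc.exists_bound_of_continuousOn h
  refine MemLp.of_bound ((h.mono Ioo_subset_Icc_self).aestronglyMeasurable measurableSet_Ioo) C ?_
  filter_upwards [ae_restrict_mem measurableSet_Ioo] with x hx
  exact hC x (Ioo_subset_Icc_self hx)

/-- Converse of `MemSobolev.exists_chain`; it places the solutions of the resolvent equation,
obtained as iterated primitives, in the domain. -/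
theorem memSobolev_of_chain (hab : a ≤ b) {p : ℝ≥0∞} {k : ℕ} {u : ℕ → ℝ → ℝ}
    (h : ∀ i < k, IsPrimitive a b (u i) (u (i + 1)))
    (hk : MemLp (u k) p (volume.restrict (Ioo a b))) :
    MemSobolev a b p k (u 0) ∧
      ∀ i ≤ k, iterWeakDeriv a b i (u 0) =ᵐ[volume.restrict (Ioo a b)] u i := by
  induction k generalizing u with
  | zero => exact ⟨hk, fun i hi => by obtain rfl : i = 0 := by omega
                                      exact EventuallyEq.rfl⟩
  | succ k ih =>
    obtain ⟨h1, h2⟩ := ih (u := fun i => u (i + 1)) (fun i hi => h (i + 1) (by omega)) hk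
    have h3 := (h 0 (by omega)).hasWeakDeriv hab
    refine ⟨⟨memLp_of_continuousOn ((h 0 (by omega)).continuousOn hab), _, h3, h1⟩, ?_⟩
    rintro (_ | i) hi
    · exact EventuallyEq.rfl
    · exact (iterWeakDeriv_congr (weakDeriv_ae_eq h3)).trans (h2 i (by omega))

theorem eqOn_Icc_of_ae_eq_Ioo (hab : a < b) (h : u =ᵐ[volume.restrict (Ioo a b)] v)
    (hu : ContinuousOn u (Icc a b)) (hv : ContinuousOn v (Icc a b)) : EqOn u v (Icc a b) := by
  rw [Measure.restrict_congr_set Ioo_ae_eq_Icc] at h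
  exact Measure.eqOn_Icc_of_ae_eq volume hab.ne h hu hv

theorem HasTrace.eq_of_continuousOn (hab : a < b) {x r : ℝ} (h : HasTrace a b f x r)
    (hfu : f =ᵐ[volume.restrict (Ioo a b)] u) (hu : ContinuousOn u (Icc a b)) : u x = r := by
  obtain ⟨hx, w, hw, hfw, rfl⟩ := h
  exact eqOn_Icc_of_ae_eq_Ioo hab (hfu.symm.trans hfw) hu hw hx

theorem hasTrace_of_continuousOn {x : ℝ} (hx : x ∈ Icc a b)
    (hfu : f =ᵐ[volume.restrict (Ioo a b)] u) (hu : ContinuousOn u (Icc a b)) :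
    HasTrace a b f x (u x) :=
  ⟨hx, u, hu, hfu, rfl⟩

end Sobolev

/-! ### Regularity of the delay -/

section Delay

variable {M d : ℝ} {τ : ℝ → ℝ}

/-- A delay function is `C¹` with Lipschitz continuous derivative on bounded intervals. -/
theorem IsDelay.exists_lipschitz (h : IsDelay M d τ) {T : ℝ} (hT : 0 < T) :
    ∃ K, 0 ≤ K ∧ (∀ s ∈ Icc 0 T, ∀ t ∈ Icc 0 T, ‖τ s - τ t‖ ≤ K * |s - t|) ∧
      (∀ s ∈ Icc 0 T, ∀ t ∈ Icc 0 T,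
        ‖derivWithin τ (Ici 0) s - derivWithin τ (Ici 0) t‖ ≤ K * |s - t|) := by
  -- Working on [0, T+1] puts T in the interior, so the derivative within [0, ∞) can be computed
  -- there too.
  have hS : 0 < T + 1 := by linarith
  obtain ⟨u, hu, hp, hb⟩ := (h.sobolev (T + 1) hS).exists_chain hS le_top
  have h01 := hp 0 (by norm_num)
  have h12 := hp 1 (by norm_num)
  have c0 := h01.continuousOn hS.le
  have c1 := h12.continuousOn hS.le
  have e0 : EqOn τ (u 0) (Icc 0 (T + 1)) := eqOn_Icc_of_ae_eq_Ioo hS (hu 0 (by norm_num))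
    (h.continuousOn.mono fun x hx => hx.1) c0
  set w : ℝ → ℝ := IccExtend hS.le ((Icc 0 (T + 1)).domRestrict (u 1)) with hw
  have hwc : Continuous w := (continuousOn_iff_continuous_domRestrict.1 c1).Icc_extend'
  have hwu : ∀ t ∈ Icc 0 (T + 1), w t = u 1 t := fun t ht => by
    rw [hw, IccExtend_of_mem hS.le _ ht]; rfl
  have e1 : ∀ t ∈ Icc 0 (T + 1), τ t = u 0 0 + ∫ s in (0 : ℝ)..t, w s := by
    intro t ht
    rw [e0 ht, h01.eq t ht]
    congr 1
    refine intervalIntegral.integral_congr fun s hs => ?_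
    rw [uIcc_of_le ht.1] at hs
    exact (hwu s ⟨hs.1, hs.2.trans ht.2⟩).symm
  have hd : ∀ t ∈ Icc 0 T, HasDerivWithinAt τ (u 1 t) (Ici 0) t := by
    intro t ht
    have ht' : t ∈ Icc 0 (T + 1) := ⟨ht.1, by linarith [ht.2]⟩
    rw [← hwu t ht']
    have : HasDerivAt (fun t => u 0 0 + ∫ s in (0 : ℝ)..t, w s) (w t) t :=
      (intervalIntegral.integral_hasDerivAt_right (hwc.intervalIntegrable _ _)
        (hwc.stronglyMeasurableAtFilter _ _) hwc.continuousAt).const_add _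
    refine this.hasDerivWithinAt.congr_of_eventuallyEq ?_ (e1 t ht')
    have hmem : Icc 0 (T + 1) ∈ 𝓝[Ici 0] t := by
      rw [← Ici_inter_Iic]
      exact inter_mem self_mem_nhdsWithin (mem_nhdsWithin_of_mem_nhds
        (Iic_mem_nhds (by linarith [ht.2])))
    filter_upwards [hmem] with s hs using e1 s hs
  obtain ⟨K₁, hK₁⟩ := isCompact_Icc.exists_bound_of_continuousOn c1
  have hK₁0 : 0 ≤ K₁ := (norm_nonneg _).trans (hK₁ 0 ⟨le_rfl, hS.le⟩)
  obtain ⟨K₂, hK₂⟩ : ∃ K₂, ∀ᵐ x ∂volume.restrict (Ioo 0 (T + 1)), ‖u 2 x‖ ≤ K₂ := by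
    have h1 : eLpNormEssSup (u 2) (volume.restrict (Ioo 0 (T + 1))) < ⊤ := by
      simpa using hb.eLpNorm_lt_top
    refine ⟨(eLpNormEssSup (u 2) (volume.restrict (Ioo 0 (T + 1)))).toReal, ?_⟩
    filter_upwards [ae_le_eLpNormEssSup (f := u 2) (μ := volume.restrict (Ioo 0 (T + 1)))]
      with x hx
    rw [← toReal_enorm]
    exact ENNReal.toReal_mono h1.ne hx
  rw [ae_restrict_Ioo_iff_uIoc hS.le] at hK₂
  -- K₁ bounds τ' and K₂ bounds τ'' almost everywhere; one constant serves both Lipschitz estimates.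
  refine ⟨K₁ + |K₂|, by positivity, fun s hs t ht => ?_, fun s hs t ht => ?_⟩
  · have := Convex.norm_image_sub_le_of_norm_hasDerivWithin_le (C := K₁)
      (fun x hx => (hd x hx).mono fun y hy => hy.1)
      (fun x hx => hK₁ x ⟨hx.1, by linarith [hx.2]⟩) (convex_Icc 0 T) ht hs
    refine this.trans ?_
    rw [Real.norm_eq_abs]
    gcongr
    linarith [abs_nonneg K₂]
  · rw [(hd s hs).derivWithin (uniqueDiffOn_Ici 0 s hs.1),
      (hd t ht).derivWithin (uniqueDiffOn_Ici 0 t ht.1)]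
    have hs' : s ∈ Icc 0 (T + 1) := ⟨hs.1, by linarith [hs.2]⟩
    have ht' : t ∈ Icc 0 (T + 1) := ⟨ht.1, by linarith [ht.2]⟩
    have hi : ∀ r ∈ Icc 0 (T + 1), IntervalIntegrable (u 2) volume 0 r := fun r hr =>
      h12.integrable.mono_set (by
        rw [uIcc_of_le hr.1, uIcc_of_le hS.le]; exact Icc_subset_Icc_right hr.2)
    rw [h12.eq s hs', h12.eq t ht', add_sub_add_left_eq_sub,
      intervalIntegral.integral_interval_sub_left (hi s hs') (hi t ht')]
    refine (intervalIntegral.norm_integral_le_of_norm_le_const_ae (C := |K₂|) ?_).trans ?_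
    · filter_upwards [hK₂] with x hx hx'
      refine (hx ?_).trans (le_abs_self _)
      have hsub : Icc (min t s) (max t s) ⊆ Icc 0 (T + 1) :=
        Icc_subset_Icc (le_min ht'.1 hs'.1) (max_le ht'.2 hs'.2)
      rw [uIoc_of_le hS.le]
      rw [uIoc, mem_Ioc] at hx'
      exact ⟨(le_min ht'.1 hs'.1).trans_lt hx'.1, hx'.2.trans (max_le ht'.2 hs'.2)⟩
    · gcongr
      linarith

end Delay

/-! ### Boundary terms and dissipativity -/

namespace IsPrimitive

variable {a b : ℝ} {u v u' v' : ℝ → ℝ}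

theorem mono (h : IsPrimitive a b u u') (hab : a ≤ b) {x : ℝ} (hx : x ∈ Icc a b) :
    IsPrimitive a x u u' :=
  ⟨h.integrable.mono_set (by
    rw [uIcc_of_le hx.1, uIcc_of_le hab]; exact Icc_subset_Icc_right hx.2),
    fun y hy => h.eq y ⟨hy.1, hy.2.trans hx.2⟩⟩

theorem add (h : IsPrimitive a b u u') (k : IsPrimitive a b v v') (hab : a ≤ b) :
    IsPrimitive a b (fun x => u x + v x) (fun x => u' x + v' x) :=
  ⟨h.integrable.add k.integrable, fun x hx => by
    rw [intervalIntegral.integral_add (h.mono hab hx).integrable (k.mono hab hx).integrable,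
      h.eq x hx, k.eq x hx]
    ring⟩

theorem mul (h : IsPrimitive a b u u') (k : IsPrimitive a b v v') (hab : a ≤ b) :
    IsPrimitive a b (fun x => u x * v x) (fun x => u' x * v x + u x * v' x) := by
  have i1 : ∀ x ∈ Icc a b, IntervalIntegrable (fun x => u' x * v x) volume a x := fun x hx =>
    (h.mono hab hx).integrable.mul_continuousOn (by
      rw [uIcc_of_le hx.1]; exact (k.mono hab hx).continuousOn hx.1)
  have i2 : ∀ x ∈ Icc a b, IntervalIntegrable (fun x => u x * v' x) volume a x := fun x hx =>
    (k.mono hab hx).integrable.continuousOn_mul (by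
      rw [uIcc_of_le hx.1]; exact (h.mono hab hx).continuousOn hx.1)
  refine ⟨(i1 b ⟨hab, le_rfl⟩).add (i2 b ⟨hab, le_rfl⟩), fun x hx => ?_⟩
  rw [intervalIntegral.integral_add (i1 x hx) (i2 x hx),
    (h.mono hab hx).integral_add_eq (k.mono hab hx) hx.1]
  ring

theorem congr_right_of_eq (h : IsPrimitive a b u u') (e : ∀ x, u' x = v' x) :
    IsPrimitive a b u v' := by
  rwa [funext e] at h

end IsPrimitive

theorem integral_neg_sub_sub {f g k : ℝ → ℝ} {L a a₁ : ℝ} (hf : IntervalIntegrable f volume 0 L)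
    (hg : IntervalIntegrable g volume 0 L) (hk : IntervalIntegrable k volume 0 L) :
    ∫ x in (0 : ℝ)..L, (-f x - a * g x - a₁ * k x) = -(∫ x in (0 : ℝ)..L, f x) -
      a * (∫ x in (0 : ℝ)..L, g x) - a₁ * ∫ x in (0 : ℝ)..L, k x := by
  have hn : IntervalIntegrable (fun x => -f x) volume 0 L := hf.neg
  rw [intervalIntegral.integral_sub (hn.sub (hg.const_mul a)) (hk.const_mul a₁),
    intervalIntegral.integral_sub hn (hg.const_mul a), intervalIntegral.integral_neg,
    intervalIntegral.integral_const_mul, intervalIntegral.integral_const_mul]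

/-- Regular representatives `u i`, `v i`, `y i` of the derivatives of an element `(u 0, v 0, y 0)`
of the domain of the operators, together with the boundary conditions. -/
structure IsRegular (L α β : ℝ) (u v y : ℕ → ℝ → ℝ) : Prop where
  prim_u : ∀ i < 5, IsPrimitive 0 L (u i) (u (i + 1))
  prim_v : ∀ i < 5, IsPrimitive 0 L (v i) (v (i + 1))
  prim_y : IsPrimitive 0 1 (y 0) (y 1)
  memLp_u : MemLp (u 5) 2 (volume.restrict (Ioo 0 L))
  memLp_v : MemLp (v 5) 2 (volume.restrict (Ioo 0 L))
  memLp_y : MemLp (y 1) 2 (volume.restrict (Ioo 0 1))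
  u_zero : u 0 0 = 0
  u_L : u 0 L = 0
  u_x_zero : u 1 0 = 0
  u_x_L : u 1 L = 0
  v_zero : v 0 0 = 0
  v_L : v 0 L = 0
  v_x_zero : v 1 0 = 0
  v_x_L : v 1 L = 0
  u_xx_zero : u 2 0 = 0
  y_zero : y 0 0 = u 2 L
  feedback : v 2 L = α * u 2 L + β * y 0 1

variable {L α β : ℝ}

/-- Traces are values of continuous representatives, which are unique on the closed interval, so the
boundary conditions become pointwise equations for the chains of primitives. -/
theorem InDomain.exists_isRegular (hL : 0 < L) {η ω z : ℝ → ℝ} (h : InDomain L α β η ω z) :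
    ∃ u v y : ℕ → ℝ → ℝ, IsRegular L α β u v y ∧
      (∀ i ≤ 5, iterWeakDeriv 0 L i η =ᵐ[volume.restrict (Ioo 0 L)] u i) ∧
      (∀ i ≤ 5, iterWeakDeriv 0 L i ω =ᵐ[volume.restrict (Ioo 0 L)] v i) ∧
      (∀ i ≤ 1, iterWeakDeriv 0 1 i z =ᵐ[volume.restrict (Ioo 0 1)] y i) := by
  obtain ⟨u, u1, u2, u3⟩ := h.eta_sobolev.exists_chain hL one_le_two
  obtain ⟨v, v1, v2, v3⟩ := h.omega_sobolev.exists_chain hL one_le_two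
  obtain ⟨y, y1, y2, y3⟩ := h.z_sobolev.exists_chain zero_lt_one one_le_two
  obtain ⟨r, s, k1, k2, k3, k4⟩ := h.feedback
  have cu : ∀ i < 5, ContinuousOn (u i) (Icc 0 L) := fun i hi => (u2 i hi).continuousOn hL.le
  have cv : ∀ i < 5, ContinuousOn (v i) (Icc 0 L) := fun i hi => (v2 i hi).continuousOn hL.le
  have cy := (y2 0 (by norm_num)).continuousOn zero_le_one
  have tu : ∀ i < 5, ∀ x c, HasTrace 0 L (iterWeakDeriv 0 L i η) x c → u i x = c :=
    fun i hi x c ht => ht.eq_of_continuousOn hL (u1 i (by omega)) (cu i hi)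
  have tv : ∀ i < 5, ∀ x c, HasTrace 0 L (iterWeakDeriv 0 L i ω) x c → v i x = c :=
    fun i hi x c ht => ht.eq_of_continuousOn hL (v1 i (by omega)) (cv i hi)
  have ty : ∀ x c, HasTrace 0 1 z x c → y 0 x = c :=
    fun x c ht => ht.eq_of_continuousOn zero_lt_one (y1 0 (by omega)) cy
  have e1 := tu 2 (by norm_num) _ _ k1
  refine ⟨u, v, y, ⟨u2, v2, y2 0 (by norm_num), u3, v3, y3, tu 0 (by norm_num) _ _ h.eta_zero,
    tu 0 (by norm_num) _ _ h.eta_L, tu 1 (by norm_num) _ _ h.eta_x_zero,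
    tu 1 (by norm_num) _ _ h.eta_x_L, tv 0 (by norm_num) _ _ h.omega_zero,
    tv 0 (by norm_num) _ _ h.omega_L, tv 1 (by norm_num) _ _ h.omega_x_zero,
    tv 1 (by norm_num) _ _ h.omega_x_L, tu 2 (by norm_num) _ _ h.eta_xx_zero,
    (ty _ _ k2).trans e1.symm, ?_⟩, u1, v1, y1⟩
  rw [e1, ty _ _ k3]
  exact tv 2 (by norm_num) _ _ k4

namespace IsRegular

variable {u v y : ℕ → ℝ → ℝ}

theorem ae_eq (h : IsRegular L α β u v y) (hL : 0 < L) :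
    (∀ i ≤ 5, iterWeakDeriv 0 L i (u 0) =ᵐ[volume.restrict (Ioo 0 L)] u i) ∧
    (∀ i ≤ 5, iterWeakDeriv 0 L i (v 0) =ᵐ[volume.restrict (Ioo 0 L)] v i) ∧
    (∀ i ≤ 1, iterWeakDeriv 0 1 i (y 0) =ᵐ[volume.restrict (Ioo 0 1)] y i) :=
  ⟨(memSobolev_of_chain hL.le h.prim_u h.memLp_u).2, (memSobolev_of_chain hL.le h.prim_v h.memLp_v).2,
    (memSobolev_of_chain (k := 1) zero_le_one (by simpa using h.prim_y) h.memLp_y).2⟩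

theorem inDomain (h : IsRegular L α β u v y) (hL : 0 < L) :
    InDomain L α β (u 0) (v 0) (y 0) := by
  obtain ⟨u1, v1, y1⟩ := h.ae_eq hL
  have m0 : (0 : ℝ) ∈ Icc 0 L := ⟨le_rfl, hL.le⟩
  have mL : L ∈ Icc 0 L := ⟨hL.le, le_rfl⟩
  have tu : ∀ i < 5, ∀ x ∈ Icc 0 L, ∀ c, u i x = c →
      HasTrace 0 L (iterWeakDeriv 0 L i (u 0)) x c :=
    fun i hi x hx c hc => hc ▸ hasTrace_of_continuousOn hx (u1 i (by omega))
      ((h.prim_u i hi).continuousOn hL.le)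
  have tv : ∀ i < 5, ∀ x ∈ Icc 0 L, ∀ c, v i x = c →
      HasTrace 0 L (iterWeakDeriv 0 L i (v 0)) x c :=
    fun i hi x hx c hc => hc ▸ hasTrace_of_continuousOn hx (v1 i (by omega))
      ((h.prim_v i hi).continuousOn hL.le)
  have ty : ∀ x ∈ Icc 0 1, ∀ c, y 0 x = c → HasTrace 0 1 (y 0) x c := fun x hx c hc =>
    hc ▸ hasTrace_of_continuousOn hx (y1 0 (by omega)) (h.prim_y.continuousOn zero_le_one)
  exact
    { eta_sobolev := (memSobolev_of_chain hL.le h.prim_u h.memLp_u).1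
      omega_sobolev := (memSobolev_of_chain hL.le h.prim_v h.memLp_v).1
      z_sobolev := (memSobolev_of_chain (k := 1) zero_le_one (by simpa using h.prim_y) h.memLp_y).1
      eta_zero := tu 0 (by norm_num) 0 m0 _ h.u_zero
      eta_L := tu 0 (by norm_num) L mL _ h.u_L
      eta_x_zero := tu 1 (by norm_num) 0 m0 _ h.u_x_zero
      eta_x_L := tu 1 (by norm_num) L mL _ h.u_x_L
      omega_zero := tv 0 (by norm_num) 0 m0 _ h.v_zero
      omega_L := tv 0 (by norm_num) L mL _ h.v_L
      omega_x_zero := tv 1 (by norm_num) 0 m0 _ h.v_x_zero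
      omega_x_L := tv 1 (by norm_num) L mL _ h.v_x_L
      eta_xx_zero := tu 2 (by norm_num) 0 m0 _ h.u_xx_zero
      feedback := ⟨u 2 L, y 0 1, tu 2 (by norm_num) L mL _ rfl, ty 0 (by simp) _ h.y_zero,
        ty 1 (by simp) _ rfl, tv 2 (by norm_num) L mL _ h.feedback⟩ }

/-- Dissipation identity for the dispersive part. -/
theorem integral_dispersion (h : IsRegular L α β u v y) (hL : 0 < L) (a a₁ : ℝ) :
    (∫ x in (0 : ℝ)..L, (-v 1 x - a * v 3 x - a₁ * v 5 x) * u 0 x) +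
      (∫ x in (0 : ℝ)..L, (-u 1 x - a * u 3 x - a₁ * u 5 x) * v 0 x) =
      -a₁ * (u 2 L * v 2 L) := by
  have ibp : ∀ i < 5, ∀ j < 5, (∫ x in (0 : ℝ)..L, u (i + 1) x * v j x) +
      ∫ x in (0 : ℝ)..L, u i x * v (j + 1) x = u i L * v j L - u i 0 * v j 0 :=
    fun i hi j hj => (h.prim_u i hi).integral_add_eq (h.prim_v j hj) hL.le
  have iu : ∀ i ≤ 4, IntervalIntegrable (fun x => u (i + 1) x * v 0 x) volume 0 L := fun i hi =>
    (h.prim_u i (by omega)).integrable.mul_continuousOn (by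
      rw [uIcc_of_le hL.le]; exact (h.prim_v 0 (by norm_num)).continuousOn hL.le)
  have iv : ∀ i ≤ 4, IntervalIntegrable (fun x => u 0 x * v (i + 1) x) volume 0 L := fun i hi =>
    (h.prim_v i (by omega)).integrable.continuousOn_mul (by
      rw [uIcc_of_le hL.le]; exact (h.prim_u 0 (by norm_num)).continuousOn hL.le)
  have e1 : ∫ x in (0 : ℝ)..L, (-u 1 x - a * u 3 x - a₁ * u 5 x) * v 0 x =
      -(∫ x in (0 : ℝ)..L, u 1 x * v 0 x) - a * (∫ x in (0 : ℝ)..L, u 3 x * v 0 x) -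
        a₁ * ∫ x in (0 : ℝ)..L, u 5 x * v 0 x := by
    rw [← integral_neg_sub_sub (iu 0 (by norm_num)) (iu 2 (by norm_num)) (iu 4 (by norm_num))]
    congr 1
    funext x
    simp only [zero_add, Nat.reduceAdd]
    ring
  have e2 : ∫ x in (0 : ℝ)..L, (-v 1 x - a * v 3 x - a₁ * v 5 x) * u 0 x =
      -(∫ x in (0 : ℝ)..L, u 0 x * v 1 x) - a * (∫ x in (0 : ℝ)..L, u 0 x * v 3 x) -
        a₁ * ∫ x in (0 : ℝ)..L, u 0 x * v 5 x := by
    rw [← integral_neg_sub_sub (iv 0 (by norm_num)) (iv 2 (by norm_num)) (iv 4 (by norm_num))]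
    congr 1
    funext x
    simp only [zero_add, Nat.reduceAdd]
    ring
  -- In the alternating sums the mixed integrals telescope. The boundary conditions kill all
  -- boundary terms except the product of the second derivatives at L in `b22`; its counterpart at 0
  -- vanishes because η_xx(0) = 0.
  have b00 := ibp 0 (by norm_num) 0 (by norm_num)
  have b20 := ibp 2 (by norm_num) 0 (by norm_num)
  have b11 := ibp 1 (by norm_num) 1 (by norm_num)
  have b02 := ibp 0 (by norm_num) 2 (by norm_num)
  have b40 := ibp 4 (by norm_num) 0 (by norm_num)
  have b31 := ibp 3 (by norm_num) 1 (by norm_num)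
  have b22 := ibp 2 (by norm_num) 2 (by norm_num)
  have b13 := ibp 1 (by norm_num) 3 (by norm_num)
  have b04 := ibp 0 (by norm_num) 4 (by norm_num)
  simp only [h.u_zero, h.u_L, h.u_x_zero, h.u_x_L, h.v_zero, h.v_L, h.v_x_zero, h.v_x_L,
    h.u_xx_zero, zero_mul, mul_zero, sub_zero] at b00 b20 b11 b02 b40 b31 b22 b13 b04
  rw [e1, e2]
  linear_combination (-1 : ℝ) * b00 - a * (b20 - b11 + b02) - a₁ * (b40 - b31 + b22 - b13 + b04)

/-- The transport speed a₁α is chosen so that its boundary terms combine with those of the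
dispersive part. With r = η_xx(L) and s = z(1) the sum is -a₁r(αr + βs) - a₁α(s² - r²)/2 =
-(a₁/2)(αr² + 2βrs + αs²), nonpositive for |β| ≤ α. -/
theorem dissipative (h : IsRegular L α β u v y) (hL : 0 < L) (a : ℝ) {a₁ : ℝ} (ha₁ : 0 < a₁)
    (hαβ : |β| ≤ α) :
    (∫ x in (0 : ℝ)..L, (-v 1 x - a * v 3 x - a₁ * v 5 x) * u 0 x) +
      (∫ x in (0 : ℝ)..L, (-u 1 x - a * u 3 x - a₁ * u 5 x) * v 0 x) +
      (∫ x in (0 : ℝ)..1, (-(a₁ * α) * y 1 x) * y 0 x) ≤ 0 := by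
  rw [h.integral_dispersion hL]
  have e := h.prim_y.integral_add_eq h.prim_y zero_le_one
  have e1 : ∫ x in (0 : ℝ)..1, y 0 x * y 1 x = ∫ x in (0 : ℝ)..1, y 1 x * y 0 x := by
    congr 1; funext x; ring
  have e2 : ∫ x in (0 : ℝ)..1, (-(a₁ * α) * y 1 x) * y 0 x =
      -(a₁ * α) * ∫ x in (0 : ℝ)..1, y 1 x * y 0 x := by
    rw [← intervalIntegral.integral_const_mul]
    congr 1; funext x; ring
  rw [e1, h.y_zero] at e
  rw [e2, h.feedback]
  set r := u 2 L
  set s := y 0 1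
  set I := ∫ x in (0 : ℝ)..1, y 1 x * y 0 x
  have hI : I = (s * s - r * r) / 2 := by linarith
  have key : 0 ≤ α * r ^ 2 + 2 * β * (r * s) + α * s ^ 2 := by
    have h1 : |β * (r * s)| ≤ α * ((r ^ 2 + s ^ 2) / 2) := by
      rw [abs_mul]
      refine mul_le_mul hαβ ?_ (abs_nonneg _) ((abs_nonneg _).trans hαβ)
      rw [abs_le]
      constructor <;> nlinarith [sq_nonneg (r - s), sq_nonneg (r + s)]
    have := (abs_le.1 h1).1
    nlinarith
  rw [hI]
  nlinarith [mul_nonneg ha₁.le key]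

end IsRegular

/-! ### The resolvent equation as a boundary value problem -/

section LinearSystems

variable {n : ℕ}

/-- The source is only integrable. Subtracting its primitive P from the unknown leaves w' = Bw + BP,
whose source is continuous. -/
theorem exists_isPrimitive_linear (B : (Fin n → ℝ) →L[ℝ] (Fin n → ℝ)) {G : Fin n → ℝ → ℝ}
    (hG : ∀ i, Integrable (G i)) {L : ℝ} (hL : 0 ≤ L) :
    ∃ x : ℝ → Fin n → ℝ, x 0 = 0 ∧
      ∀ i, IsPrimitive 0 L (fun t => x t i) (fun t => B (x t) i + G i t) := by
  let P : ℝ → Fin n → ℝ := fun t i => ∫ s in (0 : ℝ)..t, G i s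
  have hP : Continuous P := continuous_pi fun i =>
    intervalIntegral.continuous_primitive (fun a b => (hG i).intervalIntegrable) 0
  obtain ⟨w, hw, hw0, hwd⟩ := exists_hasDerivAt_linear hL (F := fun _ => B) continuous_const
    (B.continuous.comp hP) 0
  refine ⟨fun t => w t + P t, ?_, fun i => ?_⟩
  · funext i
    simp [hw0, P]
  have h1 : IsPrimitive 0 L (fun t => w t i) (fun t => (B (w t) + B (P t)) i) := by
    refine .of_hasDerivAt hL (fun t ht => ?_) ?_
    · exact (hasDerivAt_pi.1 (hwd t ht)) i
    · exact ((continuous_apply i).comp ((B.continuous.comp hw).add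
        (B.continuous.comp hP))).continuousOn
  have h2 : IsPrimitive 0 L (fun t => P t i) (G i) := by
    have := isPrimitive_integral (hG i).intervalIntegrable (a := 0) (b := L) 0
    simpa [P] using this
  refine (h1.add h2 hL).congr_right_of_eq fun t => ?_
  simp [map_add]

theorem hasDerivAt_exp_clm {E : Type*} [NormedAddCommGroup E] [NormedSpace ℝ E] [CompleteSpace E]
    (B : E →L[ℝ] E) (x : E) (t : ℝ) :
    HasDerivAt (fun t : ℝ => NormedSpace.exp (t • B) x) (B (NormedSpace.exp (t • B) x)) t := by
  have h := hasDerivAt_exp_smul_const' (𝕂 := ℝ) B t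
  have h2 := h.clm_apply (hasDerivAt_const t x)
  simpa using h2

end LinearSystems

/-- The first-order system for the derivatives of `η` and `ω` in the resolvent equation. -/
noncomputable def resolventSystem (a a₁ h : ℝ) : (Fin 10 → ℝ) →L[ℝ] (Fin 10 → ℝ) :=
  LinearMap.toContinuousLinearMap
    -- Entries 0 to 4 are η and its derivatives, entries 5 to 9 those of ω. Row 4 is the second
    -- resolvent equation solved for the fifth derivative of η, row 9 the first one solved for that
    -- of ω, both without data.
    { toFun := fun x => ![x 1, x 2, x 3, x 4, -(x 5 + h * x 1 + h * a * x 3) / (h * a₁),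
        x 6, x 7, x 8, x 9, -(x 0 + h * x 6 + h * a * x 8) / (h * a₁)]
      map_add' := fun x y => by
        ext i
        fin_cases i <;> simp <;> ring
      map_smul' := fun c x => by
        ext i
        fin_cases i <;> simp <;> ring }

theorem resolventSystem_apply (a a₁ h : ℝ) (x : Fin 10 → ℝ) : resolventSystem a a₁ h x =
    ![x 1, x 2, x 3, x 4, -(x 5 + h * x 1 + h * a * x 3) / (h * a₁),
        x 6, x 7, x 8, x 9, -(x 0 + h * x 6 + h * a * x 8) / (h * a₁)] := rfl

/-- The boundary conditions at `0` and `L` in terms of the vectors of derivatives there. -/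
def boundaryMap (γ : ℝ) : (Fin 10 → ℝ) × (Fin 10 → ℝ) →ₗ[ℝ] (Fin 10 → ℝ) where
  -- The first vector is taken at 0, the second at L. In the last entry z(1) has been eliminated:
  -- its dependence on z(0) = η_xx(L) is absorbed in γ.
  toFun p := ![p.1 0, p.1 1, p.1 2, p.1 5, p.1 6, p.2 0, p.2 1, p.2 5, p.2 6,
    p.2 7 - γ * p.2 2]
  map_add' p q := by
    ext i
    fin_cases i <;> simp
    ring
  map_smul' c p := by
    ext i
    fin_cases i <;> simp
    ring

theorem boundaryMap_apply (γ : ℝ) (p : (Fin 10 → ℝ) × (Fin 10 → ℝ)) : boundaryMap γ p =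
    ![p.1 0, p.1 1, p.1 2, p.1 5, p.1 6, p.2 0, p.2 1, p.2 5, p.2 6, p.2 7 - γ * p.2 2] := rfl

/-- The solution of `y + k y' = g`, `y 0 = r`. -/
theorem exists_isPrimitive_transport {k : ℝ} {g : ℝ → ℝ} (hg : Integrable g) (r : ℝ) :
    ∃ y : ℝ → ℝ, y 0 = r ∧ IsPrimitive 0 1 y (fun ρ => (g ρ - y ρ) / k) ∧
      y 1 = r * Real.exp (-1 / k) + Real.exp (-1 / k) *
        ∫ σ in (0 : ℝ)..1, Real.exp (σ / k) * g σ / k := by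
  have hE : IsPrimitive 0 1 (fun ρ => Real.exp (-ρ / k))
      (fun ρ => Real.exp (-ρ / k) * (-1 / k)) := by
    refine .of_hasDerivAt zero_le_one (fun ρ _ => ?_) (by fun_prop)
    have := (((hasDerivAt_id ρ).neg).div_const k).exp
    simpa using this
  have hi : IntervalIntegrable (fun σ => Real.exp (σ / k) * g σ / k) volume 0 1 :=
    ((hg.intervalIntegrable (a := 0) (b := 1)).continuousOn_mul (by fun_prop)).div_const k
  have h2 := hE.mul (isPrimitive_integral hi r) zero_le_one
  refine ⟨_, ?_, h2.congr_right_of_eq fun ρ => ?_, ?_⟩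
  · simp
  · have : Real.exp (-ρ / k) * Real.exp (ρ / k) = 1 := by
      rw [← Real.exp_add, neg_div, neg_add_cancel, Real.exp_zero]
    have h3 : Real.exp (-ρ / k) * (Real.exp (ρ / k) * g ρ / k) = g ρ / k := by
      rw [← mul_div_assoc, ← mul_assoc, this, one_mul]
    rw [h3]
    ring
  · ring

variable {L α β : ℝ}

/-- Solutions of the resolvent equation, from solutions of the first-order system that satisfy the
boundary conditions. -/
theorem isRegular_of_system {a a₁ h k r c : ℝ} (hL : 0 < L)
    {f₁ f₂ f₃ : ℝ → ℝ} (hf₁ : MemLp f₁ 2 (volume.restrict (Ioo 0 L)))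
    (hf₂ : MemLp f₂ 2 (volume.restrict (Ioo 0 L))) (hf₃ : MemLp f₃ 2 (volume.restrict (Ioo 0 1)))
    {x : ℝ → Fin 10 → ℝ} {y : ℝ → ℝ}
    (hx : ∀ i, IsPrimitive 0 L (fun t => x t i) (fun t => resolventSystem a a₁ h (x t) i +
      ![0, 0, 0, 0, f₂ t / (h * a₁), 0, 0, 0, 0, f₁ t / (h * a₁)] i))
    (hb : boundaryMap (α + β * r) (x 0, x L) = ![0, 0, 0, 0, 0, 0, 0, 0, 0, β * c])
    (hy0 : y 0 = x L 2) (hy : IsPrimitive 0 1 y (fun ρ => (f₃ ρ - y ρ) / k))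
    (hy1 : y 1 = x L 2 * r + c) :
    IsRegular L α β
      (fun i t => match i with
        | 0 => x t 0
        | 1 => x t 1
        | 2 => x t 2
        | 3 => x t 3
        | 4 => x t 4
        | _ => (f₂ t - x t 5 - h * (x t 1 + a * x t 3)) / (h * a₁))
      (fun i t => match i with
        | 0 => x t 5
        | 1 => x t 6
        | 2 => x t 7
        | 3 => x t 8
        | 4 => x t 9
        | _ => (f₁ t - x t 0 - h * (x t 6 + a * x t 8)) / (h * a₁))
      (fun i ρ => match i with
        | 0 => y ρ
        | _ => (f₃ ρ - y ρ) / k) := by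
  simp only [resolventSystem_apply] at hx
  rw [boundaryMap_apply] at hb
  have hc : ∀ i, MemLp (fun t => x t i) 2 (volume.restrict (Ioo 0 L)) := fun i =>
    memLp_of_continuousOn ((hx i).continuousOn hL.le)
  have b : ∀ i, _ := fun i => congrFun hb i
  have b0 := b 0
  have b1 := b 1
  have b2 := b 2
  have b3 := b 3
  have b4 := b 4
  have b5 := b 5
  have b6 := b 6
  have b7 := b 7
  have b8 := b 8
  have b9 := b 9
  simp at b0 b1 b2 b3 b4 b5 b6 b7 b8 b9
  refine ⟨fun i hi => ?_, fun i hi => ?_, ?_, ?_, ?_, ?_, ?_, ?_, ?_, ?_, ?_, ?_, ?_, ?_, ?_, ?_, ?_⟩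
  · interval_cases i
    · simpa using hx 0
    · simpa using hx 1
    · simpa using hx 2
    · simpa using hx 3
    · refine (hx 4).congr_right_of_eq fun t => ?_
      simp
      ring
  · interval_cases i
    · simpa using hx 5
    · simpa using hx 6
    · simpa using hx 7
    · simpa using hx 8
    · refine (hx 9).congr_right_of_eq fun t => ?_
      simp
      ring
  · exact hy
  · have := ((hf₂.sub (hc 5)).sub (((hc 1).add ((hc 3).const_mul a)).const_mul h)).mul_const
      (h * a₁)⁻¹
    simpa [div_eq_mul_inv] using this
  · have := ((hf₁.sub (hc 0)).sub (((hc 6).add ((hc 8).const_mul a)).const_mul h)).mul_const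
      (h * a₁)⁻¹
    simpa [div_eq_mul_inv] using this
  · have := (hf₃.sub (memLp_of_continuousOn (hy.continuousOn zero_le_one))).mul_const k⁻¹
    simpa [div_eq_mul_inv] using this
  · exact b0
  · exact b5
  · exact b1
  · exact b6
  · exact b3
  · exact b7
  · exact b4
  · exact b8
  · exact b2
  · exact hy0
  -- Since y(1) = r η_xx(L) + c, the last boundary equation ω_xx(L) - (α + βr) η_xx(L) = βc is the
  -- feedback law.
  · simp [hy1]
    linarith


theorem eq_zero_of_integral_sq_nonpos {L : ℝ} (hL : 0 < L) {f : ℝ → ℝ} (hf : Continuous f)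
    (h : ∫ t in (0 : ℝ)..L, f t * f t ≤ 0) : ∀ t ∈ Icc 0 L, f t = 0 := by
  by_contra! hne
  obtain ⟨t, ht, hft⟩ := hne
  exact h.not_gt (intervalIntegral.integral_pos hL (hf.mul hf).continuousOn
    (fun s _ => mul_self_nonneg _) ⟨t, ht, mul_self_pos.2 hft⟩)

theorem eq_zero_of_hasDerivAt {f g : ℝ → ℝ} {L : ℝ} (hf : ∀ t, HasDerivAt f (g t) t)
    (h : ∀ t ∈ Ioo 0 L, f t = 0) : ∀ t ∈ Ioo 0 L, g t = 0 := fun t ht =>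
  (hf t).unique ((hasDerivAt_const t (0 : ℝ)).congr_of_eventuallyEq
    (eventually_of_mem (isOpen_Ioo.mem_nhds ht) h))

/-- The homogeneous boundary value problem has only the trivial solution. -/
theorem eq_zero_of_boundaryMap_eq_zero {a a₁ h : ℝ} (hL : 0 < L) (ha₁ : 0 < a₁) (hα : 0 < α)
    (hαβ : |β| ≤ α) (hh : 0 < h) {x₀ : Fin 10 → ℝ}
    (hb : boundaryMap (α + β * Real.exp (-1 / (h * (a₁ * α))))
      (x₀, NormedSpace.exp (L • resolventSystem a a₁ h) x₀) = 0) : x₀ = 0 := by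
  set B := resolventSystem a a₁ h with hB
  set x : ℝ → Fin 10 → ℝ := fun t => NormedSpace.exp (t • B) x₀ with hx
  have hx0 : x 0 = x₀ := by simp [hx]
  have hd : ∀ t, HasDerivAt x (B (x t)) t := fun t => hasDerivAt_exp_clm B x₀ t
  have hdi : ∀ i t, HasDerivAt (fun t => x t i) (B (x t) i) t := fun i t =>
    hasDerivAt_pi.1 (hd t) i
  have hxc : Continuous x := continuous_iff_continuousAt.2 fun t => (hd t).continuousAt
  have hxi : ∀ i, Continuous fun t => x t i := fun i => (continuous_apply i).comp hxc
  have hprim : ∀ i, IsPrimitive 0 L (fun t => x t i) (fun t => B (x t) i) := fun i =>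
    .of_hasDerivAt hL.le (fun t _ => hdi i t)
      ((continuous_apply i).comp (B.continuous.comp hxc)).continuousOn
  -- Completing x by the matching z-component gives an element U of the domain with hAU = U.
  -- Dissipativity then yields ‖U‖²/h = ⟨AU, U⟩ ≤ 0.
  obtain ⟨y, hy0, hy, hy1⟩ := exists_isPrimitive_transport (k := h * (a₁ * α))
    (integrable_zero ℝ ℝ volume) (x L 2)
  have hreg := isRegular_of_system (α := α) (β := β) (f₁ := 0) (f₂ := 0) (f₃ := 0) (x := x)
    (a := a) (a₁ := a₁) (h := h) (k := h * (a₁ * α)) (r := Real.exp (-1 / (h * (a₁ * α)))) (c := 0)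
    (y := y) hL
    MemLp.zero MemLp.zero MemLp.zero (fun i => (hprim i).congr_right_of_eq fun t => ?_)
    ?_ hy0 hy (by simp [hy1])
  rotate_left
  · fin_cases i <;> simp [hB]
  · rw [hx0, hb]
    ext i
    fin_cases i <;> simp
  have hdis := hreg.dissipative hL a ha₁ hαβ
  have e1 : ∀ f : ℝ → ℝ, ∀ c : ℝ, ∫ t in (0 : ℝ)..c, f t * f t / h =
      (∫ t in (0 : ℝ)..c, f t * f t) / h := fun f c => intervalIntegral.integral_div _ _
  have hdis' : (∫ t in (0 : ℝ)..L, x t 0 * x t 0 / h) + (∫ t in (0 : ℝ)..L, x t 5 * x t 5 / h) +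
      (∫ t in (0 : ℝ)..1, y t * y t / h) ≤ 0 := by
    refine le_of_eq_of_le ?_ hdis
    congr 1
    · congr 1
      · congr 1
        funext t
        simp
        field_simp
        ring
      · congr 1
        funext t
        simp
        field_simp
        ring
    · congr 1
      funext t
      simp
      field_simp
  rw [e1 (fun t => x t 0), e1 (fun t => x t 5), e1, ← add_div, ← add_div,
    div_le_iff₀ hh, zero_mul] at hdis'
  have n0 : 0 ≤ ∫ t in (0 : ℝ)..L, x t 0 * x t 0 :=
    intervalIntegral.integral_nonneg hL.le fun t _ => mul_self_nonneg _
  have n5 : 0 ≤ ∫ t in (0 : ℝ)..L, x t 5 * x t 5 :=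
    intervalIntegral.integral_nonneg hL.le fun t _ => mul_self_nonneg _
  have ny : 0 ≤ ∫ t in (0 : ℝ)..1, y t * y t :=
    intervalIntegral.integral_nonneg zero_le_one fun t _ => mul_self_nonneg _
  have z0 : ∀ t ∈ Ioo 0 L, x t 0 = 0 := fun t ht =>
    eq_zero_of_integral_sq_nonpos hL (hxi 0) (by linarith) t (Ioo_subset_Icc_self ht)
  have z5 : ∀ t ∈ Ioo 0 L, x t 5 = 0 := fun t ht =>
    eq_zero_of_integral_sq_nonpos hL (hxi 5) (by linarith) t (Ioo_subset_Icc_self ht)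
  -- Once η and ω vanish on the open interval, so do the remaining entries of x, each being the
  -- derivative of the one before.
  have z1 : ∀ t ∈ Ioo 0 L, x t 1 = 0 := eq_zero_of_hasDerivAt (hdi 0) z0
  have z2 : ∀ t ∈ Ioo 0 L, x t 2 = 0 := eq_zero_of_hasDerivAt (hdi 1) z1
  have z3 : ∀ t ∈ Ioo 0 L, x t 3 = 0 := eq_zero_of_hasDerivAt (hdi 2) z2
  have z4 : ∀ t ∈ Ioo 0 L, x t 4 = 0 := eq_zero_of_hasDerivAt (hdi 3) z3
  have z6 : ∀ t ∈ Ioo 0 L, x t 6 = 0 := eq_zero_of_hasDerivAt (hdi 5) z5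
  have z7 : ∀ t ∈ Ioo 0 L, x t 7 = 0 := eq_zero_of_hasDerivAt (hdi 6) z6
  have z8 : ∀ t ∈ Ioo 0 L, x t 8 = 0 := eq_zero_of_hasDerivAt (hdi 7) z7
  have z9 : ∀ t ∈ Ioo 0 L, x t 9 = 0 := eq_zero_of_hasDerivAt (hdi 8) z8
  have hz : ∀ t ∈ Ioo 0 L, x t = 0 := fun t ht => by
    ext i
    fin_cases i
    exacts [z0 t ht, z1 t ht, z2 t ht, z3 t ht, z4 t ht, z5 t ht, z6 t ht, z7 t ht, z8 t ht, z9 t ht]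
  rw [← hx0]
  refine tendsto_nhds_unique ((hxc.tendsto 0).mono_left nhdsWithin_le_nhds)
    ((tendsto_const_nhds (f := 𝓝[>] (0 : ℝ))).congr' ?_)
  filter_upwards [Ioo_mem_nhdsGT hL] with t ht using (hz t ht).symm

/-- Solvability of the resolvent equation. -/
theorem exists_isRegular_resolvent (a : ℝ) {a₁ h : ℝ} (hL : 0 < L) (ha₁ : 0 < a₁) (hα : 0 < α)
    (hαβ : |β| ≤ α) (hh : 0 < h) {f₁ f₂ f₃ : ℝ → ℝ}
    (hf₁ : MemLp f₁ 2 (volume.restrict (Ioo 0 L)))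
    (hf₂ : MemLp f₂ 2 (volume.restrict (Ioo 0 L)))
    (hf₃ : MemLp f₃ 2 (volume.restrict (Ioo 0 1))) :
    ∃ u v y : ℕ → ℝ → ℝ, IsRegular L α β u v y ∧
      (∀ x ∈ Ioo 0 L, u 0 x - h * (-v 1 x - a * v 3 x - a₁ * v 5 x) = f₁ x) ∧
      (∀ x ∈ Ioo 0 L, v 0 x - h * (-u 1 x - a * u 3 x - a₁ * u 5 x) = f₂ x) ∧
      (∀ x ∈ Ioo 0 1, y 0 x - h * (-(a₁ * α) * y 1 x) = f₃ x) := by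
  set k := h * (a₁ * α) with hk
  have hk0 : 0 < k := by positivity
  set B := resolventSystem a a₁ h with hB
  set r := Real.exp (-1 / k) with hr
  -- Cutting off by an indicator makes the data integrable on the whole line, as the solvability
  -- lemmas for the linear systems require.
  have key : ∀ {b : ℝ} {f : ℝ → ℝ}, MemLp f 2 (volume.restrict (Ioo 0 b)) →
      Integrable ((Ioo 0 b).indicator f) ∧
      MemLp ((Ioo 0 b).indicator f) 2 (volume.restrict (Ioo 0 b)) := fun {b f} hf =>
    ⟨(integrable_indicator_iff measurableSet_Ioo).2 (hf.integrable one_le_two),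
      hf.indicator measurableSet_Ioo⟩
  obtain ⟨g₁i, g₁m⟩ := key hf₁
  obtain ⟨g₂i, g₂m⟩ := key hf₂
  obtain ⟨g₃i, g₃m⟩ := key hf₃
  set g₁ := (Ioo 0 L).indicator f₁ with hg₁
  set g₂ := (Ioo 0 L).indicator f₂ with hg₂
  set g₃ := (Ioo 0 1).indicator f₃ with hg₃
  let G : Fin 10 → ℝ → ℝ := fun i t =>
    ![0, 0, 0, 0, g₂ t / (h * a₁), 0, 0, 0, 0, g₁ t / (h * a₁)] i
  have hG : ∀ i, Integrable (G i) := by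
    intro i
    fin_cases i
    exacts [integrable_zero _ _ _, integrable_zero _ _ _, integrable_zero _ _ _,
      integrable_zero _ _ _, g₂i.div_const _, integrable_zero _ _ _, integrable_zero _ _ _,
      integrable_zero _ _ _, integrable_zero _ _ _, g₁i.div_const _]
  obtain ⟨w, hw0, hw⟩ := exists_isPrimitive_linear B hG hL.le
  -- Λ sends the vector at 0 to the boundary values of the homogeneous solution. There are ten
  -- unknowns and ten conditions, so uniqueness implies surjectivity.
  let Λ : (Fin 10 → ℝ) →ₗ[ℝ] (Fin 10 → ℝ) := boundaryMap (α + β * r) ∘ₗ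
    LinearMap.prod LinearMap.id (NormedSpace.exp (L • B)).toLinearMap
  have hΛ : Function.Surjective Λ := by
    refine LinearMap.injective_iff_surjective.1 ((injective_iff_map_eq_zero Λ).2 fun x₀ hx₀ => ?_)
    exact eq_zero_of_boundaryMap_eq_zero hL ha₁ hα hαβ hh hx₀
  set c := r * ∫ σ in (0 : ℝ)..1, Real.exp (σ / k) * g₃ σ / k with hc
  -- x₀ corrects the boundary values of the particular solution w, which starts at 0; βc is the
  -- contribution of the third datum to the feedback.
  obtain ⟨x₀, hx₀⟩ := hΛ (![0, 0, 0, 0, 0, 0, 0, 0, 0, β * c] - boundaryMap (α + β * r) (0, w L))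
  set x : ℝ → Fin 10 → ℝ := fun t => NormedSpace.exp (t • B) x₀ + w t with hx
  have hd : ∀ t, HasDerivAt (fun t : ℝ => NormedSpace.exp (t • B) x₀)
    (B (NormedSpace.exp (t • B) x₀)) t := fun t => hasDerivAt_exp_clm B x₀ t
  have hec : Continuous fun t : ℝ => NormedSpace.exp (t • B) x₀ :=
    continuous_iff_continuousAt.2 fun t => (hd t).continuousAt
  have hprim : ∀ i, IsPrimitive 0 L (fun t => x t i) (fun t => B (x t) i + G i t) := fun i => by
    have h1 : IsPrimitive 0 L (fun t => NormedSpace.exp (t • B) x₀ i)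
        (fun t => B (NormedSpace.exp (t • B) x₀) i) :=
      .of_hasDerivAt hL.le (fun t _ => hasDerivAt_pi.1 (hd t) i)
        ((continuous_apply i).comp (B.continuous.comp hec)).continuousOn
    refine (h1.add (hw i) hL.le).congr_right_of_eq fun t => ?_
    simp [hx, add_assoc]
  have hbd : boundaryMap (α + β * r) (x 0, x L) = ![0, 0, 0, 0, 0, 0, 0, 0, 0, β * c] := by
    have e : ((x 0, x L) : (Fin 10 → ℝ) × (Fin 10 → ℝ)) =
        (x₀, NormedSpace.exp (L • B) x₀) + (0, w L) := by
      simp [hx, hw0]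
    rw [e, map_add]
    exact eq_sub_iff_add_eq.1 hx₀
  obtain ⟨y, hy0, hy, hy1⟩ := exists_isPrimitive_transport (k := k) g₃i (x L 2)
  refine ⟨_, _, _, isRegular_of_system hL g₁m g₂m g₃m hprim hbd hy0 hy hy1, fun t ht => ?_,
    fun t ht => ?_, fun t ht => ?_⟩
  · rw [← indicator_of_mem ht f₁, ← hg₁]
    simp
    field_simp
    ring
  · rw [← indicator_of_mem ht f₂, ← hg₂]
    simp
    field_simp
    ring
  · rw [← indicator_of_mem ht f₃, ← hg₃]
    simp [hk]
    field_simp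
    ring


/-! ### Maximal dissipativity of the reference operator -/

section Generator

open scoped RealInnerProductSpace

variable {L a a₁ α β : ℝ}

theorem state_ext {U V : State L} (h1 : U.eta = V.eta) (h2 : U.omega = V.omega)
    (h3 : U.zed = V.zed) : U = V :=
  WithLp.ofLp_injective 2 (Prod.ext h1 (WithLp.ofLp_injective 2 (Prod.ext h2 h3)))

theorem state_inner (U V : State L) :
    ⟪U, V⟫ = ⟪U.eta, V.eta⟫ + (⟪U.omega, V.omega⟫ + ⟪U.zed, V.zed⟫) := by
  rw [WithLp.prod_inner_apply, WithLp.prod_inner_apply]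
  rfl

theorem L2_inner_eq {b : ℝ} (hb : 0 ≤ b) {F G : L2 0 b} {f g : ℝ → ℝ}
    (hf : F =ᵐ[volume.restrict (Ioo 0 b)] f) (hg : G =ᵐ[volume.restrict (Ioo 0 b)] g) :
    ⟪F, G⟫ = ∫ x in (0 : ℝ)..b, f x * g x := by
  rw [L2.inner_def, ← integral_Ioo_eq hb]
  refine integral_congr_ae ?_
  filter_upwards [hf, hg] with x h1 h2
  rw [h1, h2]
  simp [mul_comm]

theorem transport_const {ξ t : ℝ} (z : ℝ → ℝ) (ρ : ℝ) :
    transport (fun _ => 1 / ξ) t z ρ = -ξ * iterWeakDeriv 0 1 1 z ρ := by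
  simp [transport]

theorem opA_eta (hL : 0 < L) (τ : ℝ → ℝ) (t : ℝ) (U : (opA hL a a₁ α β τ t).domain) :
    (opA hL a a₁ α β τ t U).eta =ᵐ[volume.restrict (Ioo 0 L)]
      dispersion L a a₁ (U : State L).omega :=
  MemLp.coeFn_toLp (memLp_dispersion U.2.omega_sobolev)

theorem opA_omega (hL : 0 < L) (τ : ℝ → ℝ) (t : ℝ) (U : (opA hL a a₁ α β τ t).domain) :
    (opA hL a a₁ α β τ t U).omega =ᵐ[volume.restrict (Ioo 0 L)]
      dispersion L a a₁ (U : State L).eta :=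
  MemLp.coeFn_toLp (memLp_dispersion U.2.eta_sobolev)

theorem opA_zed (hL : 0 < L) (τ : ℝ → ℝ) (t : ℝ) (U : (opA hL a a₁ α β τ t).domain) :
    (opA hL a a₁ α β τ t U).zed =ᵐ[volume.restrict (Ioo 0 1)]
      transport τ t (U : State L).zed :=
  MemLp.coeFn_toLp (memLp_transport U.2.z_sobolev)

theorem opA_ae_eq (hL : 0 < L) {ξ t : ℝ} {u v y : ℕ → ℝ → ℝ}
    (U : (opA hL a a₁ α β (fun _ => 1 / ξ) t).domain)
    (hu : ∀ i ≤ 5, iterWeakDeriv 0 L i (U : State L).eta =ᵐ[volume.restrict (Ioo 0 L)] u i)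
    (hv : ∀ i ≤ 5, iterWeakDeriv 0 L i (U : State L).omega =ᵐ[volume.restrict (Ioo 0 L)] v i)
    (hy : ∀ i ≤ 1, iterWeakDeriv 0 1 i (U : State L).zed =ᵐ[volume.restrict (Ioo 0 1)] y i) :
    ((opA hL a a₁ α β (fun _ => 1 / ξ) t U).eta =ᵐ[volume.restrict (Ioo 0 L)]
      fun x => -v 1 x - a * v 3 x - a₁ * v 5 x) ∧
    ((opA hL a a₁ α β (fun _ => 1 / ξ) t U).omega =ᵐ[volume.restrict (Ioo 0 L)]
      fun x => -u 1 x - a * u 3 x - a₁ * u 5 x) ∧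
    ((opA hL a a₁ α β (fun _ => 1 / ξ) t U).zed =ᵐ[volume.restrict (Ioo 0 1)]
      fun ρ => -ξ * y 1 ρ) := by
  refine ⟨?_, ?_, ?_⟩
  · filter_upwards [opA_eta hL (fun _ => 1 / ξ) t U, hv 1 (by norm_num), hv 3 (by norm_num),
      hv 5 le_rfl] with x h h1 h3 h5
    rw [h, dispersion, h1, h3, h5]
  · filter_upwards [opA_omega hL (fun _ => 1 / ξ) t U, hu 1 (by norm_num), hu 3 (by norm_num),
      hu 5 le_rfl] with x h h1 h3 h5
    rw [h, dispersion, h1, h3, h5]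
  · filter_upwards [opA_zed hL (fun _ => 1 / ξ) t U, hy 1 le_rfl] with x h h1
    rw [h, transport_const, h1]

/-- With a suitable constant delay, the operator is maximal dissipative. -/
theorem maxDissipative_opA (hL : 0 < L) (a : ℝ) (ha₁ : 0 < a₁) (hα : 0 < α) (hαβ : |β| ≤ α) :
    MaxDissipative (opA hL a a₁ α β (fun _ => 1 / (a₁ * α)) 0) where
  inner_nonpos U := by
    obtain ⟨u, v, y, hr, hu, hv, hy⟩ := InDomain.exists_isRegular hL U.2
    obtain ⟨h1, h2, h3⟩ := opA_ae_eq hL U hu hv hy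
    rw [state_inner, L2_inner_eq hL.le h1 (hu 0 (by norm_num)),
      L2_inner_eq hL.le h2 (hv 0 (by norm_num)),
      L2_inner_eq zero_le_one h3 (hy 0 (by norm_num)), ← add_assoc]
    exact hr.dissipative hL a ha₁ hαβ
  surj h hh x := by
    obtain ⟨u, v, y, hr, e1, e2, e3⟩ := exists_isRegular_resolvent a hL ha₁ hα hαβ hh
      (Lp.memLp x.eta) (Lp.memLp x.omega) (Lp.memLp x.zed)
    have hd := hr.inDomain hL
    let U₀ : State L := WithLp.toLp 2 (hd.eta_sobolev.memLp.toLp,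
      WithLp.toLp 2 (hd.omega_sobolev.memLp.toLp, hd.z_sobolev.memLp.toLp))
    have c1 : U₀.eta =ᵐ[volume.restrict (Ioo 0 L)] u 0 := MemLp.coeFn_toLp hd.eta_sobolev.memLp
    have c2 : U₀.omega =ᵐ[volume.restrict (Ioo 0 L)] v 0 := MemLp.coeFn_toLp hd.omega_sobolev.memLp
    have c3 : U₀.zed =ᵐ[volume.restrict (Ioo 0 1)] y 0 := MemLp.coeFn_toLp hd.z_sobolev.memLp
    let U : (opA hL a a₁ α β (fun _ => 1 / (a₁ * α)) 0).domain :=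
      ⟨U₀, hd.congr c1.symm c2.symm c3.symm⟩
    obtain ⟨du, dv, dy⟩ := hr.ae_eq hL
    obtain ⟨h1, h2, h3⟩ := opA_ae_eq (a := a) (a₁ := a₁) hL U
      (fun i hi => (iterWeakDeriv_congr c1).trans (du i hi))
      (fun i hi => (iterWeakDeriv_congr c2).trans (dv i hi))
      (fun i hi => (iterWeakDeriv_congr c3).trans (dy i hi))
    refine ⟨U, state_ext (Lp.ext ?_) (Lp.ext ?_) (Lp.ext ?_)⟩
    · change ⇑(U₀.eta - h • (opA hL a a₁ α β (fun _ => 1 / (a₁ * α)) 0 U).eta)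
        =ᵐ[volume.restrict (Ioo 0 L)] _
      filter_upwards [Lp.coeFn_sub U₀.eta (h • (opA hL a a₁ α β (fun _ => 1 / (a₁ * α)) 0 U).eta),
        Lp.coeFn_smul h (opA hL a a₁ α β (fun _ => 1 / (a₁ * α)) 0 U).eta, c1, h1,
        ae_restrict_mem measurableSet_Ioo] with t k1 k2 k3 k4 ht
      rw [k1, Pi.sub_apply, k2, Pi.smul_apply, k3, k4, ← e1 t ht, smul_eq_mul]
    · change ⇑(U₀.omega - h • (opA hL a a₁ α β (fun _ => 1 / (a₁ * α)) 0 U).omega)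
        =ᵐ[volume.restrict (Ioo 0 L)] _
      filter_upwards [Lp.coeFn_sub U₀.omega
          (h • (opA hL a a₁ α β (fun _ => 1 / (a₁ * α)) 0 U).omega),
        Lp.coeFn_smul h (opA hL a a₁ α β (fun _ => 1 / (a₁ * α)) 0 U).omega, c2, h2,
        ae_restrict_mem measurableSet_Ioo] with t k1 k2 k3 k4 ht
      rw [k1, Pi.sub_apply, k2, Pi.smul_apply, k3, k4, ← e2 t ht, smul_eq_mul]
    · change ⇑(U₀.zed - h • (opA hL a a₁ α β (fun _ => 1 / (a₁ * α)) 0 U).zed)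
        =ᵐ[volume.restrict (Ioo 0 1)] _
      filter_upwards [Lp.coeFn_sub U₀.zed (h • (opA hL a a₁ α β (fun _ => 1 / (a₁ * α)) 0 U).zed),
        Lp.coeFn_smul h (opA hL a a₁ α β (fun _ => 1 / (a₁ * α)) 0 U).zed, c3, h3,
        ae_restrict_mem measurableSet_Ioo] with t k1 k2 k3 k4 ht
      rw [k1, Pi.sub_apply, k2, Pi.smul_apply, k3, k4, ← e3 t ht, smul_eq_mul]

end Generator


open scoped RealInnerProductSpace in
/-- Symmetric, bounded, coercive coefficients are admissible, together with their inverses. -/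
theorem IsCoeff.exists_of_coercive {X : Type*} [NormedAddCommGroup X] [InnerProductSpace ℝ X]
    [CompleteSpace X] {N : ℝ → X →L[ℝ] X} {K c : ℝ} (hc : 0 < c) (hK : 0 < K)
    (lip : ∀ s t, ‖N s - N t‖ ≤ K * |s - t|) (bound : ∀ t, ‖N t‖ ≤ K)
    (symm : ∀ t u v, ⟪N t u, v⟫ = ⟪u, N t v⟫) (co : ∀ t u, c * ‖u‖ ^ 2 ≤ ⟪N t u, u⟫) :
    ∃ P K' c', IsCoeff P N K' c' ∧ ∀ t, DifferentiableAt ℝ N t → DifferentiableAt ℝ P t := by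
  -- Lax–Milgram: a coercive bounded operator is invertible.
  have hu : ∀ t, IsUnit (N t) := fun t =>
    ContinuousLinearMap.isUnit_of_forall_le_norm_inner_map (𝕜 := ℝ) (N t) (c := ⟨c, hc.le⟩) hc
      fun x => by
        rw [mul_comm]
        exact (co t x).trans (le_abs_self _)
  let P : ℝ → X →L[ℝ] X := fun t => Ring.inverse (N t)
  have hPN : ∀ t u, P t (N t u) = u := fun t u => by
    have := Ring.inverse_mul_cancel _ (hu t)
    exact congrArg (fun f : X →L[ℝ] X => f u) this
  have hNP : ∀ t u, N t (P t u) = u := fun t u => by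
    have := Ring.mul_inverse_cancel _ (hu t)
    exact congrArg (fun f : X →L[ℝ] X => f u) this
  have low : ∀ t u, c * ‖u‖ ≤ ‖N t u‖ := fun t u => by
    have h1 := (co t u).trans (real_inner_le_norm _ _)
    rcases (norm_nonneg u).eq_or_lt with h0 | h0
    · rw [← h0, mul_zero]
      exact norm_nonneg _
    · exact le_of_mul_le_mul_right (by nlinarith) h0
  have bP : ∀ t, ‖P t‖ ≤ c⁻¹ := fun t => (P t).opNorm_le_bound (by positivity) fun v => by
    have := low t (P t v)
    rw [hNP] at this
    rw [inv_mul_eq_div, le_div_iff₀ hc]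
    linarith
  have c'1 : c⁻¹ * K * c⁻¹ ≤ K + c⁻¹ + c⁻¹ * K * c⁻¹ := by
    have : 0 < c⁻¹ := by positivity
    linarith
  -- One constant dominates the bounds and Lipschitz constants of both N and P. The inverse is
  -- coercive with constant c/K², since ⟨Pv, v⟩ ≥ c‖Pv‖² and ‖v‖ ≤ K‖Pv‖.
  refine ⟨P, K + c⁻¹ + c⁻¹ * K * c⁻¹, min c (c / K ^ 2), ⟨?_, by positivity, fun s t => ?_,
    fun s t => ?_, fun t => ?_, fun t => ?_, fun t u v => ?_, symm, fun t v => ?_, fun t u => ?_,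
    hPN⟩, fun t ht => ht.inverse (hu t)⟩
  · positivity
  -- The identity for differences of inverses transfers the Lipschitz bound from N to P.
  · have e : P s - P t = P s * (N t - N s) * P t := by
      ext v
      change P s v - P t v = P s (N t (P t v) - N s (P t v))
      rw [map_sub, hNP, hPN]
    rw [e]
    calc ‖P s * (N t - N s) * P t‖ ≤ ‖P s‖ * ‖N t - N s‖ * ‖P t‖ :=
          (norm_mul_le _ _).trans (by gcongr; exact norm_mul_le _ _)
      _ ≤ c⁻¹ * (K * |t - s|) * c⁻¹ := by
          gcongr
          exacts [bP s, lip t s, bP t]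
      _ = c⁻¹ * K * c⁻¹ * |s - t| := by rw [abs_sub_comm]; ring
      _ ≤ _ := by gcongr
  · refine (lip s t).trans ?_
    have : 0 < c⁻¹ := by positivity
    have : 0 < c⁻¹ * K * c⁻¹ := by positivity
    gcongr
    linarith
  · refine (bP t).trans ?_
    have : 0 < c⁻¹ * K * c⁻¹ := by positivity
    linarith
  · refine (bound t).trans ?_
    have : 0 < c⁻¹ := by positivity
    have : 0 < c⁻¹ * K * c⁻¹ := by positivity
    linarith
  · have h := symm t (P t u) (P t v)
    rw [hNP, hNP] at h
    exact h.symm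
  · have h1 : ‖v‖ ≤ K * ‖P t v‖ := by
      have := (N t).le_of_opNorm_le (bound t) (P t v)
      rwa [hNP] at this
    have h2 := co t (P t v)
    rw [hNP] at h2
    calc min c (c / K ^ 2) * ‖v‖ ^ 2 ≤ c / K ^ 2 * (K * ‖P t v‖) ^ 2 := by
          gcongr
          exact min_le_right _ _
      _ = c * ‖P t v‖ ^ 2 := by field_simp
      _ ≤ ⟪v, P t v⟫ := h2
      _ = ⟪P t v, v⟫ := real_inner_comm _ _
  · refine le_trans ?_ (co t u)
    gcongr
    exact min_le_left _ _

/-! ### Multiplication operators on the delay component -/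

section Multiplication

open scoped RealInnerProductSpace

theorem memLp_coord : MemLp (fun ρ : ℝ => ρ) ∞ (volume.restrict (Ioo (0 : ℝ) 1)) := by
  refine memLp_top_of_bound (by fun_prop) 1 ?_
  filter_upwards [ae_restrict_mem measurableSet_Ioo] with ρ hρ
  rw [Real.norm_eq_abs, abs_of_pos hρ.1]
  exact hρ.2.le

/-- Multiplication by the variable on `L²(0, 1)`. -/
noncomputable def mulCoord : L2 0 1 →L[ℝ] L2 0 1 :=
  (ContinuousLinearMap.mul ℝ ℝ).holderL (volume.restrict (Ioo (0 : ℝ) 1)) ∞ 2 2 memLp_coord.toLp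

theorem mulCoord_ae (z : L2 0 1) :
    mulCoord z =ᵐ[volume.restrict (Ioo (0 : ℝ) 1)] fun ρ => ρ * z ρ := by
  have h : mulCoord z =ᵐ[volume.restrict (Ioo (0 : ℝ) 1)]
      fun ρ => (ContinuousLinearMap.mul ℝ ℝ) ((memLp_coord.toLp : Lp ℝ ∞ _) ρ) (z ρ) :=
    ContinuousLinearMap.coeFn_holder (r := 2) (ContinuousLinearMap.mul ℝ ℝ) memLp_coord.toLp z
  filter_upwards [h, memLp_coord.coeFn_toLp] with ρ h1 h2
  rw [h1, h2, ContinuousLinearMap.mul_apply']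

theorem mulCoord_inner (z w : L2 0 1) :
    ⟪mulCoord z, w⟫ = ∫ ρ in (0 : ℝ)..1, ρ * z ρ * w ρ :=
  L2_inner_eq zero_le_one (mulCoord_ae z) EventuallyEq.rfl

theorem mulCoord_symm (z w : L2 0 1) : ⟪mulCoord z, w⟫ = ⟪z, mulCoord w⟫ := by
  rw [real_inner_comm (mulCoord w), mulCoord_inner, mulCoord_inner]
  congr 1
  funext ρ
  ring

theorem mulCoord_nonneg (z : L2 0 1) : 0 ≤ ⟪mulCoord z, z⟫ := by
  rw [mulCoord_inner]
  refine intervalIntegral.integral_nonneg zero_le_one fun ρ hρ => ?_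
  rw [mul_assoc]
  exact mul_nonneg hρ.1 (mul_self_nonneg _)

theorem mulCoord_le (z : L2 0 1) : ⟪mulCoord z, z⟫ ≤ ‖z‖ ^ 2 := by
  rw [← real_inner_self_eq_norm_sq, ← sub_nonneg, ← inner_sub_left,
    L2_inner_eq zero_le_one (f := fun ρ => (1 - ρ) * z ρ) ?_ EventuallyEq.rfl]
  · refine intervalIntegral.integral_nonneg zero_le_one fun ρ hρ => ?_
    rw [mul_assoc]
    exact mul_nonneg (sub_nonneg.2 hρ.2) (mul_self_nonneg _)
  · filter_upwards [Lp.coeFn_sub z (mulCoord z), mulCoord_ae z] with ρ h1 h2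
    rw [h1, Pi.sub_apply, h2]
    ring

variable {L : ℝ}

/-- The operator `(η, ω, z) ↦ (0, 0, S z)` on states. -/
noncomputable def onZed (L : ℝ) (S : L2 0 1 →L[ℝ] L2 0 1) : State L →L[ℝ] State L :=
  (WithLp.prodContinuousLinearEquiv 2 ℝ (L2 0 L)
      (WithLp 2 (L2 0 L × L2 0 1))).symm.toContinuousLinearMap ∘L
    ContinuousLinearMap.inr ℝ _ _ ∘L
    (WithLp.prodContinuousLinearEquiv 2 ℝ (L2 0 L) (L2 0 1)).symm.toContinuousLinearMap ∘L
    ContinuousLinearMap.inr ℝ _ _ ∘L S ∘L ContinuousLinearMap.snd ℝ _ _ ∘L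
    (WithLp.prodContinuousLinearEquiv 2 ℝ (L2 0 L) (L2 0 1)).toContinuousLinearMap ∘L
    ContinuousLinearMap.snd ℝ _ _ ∘L
    (WithLp.prodContinuousLinearEquiv 2 ℝ (L2 0 L)
      (WithLp 2 (L2 0 L × L2 0 1))).toContinuousLinearMap

theorem onZed_eta (S : L2 0 1 →L[ℝ] L2 0 1) (U : State L) : (onZed L S U).eta = 0 := rfl

theorem onZed_omega (S : L2 0 1 →L[ℝ] L2 0 1) (U : State L) : (onZed L S U).omega = 0 := rfl

theorem onZed_zed (S : L2 0 1 →L[ℝ] L2 0 1) (U : State L) : (onZed L S U).zed = S U.zed := rfl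

/-- The operator `(η, ω, z) ↦ (η, ω, (p - q ρ) z)` on states. -/
noncomputable def coeffN (L p q : ℝ) : State L →L[ℝ] State L :=
  -- The bracket is the projection onto the first two components.
  (1 - onZed L 1) + p • onZed L 1 - q • onZed L mulCoord

variable (p q : ℝ) (U V : State L)

theorem coeffN_eta : (coeffN L p q U).eta = U.eta := by
  change U.eta - (onZed L 1 U).eta + p • (onZed L 1 U).eta - q • (onZed L mulCoord U).eta = _
  simp [onZed_eta]

theorem coeffN_omega : (coeffN L p q U).omega = U.omega := by
  change U.omega - (onZed L 1 U).omega + p • (onZed L 1 U).omega -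
    q • (onZed L mulCoord U).omega = _
  simp [onZed_omega]

theorem coeffN_zed : (coeffN L p q U).zed = p • U.zed - q • mulCoord U.zed := by
  change U.zed - (onZed L 1 U).zed + p • (onZed L 1 U).zed - q • (onZed L mulCoord U).zed = _
  simp [onZed_zed]

theorem coeffN_symm : ⟪coeffN L p q U, V⟫ = ⟪U, coeffN L p q V⟫ := by
  rw [state_inner, state_inner, coeffN_eta, coeffN_eta, coeffN_omega, coeffN_omega, coeffN_zed,
    coeffN_zed, inner_sub_left, inner_sub_right, inner_smul_left, inner_smul_left,
    inner_smul_right, inner_smul_right, mulCoord_symm]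
  simp

/-- The multiplier p - qρ is affine on [0,1], so it is bounded below by the smaller of its end
values p and p - q. -/
theorem coeffN_coercive {c : ℝ} (hc1 : c ≤ 1) (hc : c ≤ p) (hq : c ≤ p - q) :
    c * ‖U‖ ^ 2 ≤ ⟪coeffN L p q U, U⟫ := by
  have h1 := mulCoord_nonneg U.zed
  have h2 := mulCoord_le U.zed
  have hz : c * ‖U.zed‖ ^ 2 ≤ p * ‖U.zed‖ ^ 2 - q * ⟪mulCoord U.zed, U.zed⟫ := by
    rcases le_total 0 q with h | h
    · have := mul_le_mul_of_nonneg_left h2 h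
      have := mul_le_mul_of_nonneg_right hq (sq_nonneg ‖U.zed‖)
      linarith
    · have := mul_nonpos_of_nonpos_of_nonneg h h1
      have := mul_le_mul_of_nonneg_right hc (sq_nonneg ‖U.zed‖)
      linarith
  have hη := mul_le_mul_of_nonneg_right hc1 (sq_nonneg ‖U.eta‖)
  have hω := mul_le_mul_of_nonneg_right hc1 (sq_nonneg ‖U.omega‖)
  rw [← real_inner_self_eq_norm_sq, state_inner, state_inner, coeffN_eta, coeffN_omega, coeffN_zed,
    inner_sub_left, real_inner_smul_left, real_inner_smul_left, real_inner_self_eq_norm_sq,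
    real_inner_self_eq_norm_sq, real_inner_self_eq_norm_sq]
  linarith

/-- The operator is affine in (p, q), so its regularity in time reduces to that of two scalar
functions. -/
theorem coeffN_sub (p' q' : ℝ) : coeffN L p q - coeffN L p' q' =
    (p - p') • onZed L 1 - (q - q') • onZed L mulCoord := by
  rw [coeffN, coeffN]
  module

theorem norm_coeffN_sub_le (p' q' : ℝ) : ‖coeffN L p q - coeffN L p' q'‖ ≤
    |p - p'| * ‖onZed L 1‖ + |q - q'| * ‖onZed L mulCoord‖ := by
  rw [coeffN_sub]
  exact (norm_sub_le _ _).trans (add_le_add (norm_smul (p - p') (onZed L 1)).le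
    (norm_smul (q - q') (onZed L mulCoord)).le)

theorem norm_coeffN_le : ‖coeffN L p q‖ ≤
    ‖(1 : State L →L[ℝ] State L) - onZed L 1‖ + |p| * ‖onZed L 1‖ + |q| * ‖onZed L mulCoord‖ := by
  exact (norm_sub_le _ _).trans (add_le_add ((norm_add_le _ _).trans
    (add_le_add le_rfl (norm_smul p (onZed L 1)).le)) (norm_smul q (onZed L mulCoord)).le)

end Multiplication


/-! ### The factorization A(t) = N(t)A -/

section Factorization

variable {L a a₁ α β M d : ℝ} {τ : ℝ → ℝ}

/-- The operators `A(t)` arise from the one with constant delay `1 / ξ` by multiplication of the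
third component. -/
theorem coeffN_opA (hL : 0 < L) {ξ : ℝ} (hξ : 0 < ξ) {t : ℝ} (hτt : 0 < τ t) (U : State L)
    (hU : U ∈ domainA hL α β) :
    coeffN L (1 / (ξ * τ t)) (derivWithin τ (Ici 0) t / (ξ * τ t))
      (opA hL a a₁ α β (fun _ => 1 / ξ) 0 ⟨U, hU⟩) = opA hL a a₁ α β τ t ⟨U, hU⟩ := by
  refine state_ext ?_ ?_ ?_
  · rw [coeffN_eta]
    exact Lp.ext ((opA_eta hL _ 0 ⟨U, hU⟩).trans (opA_eta hL τ t ⟨U, hU⟩).symm)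
  · rw [coeffN_omega]
    exact Lp.ext ((opA_omega hL _ 0 ⟨U, hU⟩).trans (opA_omega hL τ t ⟨U, hU⟩).symm)
  · rw [coeffN_zed]
    set Z := (opA hL a a₁ α β (fun _ => 1 / ξ) 0 ⟨U, hU⟩).zed with hZ
    set p := 1 / (ξ * τ t) with hp
    set q := derivWithin τ (Ici 0) t / (ξ * τ t) with hq
    refine Lp.ext ?_
    filter_upwards [Lp.coeFn_sub (p • Z) (q • mulCoord Z), Lp.coeFn_smul p Z,
      Lp.coeFn_smul q (mulCoord Z), mulCoord_ae Z, opA_zed (a := a) (a₁ := a₁) hL _ 0 ⟨U, hU⟩,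
      opA_zed (a := a) (a₁ := a₁) hL τ t ⟨U, hU⟩] with ρ h1 h2 h3 h4 h5 h6
    rw [h1, Pi.sub_apply, h2, h3, Pi.smul_apply, Pi.smul_apply, h4, h6, hZ, h5, transport_const,
      transport, hp, hq, smul_eq_mul, smul_eq_mul]
    field_simp
    ring

theorem abs_inv_sub_inv_le {m x y : ℝ} (hm : 0 < m) (hx : m ≤ x) (hy : m ≤ y) :
    |1 / x - 1 / y| ≤ |x - y| / m ^ 2 := by
  have hx0 := hm.trans_le hx
  have hy0 := hm.trans_le hy
  rw [div_sub_div _ _ hx0.ne' hy0.ne', one_mul, mul_one, abs_div, abs_sub_comm y x,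
    abs_of_pos (mul_pos hx0 hy0), sq]
  gcongr

theorem ae_differentiableAt_of_lip {f : ℝ → ℝ} {K : ℝ} (hK : 0 ≤ K)
    (h : ∀ s t, |f s - f t| ≤ K * |s - t|) : ∀ᵐ t, DifferentiableAt ℝ f t := by
  have : LipschitzWith K.toNNReal f := LipschitzWith.of_dist_le_mul fun s t => by
    rw [Real.dist_eq, Real.dist_eq, Real.coe_toNNReal _ hK]
    exact h s t
  exact this.ae_differentiableAt_real

/-- The multiplier has p = 1/(ξτ) and q = τ'/(ξτ). Both are Lipschitz on [0,T] because τ is bounded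
below by τ(0) and τ' is Lipschitz there; the constants may grow with T, as τ' and τ'' are bounded
only locally. -/
theorem IsDelay.isFactored_opA (hτ : IsDelay M d τ) (hL : 0 < L) (hξ : 0 < a₁ * α) :
    IsFactored (opA hL a a₁ α β τ) (opA hL a a₁ α β (fun _ => 1 / (a₁ * α)) 0) := by
  intro T hT
  set ξ := a₁ * α
  obtain ⟨K, hK, lτ, lσ⟩ := hτ.exists_lipschitz hT
  -- Composition with the projection onto [0,T] extends the coefficients to all times with the same
  -- bounds.
  let pr : ℝ → ℝ := fun t => projIcc 0 T hT.le t
  have pr_mem : ∀ t, pr t ∈ Icc 0 T := fun t => (projIcc 0 T hT.le t).2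
  have pr_lip : ∀ s t, |pr s - pr t| ≤ |s - t| := fun s t => abs_projIcc_sub_projIcc hT.le
  have pr_eq : ∀ t ∈ Icc 0 T, pr t = t := fun t ht => by simp [pr, projIcc_of_mem hT.le ht]
  let θ : ℝ → ℝ := fun t => τ (pr t)
  let σ : ℝ → ℝ := fun t => derivWithin τ (Ici 0) (pr t)
  have θ_lip : ∀ s t, |θ s - θ t| ≤ K * |s - t| := fun s t =>
    (lτ _ (pr_mem s) _ (pr_mem t)).trans (mul_le_mul_of_nonneg_left (pr_lip s t) hK)
  have σ_lip : ∀ s t, |σ s - σ t| ≤ K * |s - t| := fun s t =>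
    (lσ _ (pr_mem s) _ (pr_mem t)).trans (mul_le_mul_of_nonneg_left (pr_lip s t) hK)
  have τ0 : 0 < τ 0 := hτ.pos
  have θ_low : ∀ t, τ 0 ≤ θ t := fun t => hτ.lower _ (pr_mem t).1
  have θ_up : ∀ t, θ t ≤ M := fun t => hτ.upper _ (pr_mem t).1
  have θ_pos : ∀ t, 0 < θ t := fun t => τ0.trans_le (θ_low t)
  have hM : 0 < M := (θ_pos 0).trans_le (θ_up 0)
  have σ_le : ∀ t, σ t ≤ d := fun t => hτ.deriv_le _ (pr_mem t).1
  -- The hypotheses bound τ' only from above; the two-sided bound comes from its Lipschitz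
  -- continuity.
  set S := |σ 0| + K * T
  have hS : 0 ≤ S := by positivity
  have σ_abs : ∀ t, |σ t| ≤ S := fun t => by
    have h1 : |σ t - σ 0| ≤ K * T := by
      refine (lσ _ (pr_mem t) _ (pr_mem 0)).trans ?_
      gcongr
      rw [pr_eq 0 ⟨le_rfl, hT.le⟩, sub_zero, abs_of_nonneg (pr_mem t).1]
      exact (pr_mem t).2
    have h2 := abs_add_le (σ t - σ 0) (σ 0)
    rw [sub_add_cancel] at h2
    linarith
  let p : ℝ → ℝ := fun t => 1 / (ξ * θ t)
  let q : ℝ → ℝ := fun t => σ t / (ξ * θ t)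
  have q_eq : ∀ t, q t = σ t * p t := fun t => by simp only [p, q]; ring
  set b := 1 / (ξ * τ 0)
  have hb : 0 ≤ b := by positivity
  have p_pos : ∀ t, 0 < p t := fun t => by have := θ_pos t; positivity
  have p_abs : ∀ t, |p t| ≤ b := fun t => by
    rw [abs_of_pos (p_pos t)]
    have := θ_low t
    exact one_div_le_one_div_of_le (by positivity) (by gcongr)
  have q_abs : ∀ t, |q t| ≤ S * b := fun t => by
    rw [q_eq, abs_mul]
    exact mul_le_mul (σ_abs t) (p_abs t) (abs_nonneg _) hS
  set Kp := ξ * K / (ξ * τ 0) ^ 2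
  have hKp : 0 ≤ Kp := by positivity
  have p_lip : ∀ s t, |p s - p t| ≤ Kp * |s - t| := fun s t => by
    have hs := θ_low s
    have ht := θ_low t
    refine (abs_inv_sub_inv_le (m := ξ * τ 0) (by positivity) (by gcongr) (by gcongr)).trans ?_
    rw [← mul_sub, abs_mul, abs_of_pos hξ]
    calc ξ * |θ s - θ t| / (ξ * τ 0) ^ 2 ≤ ξ * (K * |s - t|) / (ξ * τ 0) ^ 2 := by
          gcongr; exact θ_lip s t
      _ = Kp * |s - t| := by ring
  set Kq := S * Kp + K * b
  have hKq : 0 ≤ Kq := by positivity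
  have q_lip : ∀ s t, |q s - q t| ≤ Kq * |s - t| := fun s t => by
    rw [q_eq, q_eq, show σ s * p s - σ t * p t = σ s * (p s - p t) + (σ s - σ t) * p t by ring]
    refine (abs_add_le _ _).trans ?_
    rw [abs_mul, abs_mul]
    calc |σ s| * |p s - p t| + |σ s - σ t| * |p t|
        ≤ S * (Kp * |s - t|) + K * |s - t| * b := by
          gcongr
          exacts [σ_abs s, p_lip s t, σ_lip s t, p_abs t]
      _ = Kq * |s - t| := by ring
  have hd := sub_pos.2 hτ.lt_one
  -- The end values of the multiplier are 1/(ξτ) and (1 - τ')/(ξτ). Both numerators are at least 1 -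
  -- d and both denominators at most ξM; the 1 belongs to the first two components.
  set c := min 1 ((1 - d) / (ξ * M))
  have c_le : c ≤ (1 - d) / (ξ * M) := min_le_right _ _
  have pq_low : ∀ t r, 1 - d ≤ r → (1 - d) / (ξ * M) ≤ r / (ξ * θ t) := fun t r hr => by
    have h1 := θ_pos t
    have h2 := θ_up t
    exact div_le_div₀ (hd.le.trans hr) hr (by positivity) (by gcongr)
  set B := Kp * ‖onZed L 1‖ + Kq * ‖onZed L mulCoord‖
  set B' := ‖(1 : State L →L[ℝ] State L) - onZed L 1‖ + b * ‖onZed L 1‖ +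
    S * b * ‖onZed L mulCoord‖
  have hB : 0 ≤ B := by positivity
  have hB' : 0 ≤ B' := by positivity
  -- The summand 1 keeps the common constant strictly positive, as the construction of the inverse
  -- demands.
  have N_lip : ∀ s t, ‖coeffN L (p s) (q s) - coeffN L (p t) (q t)‖ ≤
      (B + B' + 1) * |s - t| := fun s t => by
    refine (norm_coeffN_sub_le _ _ _ _).trans ?_
    calc |p s - p t| * ‖onZed L 1‖ + |q s - q t| * ‖onZed L mulCoord‖
        ≤ Kp * |s - t| * ‖onZed L 1‖ + Kq * |s - t| * ‖onZed L mulCoord‖ := by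
          gcongr
          exacts [p_lip s t, q_lip s t]
      _ = B * |s - t| := by ring
      _ ≤ (B + B' + 1) * |s - t| := by gcongr; linarith
  have N_le : ∀ t, ‖coeffN L (p t) (q t)‖ ≤ B + B' + 1 := fun t => by
    refine (norm_coeffN_le _ _).trans ?_
    have : ‖(1 : State L →L[ℝ] State L) - onZed L 1‖ + |p t| * ‖onZed L 1‖ +
        |q t| * ‖onZed L mulCoord‖ ≤ B' :=
      add_le_add (add_le_add le_rfl (mul_le_mul_of_nonneg_right (p_abs t) (norm_nonneg _)))
        (mul_le_mul_of_nonneg_right (q_abs t) (norm_nonneg _))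
    linarith
  have p_low : ∀ t, (1 - d) / (ξ * M) ≤ p t := fun t =>
    pq_low t 1 (by linarith [hτ.nonneg])
  have pq_low' : ∀ t, (1 - d) / (ξ * M) ≤ p t - q t := fun t => by
    have := pq_low t (1 - σ t) (by linarith [σ_le t])
    simpa only [p, q, ← sub_div] using this
  obtain ⟨P, K', c', hP, hPd⟩ := IsCoeff.exists_of_coercive (N := fun t => coeffN L (p t) (q t))
    (K := B + B' + 1) (c := c) (by positivity) (by positivity) N_lip N_le
    (fun t => coeffN_symm _ _) (fun t U => coeffN_coercive _ _ _ (min_le_left _ _)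
      (c_le.trans (p_low t)) (c_le.trans (pq_low' t)))
  refine ⟨P, _, K', c', hP, ?_, fun t ht U W => ?_⟩
  -- Rademacher's theorem is applied only to the scalar functions p and q; inversion then preserves
  -- differentiability.
  · filter_upwards [ae_differentiableAt_of_lip hKp p_lip, ae_differentiableAt_of_lip hKq q_lip]
      with t h1 h2
    exact hPd t (((differentiableAt_const _).add (h1.smul_const _)).sub (h2.smul_const _))
  · have key := coeffN_opA (a := a) (a₁ := a₁) (α := α) (β := β) (t := t) hL hξ
      (by simpa [θ, pr_eq t ht] using θ_pos t)
    have e1 : p t = 1 / (ξ * τ t) := by simp only [p, θ, pr_eq t ht]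
    have e2 : q t = derivWithin τ (Ici 0) t / (ξ * τ t) := by simp only [q, σ, θ, pr_eq t ht]
    simp only [e1, e2, LinearPMap.mem_graph_iff]
    constructor
    · rintro ⟨V, rfl, rfl⟩
      exact ⟨_, ⟨⟨V, V.2⟩, rfl, rfl⟩, key V V.2⟩
    · rintro ⟨_, ⟨V, rfl, rfl⟩, rfl⟩
      exact ⟨⟨V, V.2⟩, rfl, (key V V.2).symm⟩

end Factorization

/-- Since 0 ≤ d < 1, the quotient is at least a₁² + 1, which is at least 2a₁. So the hypothesis
gives |β| ≤ α, all that dissipativity needs. -/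
theorem abs_le_of_feedback {a₁ α β d : ℝ} (ha₁ : 0 < a₁) (hd0 : 0 ≤ d) (hd1 : d < 1)
    (h : |β| / (2 * a₁) * ((a₁ ^ 2 + 1 - d) / (1 - d)) < α) : 0 < α ∧ |β| ≤ α := by
  have hd := sub_pos.2 hd1
  have h1 : a₁ ^ 2 + 1 ≤ (a₁ ^ 2 + 1 - d) / (1 - d) := by
    rw [le_div_iff₀ hd]
    nlinarith [mul_nonneg hd0 (sq_nonneg a₁)]
  have h2 : |β| ≤ |β| / (2 * a₁) * (a₁ ^ 2 + 1) := by
    rw [div_mul_eq_mul_div, le_div_iff₀ (by positivity)]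
    nlinarith [mul_nonneg (abs_nonneg β) (sq_nonneg (a₁ - 1))]
  have h3 : |β| / (2 * a₁) * (a₁ ^ 2 + 1) ≤ |β| / (2 * a₁) * ((a₁ ^ 2 + 1 - d) / (1 - d)) := by
    gcongr
  have h4 := h2.trans (h3.trans h.le)
  exact ⟨((abs_nonneg β).trans (h2.trans h3)).trans_lt h, h4⟩

end DelayedBoussinesq

open DelayedBoussinesq in
theorem theorem2p2 (L : ℝ) (hL : 0 < L) (a a₁ : ℝ) (ha : 0 < a) (ha₁ : 0 < a₁)
    (M d : ℝ) (τ : ℝ → ℝ) (hτ : IsDelay M d τ)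
    (α β : ℝ) (hαβ : |β| / (2 * a₁) * ((a₁ ^ 2 + 1 - d) / (1 - d)) < α)
    (U₀ : State L) :
    (∃ U : ℝ → State L, IsMildSolution (opA hL a a₁ α β τ) U ∧ U 0 = U₀) ∧
    (∀ U V : ℝ → State L,
      IsMildSolution (opA hL a a₁ α β τ) U → IsMildSolution (opA hL a a₁ α β τ) V →
      U 0 = U₀ → V 0 = U₀ → ∀ t ≥ 0, U t = V t) ∧
    (U₀ ∈ (opA hL a a₁ α β τ 0).domain →
      ∀ U : ℝ → State L, IsMildSolution (opA hL a a₁ α β τ) U → U 0 = U₀ →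
        IsClassicalSolution (opA hL a a₁ α β τ) U ∧
        ContinuousIntoDomain (opA hL a a₁ α β τ 0) U ∧
        ContDiffOn ℝ 1 U (Ici 0)) := by
  obtain ⟨hα, hβ⟩ := abs_le_of_feedback ha₁ hτ.nonneg hτ.lt_one hαβ
  exact (hτ.isFactored_opA hL (mul_pos ha₁ hα)).wellPosed (maxDissipative_opA hL a ha₁ hα hβ) U₀
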